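/- Let $d\ge 1$ and let $L^\infty_0(\mathbb R^d)$ be the space of complex-valued, bounded, compactly supported functions on $\mathbb R^d$. Let $T$ be a sublinear operator (that is, $|T(f+g)|\le |Tf|+|Tg|$ and $|T(\lambda f)|=|\lambda||Tf|$ almost everywhere) mapping $L^\infty_0(\mathbb R^d)$ into the locally integrable functions. A countable collection $\mathcal S$ of (axis-parallel) cubes is $\tfrac12$-sparse if there are pairwise disjoint measurable sets $E_Q\subset Q$, $Q\in\mathcal S$, with $|E_Q|\ge\frac12|Q|$. Write $\langle f\rangle_{p,Q}=\big(\frac1{|Q|}\int_Q|f|^p\big)^{1/p}$, and let $\|T\|_{(p_1,p_2),\mathsf{sparse}}$ be the least constant $A$ such that for all $f_1,f_2\in L^\infty_0(\mathbb R^d)$ there is a $\tfrac12$-sparse collection $\mathcal S$ with $$|\langle Tf_1,f_2\rangle|\le A\sum_{Q\in\mathcal S}|Q|\,\langle f_1\rangle_{p_1,Q}\langle f_2\rangle_{p_2,Q}.$$ Assume that, for some constant $C\ge 0$, $$\|T\|_{(1+\frac1t,\,1+\frac1t),\mathsf{sparse}}\le C\,t\qquad\text{for all } t>1 .$$ A weight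 is a nonnegative locally integrable function $w$; $\|g\|_{L^p(w)}=(\int|g|^pw)^{1/p}$, also when $w$ is replaced by a measurable $[0,\infty]$-valued function. Let $p'=\frac p{p-1}$, let $\mathrm M$ be the Hardy–Littlewood maximal function $\mathrm Mg(x)=\sup_{Q\ni x}\langle g\rangle_{1,Q}$, the supremum over all cubes, and $\mathrm M_rg=\mathrm M(|g|^r)^{1/r}$. Set $$[w]_{A_p}=\sup_Q\Big(\frac1{|Q|}\int_Qw\Big)\Big(\frac1{|Q|}\int_Qw^{1-p'}\Big)^{p-1}\ (1<p<\infty),\qquad [w]_{A_1}=\sup_Q\frac{\frac1{|Q|}\int_Qw}{\operatorname{ess\,inf}_Qw},\qquad [w]_{A_\infty}=\sup_Q\frac{\int_Q\mathrm M(w\mathbf 1_Q)}{\int_Qw},$$ and say $w\in A_p$ if $[w]_{A_p}<\infty$ $(1\le p\le\infty)$. Then the following hold for all $f\in L^\infty_0(\mathbb R^d)$, where each implicit constant is $C$ times a constant depending only on the parameters listed. 1. For $1<p<\infty$, $w\in A_p$ and $\sigma=w^{1-p'}$, $$\|Tf\|_{L^p(w)}\lesssim_{p,d}[w]_{A_p}^{\frac1p}\Big([w]_{A_p}^{\frac1{p'}}+[\sigma]_{A_\infty}^{\frac1p}\Big)\max\{[\sigma]_{A_\infty},[w]_{A_\infty}\}\,\|f\|_{L^p(w)};$$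 in particular $\|Tf\|_{L^p(w)}\lesssim_{p,d}[w]_{A_p}^{2\max\{1,\frac1{p-1}\}}\|f\|_{L^p(w)}$, which is quadratic in $[w]_{A_2}$ for $p=2$. 2. For $1<r<p<\infty$ and every weight $w$, $$\|Tf\|_{L^p(w)}\lesssim_{d}p^2(p')^{\frac1p}(r')^{1+\frac1{p'}}\|f\|_{L^p(\mathrm M_rw)}.$$ 3. For $1\le q<p<\infty$ and $w\in A_q$, $$\|Tf\|_{L^p(w)}\lesssim_{p,q,d}[w]_{A_q}^{\frac1p}[w]_{A_\infty}^{1+\frac1{p'}}\|f\|_{L^p(w)}.$$ 4. For $1<p<\infty$, $w\in A_\infty$ and every $\varepsilon>0$, $$\|Tf\|_{L^p(w)}\lesssim_{p,d}\frac{1+\varepsilon}{\varepsilon}\,[w]_{A_\infty}^2\,\|\mathrm M_{1+\varepsilon}f\|_{L^p(w)};$$ in particular, for $0<\varepsilon\le1$ the factor $\frac{1+\varepsilon}\varepsilon$ may be replaced by $\frac1\varepsilon$. -/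

import Mathlib

open MeasureTheory Set
open scoped ENNReal NNReal ComplexConjugate

noncomputable section

namespace SparseBounds

variable {d : ℕ}

/-- Axis-parallel cubes of `ℝ^d` with positive side length. They are taken half-open; since
the boundary of a cube is a null set this convention plays no role. -/
def IsCube (Q : Set (Fin d → ℝ)) : Prop :=
  ∃ (a : Fin d → ℝ) (l : ℝ), 0 < l ∧ Q = Set.univ.pi fun i => Set.Ico (a i) (a i + l)

/-- The `L^p` average over `Q` of a nonnegative function. -/
def lpAvg (p : ℝ) (g : (Fin d → ℝ) → ℝ≥0∞) (Q : Set (Fin d → ℝ)) : ℝ≥0∞ :=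
  (⨍⁻ x in Q, g x ^ p ∂volume) ^ (1 / p)

/-- The pointwise absolute value of a complex function, with values in `[0, ∞]`. -/
def absFun (f : (Fin d → ℝ) → ℂ) : (Fin d → ℝ) → ℝ≥0∞ := fun x => ‖f x‖ₑ

/-- A countable collection of cubes is `η`-sparse if there are pairwise disjoint measurable
sets `E_Q ⊆ Q` with `|E_Q| ≥ η |Q|`. -/
def IsSparse (η : ℝ) (S : Set (Set (Fin d → ℝ))) : Prop :=
  S.Countable ∧ (∀ Q ∈ S, IsCube Q) ∧
    ∃ E : Set (Fin d → ℝ) → Set (Fin d → ℝ),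
      (∀ Q ∈ S, MeasurableSet (E Q) ∧ E Q ⊆ Q ∧
        ENNReal.ofReal η * volume Q ≤ volume (E Q)) ∧
      ∀ I ∈ S, ∀ J ∈ S, I ≠ J → E I ∩ E J = ∅

/-- The space `L^∞_0` of bounded (measurable) complex functions with compact support. -/
def IsBddCompSupp (f : (Fin d → ℝ) → ℂ) : Prop :=
  MemLp f ∞ volume ∧ HasCompactSupport f

/-- `T` is a sublinear operator mapping `L^∞_0` into the locally integrable functions. Only the
values of `T` on `L^∞_0` matter. -/
structure IsSublinearOp (T : ((Fin d → ℝ) → ℂ) → ((Fin d → ℝ) → ℂ)) : Prop where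
  locallyIntegrable : ∀ f, IsBddCompSupp f → LocallyIntegrable (T f) volume
  add_le : ∀ f g, IsBddCompSupp f → IsBddCompSupp g →
    ∀ᵐ x ∂(volume : Measure (Fin d → ℝ)), ‖T (f + g) x‖ ≤ ‖T f x‖ + ‖T g x‖
  smul_eq : ∀ (c : ℂ) f, IsBddCompSupp f →
    ∀ᵐ x ∂(volume : Measure (Fin d → ℝ)), ‖T (c • f) x‖ = ‖c‖ * ‖T f x‖

/-- The sparse form `∑_{Q ∈ S} |Q| ⟨f₁⟩_{p₁,Q} ⟨f₂⟩_{p₂,Q}`. -/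
def sparseForm (S : Set (Set (Fin d → ℝ))) (p₁ p₂ : ℝ) (f₁ f₂ : (Fin d → ℝ) → ℂ) : ℝ≥0∞ :=
  ∑' Q : S, volume (Q : Set (Fin d → ℝ)) *
    (lpAvg p₁ (absFun f₁) Q * lpAvg p₂ (absFun f₂) Q)

/-- `T` has the sparse `(p₁, p₂)` bound with constant `C`. -/
def HasSparseBound (T : ((Fin d → ℝ) → ℂ) → ((Fin d → ℝ) → ℂ)) (p₁ p₂ : ℝ) (C : ℝ≥0∞) :
    Prop :=
  ∀ f₁ f₂, IsBddCompSupp f₁ → IsBddCompSupp f₂ →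
    ∃ S : Set (Set (Fin d → ℝ)), IsSparse (1 / 2) S ∧
      ‖∫ x, T f₁ x * conj (f₂ x)‖ₑ ≤ C * sparseForm S p₁ p₂ f₁ f₂

/-- The sparse norm `‖T‖_{(p₁,p₂),sparse}`; it is `∞` if there is no finite sparse bound. -/
def sparseNorm (T : ((Fin d → ℝ) → ℂ) → ((Fin d → ℝ) → ℂ)) (p₁ p₂ : ℝ) : ℝ≥0∞ :=
  ⨅ (C : ℝ≥0) (_ : HasSparseBound T p₁ p₂ C), (C : ℝ≥0∞)

/-- The maximal function `M_r g = (M (g ^ r)) ^ (1 / r)` of a nonnegative function, where `M` is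
the (uncentered) Hardy-Littlewood maximal function over cubes. -/
def maximalFn (r : ℝ) (g : (Fin d → ℝ) → ℝ≥0∞) (x : Fin d → ℝ) : ℝ≥0∞ :=
  ⨆ (Q : Set (Fin d → ℝ)) (_ : IsCube Q) (_ : x ∈ Q), lpAvg r g Q

/-- Weights: nonnegative, measurable, locally integrable functions. -/
def IsWeight (w : (Fin d → ℝ) → ℝ≥0∞) : Prop :=
  AEMeasurable w volume ∧ ∀ K : Set (Fin d → ℝ), IsCompact K → ∫⁻ x in K, w x < ∞

/-- The norm of `L^p(w)`. -/
def wNorm (p : ℝ) (w g : (Fin d → ℝ) → ℝ≥0∞) : ℝ≥0∞ :=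
  (∫⁻ x, g x ^ p * w x) ^ (1 / p)

/-- The dual weight `σ = w ^ (1 - p')`, where `p' = p / (p - 1)`. -/
def dualWeight (p : ℝ) (w : (Fin d → ℝ) → ℝ≥0∞) : (Fin d → ℝ) → ℝ≥0∞ :=
  fun x => w x ^ (1 - p / (p - 1))

/-- The Muckenhoupt constant `[w]_{A_p}`, `1 ≤ p < ∞`: the supremum over all cubes of
`⟨w⟩_Q ⟨w ^ (1 - p')⟩_Q ^ (p - 1)` if `p > 1` and of `⟨w⟩_Q / essinf_Q w` if `p = 1`. -/
def apConst (p : ℝ) (w : (Fin d → ℝ) → ℝ≥0∞) : ℝ≥0∞ :=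
  if p = 1 then
    ⨆ (Q : Set (Fin d → ℝ)) (_ : IsCube Q),
      (⨍⁻ x in Q, w x ∂volume) * essSup (fun x => (w x)⁻¹) (volume.restrict Q)
  else
    ⨆ (Q : Set (Fin d → ℝ)) (_ : IsCube Q),
      (⨍⁻ x in Q, w x ∂volume) * (⨍⁻ x in Q, dualWeight p w x ∂volume) ^ (p - 1)

/-- The (Fujii-Wilson) constant `[w]_{A_∞} = sup_Q w(Q)⁻¹ ∫_Q M(w 1_Q)`. -/
def aInftyConst (w : (Fin d → ℝ) → ℝ≥0∞) : ℝ≥0∞ :=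
  ⨆ (Q : Set (Fin d → ℝ)) (_ : IsCube Q),
    (∫⁻ x in Q, maximalFn 1 (Q.indicator w) x) / ∫⁻ x in Q, w x

/-- `T` is a sublinear operator whose sparse norms satisfy
`Ψ(t) = ‖T‖_{(1 + 1/t, 1 + 1/t), sparse} ≤ C t` for all `t > 1`. -/
def HasLinearSparseGrowth (T : ((Fin d → ℝ) → ℂ) → ((Fin d → ℝ) → ℂ)) (C : ℝ≥0) : Prop :=
  IsSublinearOp T ∧
    ∀ t : ℝ, 1 < t → sparseNorm T (1 + 1 / t) (1 + 1 / t) ≤ C * ENNReal.ofReal t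

end SparseBounds

end

open SparseBounds

/-! By duality, the norm of T f in L^p(w) is tested against functions of modulus v w^(1/p) with v in
L^(p') (`wNorm_le_of_dual`). For each t > 1 the hypothesis bounds the pairing by C t times a sparse
form with averages of exponent s = 1 + 1/t. Every cube lies in a comparable cube of one of 2^d
adjacent dyadic grids, so it is enough to bound finite sums of |E_Q| ⟨f⟩_{s,Q} ⟨v w^(1/p)⟩_{s,Q}
over cubes of a single grid (`sparseForm_le`, `wNorm_le_of_sparse`).

Everything then rests on the choice of t. A large t brings s close to one, which leaves room to
separate the weight from the functions by Hölder, but it costs the factor t. The right t is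
proportional to p r' in the Fefferman–Stein inequality, where w is averaged in L^r, and otherwise to
an A_∞ constant, because `reverse_holder` improves the integrability of w by an amount of order
1/[w]_{A_∞}. In parts 2, 3 and 4 a second loss comes from the maximal operator M_k on L^(p') with k
just below p': its norm is η^(-1/p') up to a constant, where η = 1/k - 1/p' is the gap
(`maxOn_lpAvg_norm_le`). A gap comparable to 1/t produces the exponents 1 + 1/p'.

For A_∞ weights, `exists_lpAvg_mul_rpow_le` bounds the dual average by ⟨v⟩_k ⟨w⟩_1^(1/p). In the
Coifman–Fefferman inequality the numbers |E_Q| ⟨w⟩_Q form a Carleson sequence for w with constant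
[w]_{A_∞}, so the part of the sum containing f is controlled by M_{1+ε} f. In the A_q estimate,
Hölder against the A_q condition moves ⟨w⟩^(1/p) inside the average of f.

For the mixed A_p bound one writes f = η σ and v w^(1/p) = g w. Reverse Hölder for both weights
turns the averages into ⟨σ⟩ ⟨w⟩ times weighted averages of η and g, whose maximal functions are
bounded independently of the weights. The remaining two-weight sum (`MuckenhouptPair.sum_mul_le`) is
cut into dyadic levels of ⟨w⟩ ⟨σ⟩^(p-1). On one level Kolmogorov's inequality packs the cubes below
R into σ(R)^(1/p) w(R)^(1/p'), and summation by parts along the tree leaves two Carleson embeddings;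
the levels add up geometrically. The pure power of [w]_{A_p} follows since [w]_{A_∞} is at most a
constant times [w]_{A_p} (`MuckenhouptPair.aInftyConst_le`).

The common tool is the running maximum of coefficients along a finite tree. Its increments replace
stopping cubes and level sets: they vanish except where a cube beats all its ancestors, and they
telescope along chains. -/

noncomputable section

namespace SparseBounds

/-! ### Running maxima on finite trees: telescoping, summation by parts, Doob's inequality. -/

open scoped Classical in
/-- The running maximum `max {φ R' : R ⊆ R' ∈ F}`. -/
def upSup {X : Type*} (F : Finset (Set X)) (φ : Set X → ℝ≥0∞) (R : Set X) : ℝ≥0∞ :=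
  (F.filter (R ⊆ ·)).sup φ

open scoped Classical in
/-- The running maximum `max {φ R' : R ⊂ R' ∈ F}` over strict ancestors. -/
def strictUpSup {X : Type*} (F : Finset (Set X)) (φ : Set X → ℝ≥0∞) (R : Set X) : ℝ≥0∞ :=
  (F.filter (R ⊂ ·)).sup φ

open scoped Classical in
/-- The maximal function of a family of coefficients. -/
def maxOn {X : Type*} (F : Finset (Set X)) (φ : Set X → ℝ≥0∞) (x : X) : ℝ≥0∞ :=
  (F.filter (x ∈ ·)).sup φ

/-- The increment of `Θ` along the running maximum. -/
def incr {X : Type*} (F : Finset (Set X)) (φ : Set X → ℝ≥0∞) (Θ : ℝ≥0∞ → ℝ≥0∞) (R : Set X) :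
    ℝ≥0∞ :=
  Θ (upSup F φ R) - Θ (strictUpSup F φ R)

/-- Finite families of nonempty sets any two of which are nested or disjoint. -/
structure Laminar {X : Type*} (F : Finset (Set X)) : Prop where
  nonempty : ∀ A ∈ F, A.Nonempty
  nested : ∀ A ∈ F, ∀ B ∈ F, A ⊆ B ∨ B ⊆ A ∨ Disjoint A B

section Tree

variable {X : Type*} {F : Finset (Set X)}

lemma Laminar.mono {G : Finset (Set X)} (hF : Laminar F) (h : G ⊆ F) : Laminar G :=
  ⟨fun A hA => hF.nonempty A (h hA), fun A hA B hB => hF.nested A (h hA) B (h hB)⟩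

lemma Laminar.comparable (hF : Laminar F) {A B : Set X} (hA : A ∈ F) (hB : B ∈ F) {x : X}
    (hxA : x ∈ A) (hxB : x ∈ B) : A ⊆ B ∨ B ⊆ A := by
  rcases hF.nested A hA B hB with h | h | h
  · exact Or.inl h
  · exact Or.inr h
  · exact absurd hxB (Set.disjoint_left.mp h hxA)

lemma strictUpSup_le_upSup (φ : Set X → ℝ≥0∞) (R : Set X) :
    strictUpSup F φ R ≤ upSup F φ R := by
  classical
  exact Finset.sup_mono fun A hA => by
    simp only [Finset.mem_filter] at hA ⊢
    exact ⟨hA.1, hA.2.subset⟩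

lemma le_upSup (φ : Set X → ℝ≥0∞) {Q R : Set X} (hR : R ∈ F) (h : Q ⊆ R) :
    φ R ≤ upSup F φ Q := by
  classical
  exact Finset.le_sup (f := φ) (by simp [hR, h])

lemma le_strictUpSup (φ : Set X → ℝ≥0∞) {Q R : Set X} (hR : R ∈ F) (h : Q ⊂ R) :
    φ R ≤ strictUpSup F φ Q := by
  classical
  exact Finset.le_sup (f := φ) (by simp [hR, h])

lemma le_maxOn (φ : Set X → ℝ≥0∞) {R : Set X} (hR : R ∈ F) {x : X} (h : x ∈ R) :
    φ R ≤ maxOn F φ x := by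
  classical
  exact Finset.le_sup (f := φ) (by simp [hR, h])

lemma maxOn_le {φ : Set X → ℝ≥0∞} {x : X} {c : ℝ≥0∞} (h : ∀ R ∈ F, x ∈ R → φ R ≤ c) :
    maxOn F φ x ≤ c := by
  classical
  exact Finset.sup_le fun R hR => h R (Finset.mem_filter.mp hR).1 (Finset.mem_filter.mp hR).2

lemma upSup_le {φ : Set X → ℝ≥0∞} {Q : Set X} {c : ℝ≥0∞} (h : ∀ R ∈ F, Q ⊆ R → φ R ≤ c) :
    upSup F φ Q ≤ c := by
  classical
  exact Finset.sup_le fun R hR => h R (Finset.mem_filter.mp hR).1 (Finset.mem_filter.mp hR).2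

lemma upSup_eq_max (φ : Set X → ℝ≥0∞) {R : Set X} (hR : R ∈ F) :
    upSup F φ R = max (φ R) (strictUpSup F φ R) := by
  apply le_antisymm
  · refine upSup_le fun A hA hRA => ?_
    rcases hRA.eq_or_ssubset with rfl | h
    · exact le_max_left _ _
    · exact (le_strictUpSup φ hA h).trans (le_max_right _ _)
  · exact max_le (le_upSup φ hR subset_rfl) (strictUpSup_le_upSup φ R)

/-- An increment can only occur where the coefficient itself exceeds those of all strict ancestors.
This is how principal cubes are detected without constructing them. -/
lemma upSup_eq_of_incr_ne_zero {φ : Set X → ℝ≥0∞} {Θ : ℝ≥0∞ → ℝ≥0∞} {R : Set X} (hR : R ∈ F)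
    (h : incr F φ Θ R ≠ 0) : upSup F φ R = φ R := by
  rw [upSup_eq_max φ hR]
  apply max_eq_left
  by_contra! hlt
  apply h
  rw [incr, upSup_eq_max φ hR, max_eq_right hlt.le, tsub_self]

open scoped Classical in
/-- Telescoping along a chain that is closed under taking ancestors. -/
lemma telescope (Ψ : Finset (Set X) → ℝ≥0∞) (hmono : Monotone Ψ) (h0 : Ψ ∅ = 0)
    (C : Finset (Set X)) (hCF : C ⊆ F) (hup : ∀ R ∈ C, ∀ R' ∈ F, R ⊆ R' → R' ∈ C)
    (hchain : ∀ A ∈ C, ∀ B ∈ C, A ⊆ B ∨ B ⊆ A) :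
    ∑ R ∈ C, (Ψ (F.filter (R ⊆ ·)) - Ψ (F.filter (R ⊂ ·))) = Ψ C := by
  induction C using Finset.strongInduction with
  | H C ih =>
    rcases C.eq_empty_or_nonempty with rfl | hne
    · simp [h0]
    -- The smallest member of the chain has all of `C` as ancestors and `C.erase P` as strict
    -- ancestors, so its term completes the sum given by induction.
    obtain ⟨P, hP⟩ := C.exists_minimal hne
    have hle : ∀ A ∈ C, P ⊆ A := fun A hA => (hchain P hP.1 A hA).elim id fun h => hP.2 hA h
    have e1 : F.filter (P ⊆ ·) = C := by
      ext A
      simp only [Finset.mem_filter]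
      exact ⟨fun h => hup P hP.1 A h.1 h.2, fun h => ⟨hCF h, hle A h⟩⟩
    have e2 : F.filter (P ⊂ ·) = C.erase P := by
      ext A
      simp only [Finset.mem_filter, Finset.mem_erase]
      refine ⟨fun h => ⟨h.2.ne', hup P hP.1 A h.1 h.2.subset⟩, fun h => ⟨hCF h.2, ?_⟩⟩
      exact (hle A h.2).ssubset_of_ne (Ne.symm h.1)
    have ih' := ih (C.erase P) (Finset.erase_ssubset hP.1)
      ((Finset.erase_subset _ _).trans hCF)
      (fun R hR R' hR' hRR' => by
        have hRC := Finset.mem_of_mem_erase hR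
        refine Finset.mem_erase.mpr ⟨?_, hup R hRC R' hR' hRR'⟩
        rintro rfl
        exact (Finset.mem_erase.mp hR).1 (subset_antisymm hRR' (hle R hRC)))
      (fun A hA B hB => hchain A (Finset.mem_of_mem_erase hA) B (Finset.mem_of_mem_erase hB))
    rw [← Finset.add_sum_erase C _ hP.1, ih', e1, e2,
      tsub_add_cancel_of_le (hmono (Finset.erase_subset _ _))]

lemma monotone_comp_sup {Θ : ℝ≥0∞ → ℝ≥0∞} (hΘ : Monotone Θ) (φ : Set X → ℝ≥0∞) :
    Monotone fun C : Finset (Set X) => Θ (C.sup φ) :=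
  fun _ _ h => hΘ (Finset.sup_mono h)

/-- The members of `F` through a point form a chain closed under ancestors, so the increments
telescope to the value at the full maximum. -/
lemma sum_incr_maxOn (hF : Laminar F) (φ : Set X → ℝ≥0∞) {Θ : ℝ≥0∞ → ℝ≥0∞} (hΘ : Monotone Θ)
    (h0 : Θ 0 = 0) (x : X) :
    ∑ R ∈ F, R.indicator (fun _ => incr F φ Θ R) x = Θ (maxOn F φ x) := by
  classical
  have := telescope (F := F) (fun C => Θ (C.sup φ)) (monotone_comp_sup hΘ φ) (by simpa using h0)
    (F.filter (x ∈ ·)) (Finset.filter_subset _ _)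
    (fun R hR R' hR' h => by
      simp only [Finset.mem_filter] at hR ⊢
      exact ⟨hR', h hR.2⟩)
    (fun A hA B hB => by
      simp only [Finset.mem_filter] at hA hB
      exact hF.comparable hA.1 hB.1 hA.2 hB.2)
  rw [maxOn, ← this, Finset.sum_filter]
  refine Finset.sum_congr rfl fun R _ => ?_
  by_cases h : x ∈ R <;> simp [h, incr, upSup, strictUpSup]

open scoped Classical in
lemma sum_ancestors (hF : Laminar F) (Ψ : Finset (Set X) → ℝ≥0∞) (hmono : Monotone Ψ)
    (h0 : Ψ ∅ = 0) {Q : Set X} (hQ : Q ∈ F) :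
    ∑ R ∈ F.filter (Q ⊆ ·), (Ψ (F.filter (R ⊆ ·)) - Ψ (F.filter (R ⊂ ·)))
      = Ψ (F.filter (Q ⊆ ·)) := by
  obtain ⟨x, hx⟩ := hF.nonempty Q hQ
  exact telescope (F := F) Ψ hmono h0 _ (Finset.filter_subset _ _)
    (fun R hR R' hR' h => by
      simp only [Finset.mem_filter] at hR ⊢
      exact ⟨hR', hR.2.trans h⟩)
    (fun A hA B hB => by
      simp only [Finset.mem_filter] at hA hB
      exact hF.comparable hA.1 hB.1 (hA.2 hx) (hB.2 hx))

open scoped Classical in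
/-- Summation by parts over a finite tree. -/
lemma sum_mul_eq_sum_increments (hF : Laminar F) (Ψ : Finset (Set X) → ℝ≥0∞)
    (hmono : Monotone Ψ) (h0 : Ψ ∅ = 0) (τ : Set X → ℝ≥0∞) :
    ∑ Q ∈ F, τ Q * Ψ (F.filter (Q ⊆ ·)) =
      ∑ R ∈ F, (Ψ (F.filter (R ⊆ ·)) - Ψ (F.filter (R ⊂ ·))) * ∑ Q ∈ F.filter (· ⊆ R), τ Q := by
  have : ∀ Q ∈ F, τ Q * Ψ (F.filter (Q ⊆ ·)) = ∑ R ∈ F,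
      if Q ⊆ R then (Ψ (F.filter (R ⊆ ·)) - Ψ (F.filter (R ⊂ ·))) * τ Q else 0 := by
    intro Q hQ
    rw [← sum_ancestors hF Ψ hmono h0 hQ, Finset.mul_sum, Finset.sum_filter]
    exact Finset.sum_congr rfl fun R _ => by split_ifs <;> simp [mul_comm]
  rw [Finset.sum_congr rfl this, Finset.sum_comm]
  refine Finset.sum_congr rfl fun R _ => ?_
  rw [Finset.mul_sum, Finset.sum_filter]

open scoped Classical in
lemma sum_mul_upSup (hF : Laminar F) (φ : Set X → ℝ≥0∞) {Θ : ℝ≥0∞ → ℝ≥0∞} (hΘ : Monotone Θ)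
    (h0 : Θ 0 = 0) (τ : Set X → ℝ≥0∞) :
    ∑ Q ∈ F, τ Q * Θ (upSup F φ Q) =
      ∑ R ∈ F, incr F φ Θ R * ∑ Q ∈ F.filter (· ⊆ R), τ Q :=
  sum_mul_eq_sum_increments hF (fun C => Θ (C.sup φ)) (monotone_comp_sup hΘ φ)
    (by simpa using h0) τ

variable [MeasurableSpace X]

lemma measurable_maxOn (hm : ∀ R ∈ F, MeasurableSet R) (φ : Set X → ℝ≥0∞) :
    Measurable (maxOn F φ) := by
  classical
  have : maxOn F φ = fun x => F.sup fun R => R.indicator (fun _ => φ R) x := by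
    ext x
    apply le_antisymm
    · refine maxOn_le fun R hR hx => ?_
      have := Finset.le_sup (f := fun R : Set X => R.indicator (fun _ => φ R) x) hR
      simpa [hx] using this
    · refine Finset.sup_le fun R hR => ?_
      by_cases hx : x ∈ R
      · simpa [hx] using le_maxOn φ hR hx
      · simp [hx]
  rw [this]
  have key : ∀ G : Finset (Set X), (∀ R ∈ G, MeasurableSet R) →
      Measurable fun x => G.sup fun R => R.indicator (fun _ => φ R) x := by
    intro G
    induction G using Finset.induction_on with
    | empty => intro _; simp
    | insert a s _ ih =>
      intro h
      simp only [Finset.sup_insert]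
      exact (measurable_const.indicator (h a (by simp))).sup
        (ih fun R hR => h R (by simp [hR]))
  exact key F hm

/-- A layer-cake formula: the increments play the role of the level parameter and the sets of the
tree that of the level sets. It makes integrals of maximal functions into finite sums that are
compared term by term. -/
lemma lintegral_mul_comp_maxOn (hF : Laminar F) (hm : ∀ R ∈ F, MeasurableSet R)
    (φ : Set X → ℝ≥0∞) {Θ : ℝ≥0∞ → ℝ≥0∞} (hΘ : Monotone Θ) (h0 : Θ 0 = 0) {μ : Measure X}
    {f : X → ℝ≥0∞} (hf : AEMeasurable f μ) :
    ∫⁻ x, f x * Θ (maxOn F φ x) ∂μ = ∑ R ∈ F, incr F φ Θ R * ∫⁻ x in R, f x ∂μ := by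
  simp_rw [← sum_incr_maxOn hF φ hΘ h0, Finset.mul_sum]
  have hmeas : ∀ R ∈ F, AEMeasurable (fun x => f x * R.indicator (fun _ => incr F φ Θ R) x) μ :=
    fun R hR => hf.mul (measurable_const.indicator (hm R hR)).aemeasurable
  rw [lintegral_finsetSum' F hmeas]
  refine Finset.sum_congr rfl fun R hR => ?_
  rw [← lintegral_const_mul'' _ hf.restrict, ← lintegral_indicator (hm R hR)]
  refine lintegral_congr fun x => ?_
  by_cases h : x ∈ R <;> simp [h, mul_comm]

lemma lintegral_comp_maxOn (hF : Laminar F) (hm : ∀ R ∈ F, MeasurableSet R)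
    (φ : Set X → ℝ≥0∞) {Θ : ℝ≥0∞ → ℝ≥0∞} (hΘ : Monotone Θ) (h0 : Θ 0 = 0) (μ : Measure X) :
    ∫⁻ x, Θ (maxOn F φ x) ∂μ = ∑ R ∈ F, incr F φ Θ R * μ R := by
  have := lintegral_mul_comp_maxOn hF hm φ hΘ h0 (μ := μ) (f := fun _ => 1) aemeasurable_const
  simpa using this

/-- The weak-type principle: an inequality between increments of `Θ₁` and `Θ₂` transfers to the
maximal function of the averages of `f`. -/
lemma lintegral_comp_maxOn_le (hF : Laminar F) (hm : ∀ R ∈ F, MeasurableSet R) {μ : Measure X}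
    (hfin : ∀ R ∈ F, μ R ≠ ∞) {f : X → ℝ≥0∞} (hf : AEMeasurable f μ)
    {Θ₁ Θ₂ : ℝ≥0∞ → ℝ≥0∞} (h₁ : Monotone Θ₁) (h₁0 : Θ₁ 0 = 0) (h₂ : Monotone Θ₂)
    (h₂0 : Θ₂ 0 = 0)
    (h : ∀ R ∈ F, ∀ a b, b ≤ a → a = ⨍⁻ y in R, f y ∂μ → Θ₁ a - Θ₁ b ≤ a * (Θ₂ a - Θ₂ b)) :
    ∫⁻ x, Θ₁ (maxOn F (fun R => ⨍⁻ y in R, f y ∂μ) x) ∂μ ≤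
      ∫⁻ x, f x * Θ₂ (maxOn F (fun R => ⨍⁻ y in R, f y ∂μ) x) ∂μ := by
  rw [lintegral_comp_maxOn hF hm _ h₁ h₁0, lintegral_mul_comp_maxOn hF hm _ h₂ h₂0 hf]
  refine Finset.sum_le_sum fun R hR => ?_
  by_cases hz : incr F (fun R => ⨍⁻ y in R, f y ∂μ) Θ₁ R = 0
  · simp [hz]
  have hU := upSup_eq_of_incr_ne_zero hR hz
  have := h R hR _ _ (strictUpSup_le_upSup (fun R => ⨍⁻ y in R, f y ∂μ) R) hU
  calc incr F (fun R => ⨍⁻ y in R, f y ∂μ) Θ₁ R * μ R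
      ≤ upSup F (fun R => ⨍⁻ y in R, f y ∂μ) R *
          incr F (fun R => ⨍⁻ y in R, f y ∂μ) Θ₂ R * μ R := by gcongr; exact this
    _ = incr F (fun R => ⨍⁻ y in R, f y ∂μ) Θ₂ R * (μ R * ⨍⁻ y in R, f y ∂μ) := by
        rw [hU]; ring
    _ = _ := by rw [measure_mul_setLAverage f (hfin R hR)]

/-- Powers: `a ^ p - b ^ p ≤ p' a (a ^ (p - 1) - b ^ (p - 1))`. -/
lemma rpow_sub_rpow_le_mul {p : ℝ} (hp : 1 < p) {a b : ℝ≥0∞} (hba : b ≤ a) (ha : a ≠ ∞) :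
    a ^ p - b ^ p ≤
      a * (ENNReal.ofReal (p / (p - 1)) * a ^ (p - 1) - ENNReal.ofReal (p / (p - 1)) * b ^ (p - 1)) := by
  have hp1 : 0 < p - 1 := by linarith
  lift a to ℝ≥0 using ha
  lift b to ℝ≥0 using ne_top_of_le_ne_top ENNReal.coe_ne_top hba
  have hba' : (b : ℝ) ≤ a := by exact_mod_cast hba
  have hb0 : (0 : ℝ) ≤ b := b.2
  have ha0 : (0 : ℝ) ≤ a := a.2
  rw [← ENNReal.coe_rpow_of_nonneg _ (by linarith : 0 ≤ p),
    ← ENNReal.coe_rpow_of_nonneg _ (by linarith : 0 ≤ p), ← ENNReal.coe_rpow_of_nonneg _ hp1.le,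
    ← ENNReal.coe_rpow_of_nonneg _ hp1.le, ENNReal.ofReal]
  norm_cast
  rw [← NNReal.coe_le_coe]
  have m1 : b ^ p ≤ a ^ p := NNReal.rpow_le_rpow (by exact_mod_cast hba) (by linarith)
  have m2 : (p / (p - 1)).toNNReal * b ^ (p - 1) ≤ (p / (p - 1)).toNNReal * a ^ (p - 1) := by
    gcongr; exact_mod_cast hba
  rw [NNReal.coe_sub m1, NNReal.coe_mul, NNReal.coe_sub m2]
  push_cast
  rw [Real.coe_toNNReal _ (by positivity)]
  have hconj : p.HolderConjugate (p / (p - 1)) := Real.HolderConjugate.conjExponent hp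
  -- Young in the form a b^(p-1) ≤ a^p / p + b^p / p' is the whole inequality after rearranging.
  have hy := Real.young_inequality_of_nonneg ha0 (Real.rpow_nonneg hb0 (p - 1)) hconj
  have e1 : ((b : ℝ) ^ (p - 1)) ^ (p / (p - 1)) = (b : ℝ) ^ p := by
    rw [← Real.rpow_mul hb0]; congr 1; field_simp
  rw [e1] at hy
  have e2 : (a : ℝ) * (a : ℝ) ^ (p - 1) = (a : ℝ) ^ p := by
    rcases eq_or_lt_of_le ha0 with h | h
    · rw [← h, Real.zero_rpow (by linarith : p ≠ 0)]; simp
    · rw [← Real.rpow_one_add' ha0 (by linarith)]; congr 1; ring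
  set A := (a : ℝ) ^ p
  set B := (b : ℝ) ^ p
  set D := (a : ℝ) * (b : ℝ) ^ (p - 1)
  have : (a : ℝ) * (p / (p - 1) * (a : ℝ) ^ (p - 1) - p / (p - 1) * (b : ℝ) ^ (p - 1)) =
      p / (p - 1) * (A - D) := by rw [← e2]; ring
  rw [this]
  have hD : p / (p - 1) * D ≤ p / (p - 1) * (A / p + B / (p / (p - 1))) := by gcongr
  have e3 : p / (p - 1) * (A / p + B / (p / (p - 1))) = A / (p - 1) + B := by field_simp
  have e4 : p / (p - 1) * A = A + A / (p - 1) := by field_simp; ring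
  nlinarith

/-- Doob's maximal inequality for a finite laminar family. -/
theorem lintegral_maxOn_rpow_le (hF : Laminar F) (hm : ∀ R ∈ F, MeasurableSet R)
    {μ : Measure X} (hfin : ∀ R ∈ F, μ R ≠ ∞) {f : X → ℝ≥0∞} (hf : AEMeasurable f μ) {p : ℝ}
    (hp : 1 < p) :
    ∫⁻ x, maxOn F (fun R => ⨍⁻ y in R, f y ∂μ) x ^ p ∂μ ≤
      ENNReal.ofReal (p / (p - 1)) ^ p * ∫⁻ x, f x ^ p ∂μ := by
  have hp0 : 0 < p := by linarith
  have hp1 : 0 < p - 1 := by linarith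
  have hc : ENNReal.ofReal (p / (p - 1)) ≠ 0 := by
    simpa [ENNReal.ofReal_eq_zero] using by positivity
  have hconj : p.HolderConjugate (p / (p - 1)) := Real.HolderConjugate.conjExponent hp
  by_cases htop : ∫⁻ x, f x ^ p ∂μ = ∞
  · rw [htop, ENNReal.mul_top]
    · exact le_top
    · simp [hc, hp0]
  have hint : ∀ R ∈ F, ∫⁻ y in R, f y ∂μ ≠ ∞ := by
    intro R hR
    have := ENNReal.lintegral_mul_le_Lp_mul_Lq (μ.restrict R) hconj hf.restrict
      (g := fun _ => 1) aemeasurable_const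
    refine ne_top_of_le_ne_top ?_ (by simpa using this)
    refine ENNReal.mul_ne_top (ENNReal.rpow_ne_top_of_nonneg (by positivity) ?_)
      (ENNReal.rpow_ne_top_of_nonneg (by positivity) (hfin R hR))
    exact ne_top_of_le_ne_top htop (lintegral_mono' Measure.restrict_le_self le_rfl)
  have hav : ∀ R ∈ F, ⨍⁻ y in R, f y ∂μ ≠ ∞ := fun R hR => (setLAverage_lt_top (hint R hR)).ne
  set M := maxOn F (fun R => ⨍⁻ y in R, f y ∂μ) with hM
  have hMm : Measurable M := measurable_maxOn hm _
  set c := ENNReal.ofReal (p / (p - 1))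
  -- The weak-type principle with t^p and p' t^(p-1); Hölder on the right then leaves a power of `Y`
  -- to be cancelled.
  have key : ∫⁻ x, M x ^ p ∂μ ≤ ∫⁻ x, f x * (c * M x ^ (p - 1)) ∂μ := by
    refine lintegral_comp_maxOn_le hF hm hfin hf (Θ₁ := fun t => t ^ p)
      (Θ₂ := fun t => c * t ^ (p - 1)) (fun a b h => ENNReal.rpow_le_rpow h hp0.le)
      (by simp [hp0]) (fun a b h => mul_le_mul_right (ENNReal.rpow_le_rpow h hp1.le) c) (by simp [hp1]) ?_
    intro R hR a b hba ha
    exact rpow_sub_rpow_le_mul hp hba (ha ▸ hav R hR)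
  -- Finiteness, needed for the cancellation, holds because the tree and its averages are finite.
  have hY : ∫⁻ x, M x ^ p ∂μ ≠ ∞ := by
    have := lintegral_comp_maxOn hF hm (fun R => ⨍⁻ y in R, f y ∂μ) (Θ := fun t => t ^ p)
      (fun a b h => ENNReal.rpow_le_rpow h hp0.le) (by simp [hp0]) μ
    rw [hM, this]
    refine ENNReal.sum_ne_top.mpr fun R hR => ENNReal.mul_ne_top ?_ (hfin R hR)
    refine ne_top_of_le_ne_top ?_ tsub_le_self
    refine ENNReal.rpow_ne_top_of_nonneg hp0.le ?_
    refine ne_top_of_le_ne_top (ENNReal.sum_ne_top.mpr hav) (upSup_le fun A hA _ => ?_)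
    exact Finset.single_le_sum (f := fun R => ⨍⁻ y in R, f y ∂μ) (fun _ _ => zero_le) hA
  have hold := ENNReal.lintegral_mul_le_Lp_mul_Lq μ hconj hf
    (g := fun x => c * M x ^ (p - 1)) ((hMm.pow_const _).const_mul _).aemeasurable
  have e1 : ∫⁻ x, (c * M x ^ (p - 1)) ^ (p / (p - 1)) ∂μ = c ^ (p / (p - 1)) * ∫⁻ x, M x ^ p ∂μ := by
    rw [← lintegral_const_mul _ (hMm.pow_const _)]
    refine lintegral_congr fun x => ?_
    rw [ENNReal.mul_rpow_of_nonneg _ _ (by positivity), ← ENNReal.rpow_mul]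
    congr 2; field_simp
  set Y := ∫⁻ x, M x ^ p ∂μ
  set I := ∫⁻ x, f x ^ p ∂μ
  have h2 : Y ≤ I ^ (1 / p) * (c * Y ^ (1 / (p / (p - 1)))) := by
    refine key.trans (hold.trans ?_)
    simp only [e1]
    gcongr
    rw [ENNReal.mul_rpow_of_nonneg _ _ (by positivity), ← ENNReal.rpow_mul]
    gcongr
    rw [mul_one_div_cancel (by positivity), ENNReal.rpow_one]
  by_cases hY0 : Y = 0
  · rw [hY0]; exact zero_le
  have h3 : Y ^ (1 / p) ≤ c * I ^ (1 / p) := by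
    have e : Y = Y ^ (1 / p) * Y ^ (1 / (p / (p - 1))) := by
      rw [← ENNReal.rpow_add _ _ hY0 hY]
      conv_lhs => rw [← ENNReal.rpow_one Y]
      congr 1; field_simp; ring
    have hne : Y ^ (1 / (p / (p - 1))) ≠ 0 := by
      simp [hY0, hY]
    have hne' : Y ^ (1 / (p / (p - 1))) ≠ ∞ := ENNReal.rpow_ne_top_of_nonneg (by positivity) hY
    rw [e] at h2
    have h2' : Y ^ (1 / p) * Y ^ (1 / (p / (p - 1))) ≤
        (c * I ^ (1 / p)) * Y ^ (1 / (p / (p - 1))) := by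
      have e' : (Y ^ (1 / p) * Y ^ (1 / (p / (p - 1)))) = Y := e.symm
      rw [e'] at h2 ⊢
      calc Y ≤ _ := h2
        _ = _ := by ring
    exact (ENNReal.mul_le_mul_iff_left hne hne').mp h2'
  have h4 := ENNReal.rpow_le_rpow h3 hp0.le
  rwa [ENNReal.mul_rpow_of_nonneg _ _ hp0.le, ← ENNReal.rpow_mul, ← ENNReal.rpow_mul,
    one_div_mul_cancel hp0.ne', ENNReal.rpow_one, ENNReal.rpow_one] at h4

end Tree

variable {d : ℕ}

/-! ### Cubes and averages over them. -/

section Cubes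

lemma IsCube.measurableSet {Q : Set (Fin d → ℝ)} (hQ : IsCube Q) : MeasurableSet Q := by
  obtain ⟨a, l, -, rfl⟩ := hQ
  exact MeasurableSet.univ_pi fun _ => measurableSet_Ico

lemma volume_cube (a : Fin d → ℝ) (l : ℝ) :
    volume (Set.univ.pi fun i => Set.Ico (a i) (a i + l)) = ENNReal.ofReal l ^ d := by
  rw [Real.volume_pi_Ico]
  simp

lemma IsCube.volume_ne_zero {Q : Set (Fin d → ℝ)} (hQ : IsCube Q) : volume Q ≠ 0 := by
  obtain ⟨a, l, hl, rfl⟩ := hQ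
  rw [volume_cube]
  exact pow_ne_zero _ (by simpa using hl)

lemma IsCube.volume_ne_top {Q : Set (Fin d → ℝ)} (hQ : IsCube Q) : volume Q ≠ ∞ := by
  obtain ⟨a, l, hl, rfl⟩ := hQ
  rw [volume_cube]
  finiteness

lemma IsCube.nonempty {Q : Set (Fin d → ℝ)} (hQ : IsCube Q) : Q.Nonempty :=
  nonempty_of_measure_ne_zero hQ.volume_ne_zero

lemma IsCube.subset_compact {Q : Set (Fin d → ℝ)} (hQ : IsCube Q) :
    ∃ K, IsCompact K ∧ Q ⊆ K := by
  obtain ⟨a, l, hl, rfl⟩ := hQ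
  exact ⟨Set.univ.pi fun i => Set.Icc (a i) (a i + l), isCompact_univ_pi fun _ => isCompact_Icc,
    Set.pi_mono fun _ _ => Ico_subset_Icc_self⟩

lemma IsWeight.lintegral_cube_ne_top {w : (Fin d → ℝ) → ℝ≥0∞} (hw : IsWeight w)
    {Q : Set (Fin d → ℝ)} (hQ : IsCube Q) : ∫⁻ x in Q, w x ≠ ∞ := by
  obtain ⟨K, hK, hQK⟩ := hQ.subset_compact
  exact ne_top_of_le_ne_top (hw.2 K hK).ne (lintegral_mono_set hQK)

end Cubes

section Averages

variable {Q : Set (Fin d → ℝ)} {g u v : (Fin d → ℝ) → ℝ≥0∞}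

lemma lpAvg_one (g : (Fin d → ℝ) → ℝ≥0∞) (Q : Set (Fin d → ℝ)) :
    lpAvg 1 g Q = ⨍⁻ x in Q, g x ∂volume := by
  simp [lpAvg]

lemma volume_mul_lpAvg_one (g : (Fin d → ℝ) → ℝ≥0∞) (hQ : IsCube Q) :
    volume Q * lpAvg 1 g Q = ∫⁻ x in Q, g x := by
  rw [lpAvg_one, measure_mul_setLAverage _ hQ.volume_ne_top]

lemma lpAvg_mono_ae {s : ℝ} (hs : 0 ≤ s) (h : ∀ᵐ x ∂volume.restrict Q, u x ≤ v x) :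
    lpAvg s u Q ≤ lpAvg s v Q := by
  unfold lpAvg
  refine ENNReal.rpow_le_rpow (laverage_mono_ae ?_) (by positivity)
  filter_upwards [h] with x hx
  gcongr

lemma lpAvg_mono_on {s : ℝ} (hs : 0 ≤ s) (hQ : MeasurableSet Q) (h : ∀ x ∈ Q, u x ≤ v x) :
    lpAvg s u Q ≤ lpAvg s v Q :=
  lpAvg_mono_ae hs ((ae_restrict_iff' hQ).mpr (Filter.Eventually.of_forall h))

lemma lpAvg_congr_ae {s : ℝ} (h : u =ᵐ[volume] v) : lpAvg s u Q = lpAvg s v Q := by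
  unfold lpAvg
  congr 1
  exact laverage_congr ((ae_restrict_of_ae h).mono fun x hx => by simp only [hx])

lemma lpAvg_rpow {m θ : ℝ} (hθ : θ ≠ 0) (g : (Fin d → ℝ) → ℝ≥0∞) (Q : Set (Fin d → ℝ)) :
    lpAvg m (fun x => g x ^ θ) Q = lpAvg (θ * m) g Q ^ θ := by
  simp only [lpAvg, ← ENNReal.rpow_mul]
  congr 1
  rw [one_div, one_div, mul_inv, mul_assoc, mul_comm m⁻¹, ← mul_assoc, inv_mul_cancel₀ hθ, one_mul]

/-- Hölder's inequality for averages. -/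
lemma lpAvg_mul_le {s k m : ℝ} (hs : 0 < s) (hsk : s < k) (h : 1 / s = 1 / k + 1 / m)
    (hu : AEMeasurable u) (hv : AEMeasurable v) (Q : Set (Fin d → ℝ)) :
    lpAvg s (fun x => u x * v x) Q ≤ lpAvg k u Q * lpAvg m v Q :=
  ENNReal.lintegral_Lp_mul_le_Lq_mul_Lr hs hsk h _ (hu.restrict.smul_measure _)
    (hv.restrict.smul_measure _)

lemma lpAvg_const {s : ℝ} (hs : 0 < s) (hQ : IsCube Q) (c : ℝ≥0∞) :
    lpAvg s (fun _ => c) Q = c := by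
  rw [lpAvg, setLAverage_const hQ.volume_ne_zero hQ.volume_ne_top, ← ENNReal.rpow_mul,
    mul_one_div_cancel hs.ne', ENNReal.rpow_one]

lemma lpAvg_le_lpAvg {s k : ℝ} (hs : 0 < s) (hsk : s ≤ k) (hg : AEMeasurable g) (hQ : IsCube Q) :
    lpAvg s g Q ≤ lpAvg k g Q := by
  rcases hsk.eq_or_lt with rfl | hlt
  · rfl
  have hk : 0 < k := hs.trans hlt
  have hm : 0 < 1 / s - 1 / k := sub_pos.mpr (one_div_lt_one_div_of_lt hs hlt)
  have := lpAvg_mul_le (m := (1 / s - 1 / k)⁻¹) hs hlt (by simp) hg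
    (aemeasurable_const (b := (1 : ℝ≥0∞))) Q
  rw [lpAvg_const (by positivity) hQ] at this
  simpa using this

lemma lpAvg_const_mul {s : ℝ} (hs : 0 < s) (c : ℝ≥0∞) (hg : AEMeasurable g)
    (Q : Set (Fin d → ℝ)) : lpAvg s (fun x => c * g x) Q = c * lpAvg s g Q := by
  simp only [lpAvg, ENNReal.mul_rpow_of_nonneg _ _ hs.le, laverage]
  rw [lintegral_const_mul'' _ ((hg.pow_const s).restrict.smul_measure _),
    ENNReal.mul_rpow_of_nonneg _ _ (by positivity), ← ENNReal.rpow_mul,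
    mul_one_div_cancel hs.ne', ENNReal.rpow_one]

lemma lpAvg_le_of_subset {s : ℝ} (hs : 1 ≤ s) {Q' : Set (Fin d → ℝ)}
    (hQ' : IsCube Q') (hsub : Q ⊆ Q') {c : ℝ≥0∞} (hc : 1 ≤ c) (hvol : volume Q' ≤ c * volume Q)
    (g : (Fin d → ℝ) → ℝ≥0∞) : lpAvg s g Q ≤ c * lpAvg s g Q' := by
  have h1 : ⨍⁻ x in Q, g x ^ s ∂volume ≤ c * ⨍⁻ x in Q', g x ^ s ∂volume := by
    rw [setLAverage_eq, setLAverage_eq]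
    refine ENNReal.div_le_of_le_mul ?_
    calc ∫⁻ x in Q, g x ^ s ≤ ∫⁻ x in Q', g x ^ s := lintegral_mono_set hsub
      _ = (∫⁻ x in Q', g x ^ s) / volume Q' * volume Q' :=
          (ENNReal.div_mul_cancel hQ'.volume_ne_zero hQ'.volume_ne_top).symm
      _ ≤ (∫⁻ x in Q', g x ^ s) / volume Q' * (c * volume Q) := by gcongr
      _ = _ := by ring
  calc lpAvg s g Q ≤ (c * ⨍⁻ x in Q', g x ^ s ∂volume) ^ (1 / s) :=
        ENNReal.rpow_le_rpow h1 (by positivity)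
    _ = c ^ (1 / s) * lpAvg s g Q' := ENNReal.mul_rpow_of_nonneg _ _ (by positivity)
    _ ≤ c * lpAvg s g Q' := by
        gcongr
        calc c ^ (1 / s) ≤ c ^ (1 : ℝ) :=
              ENNReal.rpow_le_rpow_of_exponent_le hc (by rw [div_le_one] <;> linarith)
          _ = c := ENNReal.rpow_one c

end Averages

/-! ### Unweighted maximal bounds and sums over disjoint carriers. -/

/-- `(1 / η) ^ η ≤ 3` for `0 < η`. -/
lemma one_div_rpow_self_le {η : ℝ} (hη : 0 < η) : (1 / η) ^ η ≤ 3 := by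
  rw [Real.rpow_def_of_pos (by positivity)]
  have h1 : Real.log (1 / η) ≤ 1 / η - 1 := Real.log_le_sub_one_of_pos (by positivity)
  have h2 : Real.log (1 / η) * η ≤ 1 := by
    calc Real.log (1 / η) * η ≤ (1 / η - 1) * η := by gcongr
      _ = 1 - η := by field_simp
      _ ≤ 1 := by linarith
  calc Real.exp (Real.log (1 / η) * η) ≤ Real.exp 1 := Real.exp_le_exp.mpr h2
    _ ≤ 3 := by linarith [Real.exp_one_lt_d9]

section Maximal

variable {F : Finset (Set (Fin d → ℝ))}

lemma maxOn_lpAvg_eq {k : ℝ} (hk : 0 < k) (u : (Fin d → ℝ) → ℝ≥0∞) (x : Fin d → ℝ) :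
    maxOn F (fun R => lpAvg k u R) x =
      maxOn F (fun R => ⨍⁻ y in R, u y ^ k ∂volume) x ^ (1 / k) := by
  apply le_antisymm
  · exact maxOn_le fun R hR hx =>
      ENNReal.rpow_le_rpow (le_maxOn (fun R => ⨍⁻ y in R, u y ^ k ∂volume) hR hx) (by positivity)
  · rw [one_div, ENNReal.rpow_inv_le_iff hk]
    refine maxOn_le fun R hR hx => ?_
    rw [← ENNReal.rpow_inv_le_iff hk, ← one_div]
    exact le_maxOn (fun R => lpAvg k u R) hR hx

/-- The `L^q` bound for `M_k`, quantified by `η = 1 / k - 1 / q`. -/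
lemma maxOn_lpAvg_norm_le (hF : Laminar F) (hc : ∀ R ∈ F, IsCube R) {k q η : ℝ} (hk : 1 ≤ k)
    (hq : 0 < q) (hη : 0 < η) (h : 1 / k = 1 / q + η) {u : (Fin d → ℝ) → ℝ≥0∞}
    (hu : AEMeasurable u) :
    (∫⁻ x, maxOn F (fun R => lpAvg k u R) x ^ q) ^ (1 / q) ≤
      ENNReal.ofReal (3 * (1 / η) ^ (1 / q)) * (∫⁻ x, u x ^ q) ^ (1 / q) := by
  have hk0 : 0 < k := by linarith
  have hkq : k < q := by
    have : 1 / q < 1 / k := by linarith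
    exact lt_of_one_div_lt_one_div hq this
  have hqk : 1 < q / k := by rwa [lt_div_iff₀ hk0, one_mul]
  -- The Doob constant (q/k)' equals q / (q - k), while 1/η = k q / (q - k), and k ≥ 1.
  have hconst : q / k / (q / k - 1) ≤ 1 / η := by
    have e : η = (q - k) / (k * q) := by
      have : η = 1 / k - 1 / q := by linarith
      rw [this]; field_simp
    have hqk' : 0 < q - k := by linarith
    rw [e, show q / k / (q / k - 1) = q / (q - k) by field_simp,
      show 1 / ((q - k) / (k * q)) = k * q / (q - k) by field_simp]
    gcongr
    nlinarith
  have hη1 : η ≤ 1 := by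
    have : 1 / k ≤ 1 := by rw [div_le_one hk0]; exact hk
    have : 0 < 1 / q := by positivity
    linarith
  have doob := lintegral_maxOn_rpow_le hF (fun R hR => (hc R hR).measurableSet)
    (μ := volume) (fun R hR => (hc R hR).volume_ne_top) (hu.pow_const k) hqk
  have e1 : ∀ x, maxOn F (fun R => lpAvg k u R) x ^ q =
      maxOn F (fun R => ⨍⁻ y in R, u y ^ k ∂volume) x ^ (q / k) := by
    intro x
    rw [maxOn_lpAvg_eq hk0, ← ENNReal.rpow_mul]
    congr 1; field_simp
  have e2 : ∀ x, (u x ^ k) ^ (q / k) = u x ^ q := by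
    intro x
    rw [← ENNReal.rpow_mul]
    congr 1; field_simp
  simp only [e2] at doob
  simp only [e1]
  calc _ ≤ (ENNReal.ofReal (q / k / (q / k - 1)) ^ (q / k) * ∫⁻ x, u x ^ q) ^ (1 / q) :=
        ENNReal.rpow_le_rpow doob (by positivity)
    _ = ENNReal.ofReal (q / k / (q / k - 1)) ^ (1 / k) * (∫⁻ x, u x ^ q) ^ (1 / q) := by
        rw [ENNReal.mul_rpow_of_nonneg _ _ (by positivity), ← ENNReal.rpow_mul]
        congr 2; field_simp
    _ ≤ ENNReal.ofReal (1 / η) ^ (1 / k) * (∫⁻ x, u x ^ q) ^ (1 / q) := by gcongr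
    _ ≤ _ := by
        gcongr
        rw [ENNReal.ofReal_rpow_of_pos (by positivity)]
        apply ENNReal.ofReal_le_ofReal
        -- Since 1/k = 1/q + η, replacing the exponent 1/k by 1/q costs only (1/η)^η ≤ 3.
        rw [h, Real.rpow_add (by positivity), mul_comm]
        gcongr
        exact one_div_rpow_self_le hη

open scoped Classical in
/-- Sums over disjoint carriers `E Q ⊆ Q` are controlled by integrals. -/
lemma sum_carrier_le {μ : Measure (Fin d → ℝ)} {G : Finset (Set (Fin d → ℝ))}
    {E : Set (Fin d → ℝ) → Set (Fin d → ℝ)} (hE : ∀ Q ∈ G, MeasurableSet (E Q))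
    (hdisj : ∀ I ∈ G, ∀ J ∈ G, I ≠ J → E I ∩ E J = ∅) {S : Set (Fin d → ℝ)}
    (hES : ∀ Q ∈ G, E Q ⊆ S) {φ : Set (Fin d → ℝ) → ℝ≥0∞}
    {g : (Fin d → ℝ) → ℝ≥0∞} (h : ∀ Q ∈ G, ∀ x ∈ E Q, φ Q ≤ g x) :
    ∑ Q ∈ G, μ (E Q) * φ Q ≤ ∫⁻ x in S, g x ∂μ := by
  calc ∑ Q ∈ G, μ (E Q) * φ Q = ∑ Q ∈ G, ∫⁻ _ in E Q, φ Q ∂μ := by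
        simp [mul_comm]
    _ ≤ ∑ Q ∈ G, ∫⁻ x in E Q, g x ∂μ :=
        Finset.sum_le_sum fun Q hQ => setLIntegral_mono' (hE Q hQ) (h Q hQ)
    _ = ∫⁻ x in ⋃ Q ∈ G, E Q, g x ∂μ := by
        rw [lintegral_biUnion_finset _ hE]
        intro I hI J hJ hIJ
        exact Set.disjoint_iff_inter_eq_empty.mpr (hdisj I hI J hJ hIJ)
    _ ≤ ∫⁻ x in S, g x ∂μ := lintegral_mono_set (iUnion₂_subset hES)

/-- A finite laminar family of cubes together with disjoint carriers. -/
structure Carried (F : Finset (Set (Fin d → ℝ))) (E : Set (Fin d → ℝ) → Set (Fin d → ℝ)) :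
    Prop where
  laminar : Laminar F
  isCube : ∀ Q ∈ F, IsCube Q
  measurableSet : ∀ Q ∈ F, MeasurableSet (E Q)
  subset : ∀ Q ∈ F, E Q ⊆ Q
  disjoint : ∀ I ∈ F, ∀ J ∈ F, I ≠ J → E I ∩ E J = ∅

variable {E : Set (Fin d → ℝ) → Set (Fin d → ℝ)}

lemma Carried.mono {G : Finset (Set (Fin d → ℝ))} (h : Carried F E) (hG : G ⊆ F) : Carried G E :=
  ⟨h.laminar.mono hG, fun Q hQ => h.isCube Q (hG hQ), fun Q hQ => h.measurableSet Q (hG hQ),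
    fun Q hQ => h.subset Q (hG hQ), fun I hI J hJ => h.disjoint I (hG hI) J (hG hJ)⟩

lemma Carried.sum_le (h : Carried F E) (φ : Set (Fin d → ℝ) → ℝ≥0∞) {Θ : ℝ≥0∞ → ℝ≥0∞}
    (hΘ : Monotone Θ) : ∑ Q ∈ F, volume (E Q) * Θ (φ Q) ≤ ∫⁻ x, Θ (maxOn F φ x) := by
  have := sum_carrier_le (μ := volume) h.measurableSet h.disjoint (S := univ)
    (fun _ _ => subset_univ _) (φ := fun Q => Θ (φ Q)) (g := fun x => Θ (maxOn F φ x))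
    (fun Q hQ x hx => hΘ (le_maxOn φ hQ (h.subset Q hQ hx)))
  simpa using this

lemma sum_mul_mul_le {ι : Type*} (s : Finset ι) {p : ℝ} (hp : 1 < p) (c a b : ι → ℝ≥0∞) :
    ∑ i ∈ s, c i * (a i * b i) ≤
      (∑ i ∈ s, c i * a i ^ p) ^ (1 / p) *
        (∑ i ∈ s, c i * b i ^ (p / (p - 1))) ^ (1 - 1 / p) := by
  have hp1 : 0 < p - 1 := by linarith
  have hconj : p.HolderConjugate (p / (p - 1)) := Real.HolderConjugate.conjExponent hp
  have := ENNReal.inner_le_Lp_mul_Lq s (fun i => c i ^ (1 / p) * a i)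
    (fun i => c i ^ (1 - 1 / p) * b i) hconj
  have hpp : 1 / (p / (p - 1)) = 1 - 1 / p := by field_simp
  have hp0 : 0 ≤ 1 - 1 / p := by rw [← hpp]; positivity
  rw [hpp] at this
  convert this using 1
  · refine Finset.sum_congr rfl fun i _ => ?_
    rw [show c i ^ (1 / p) * a i * (c i ^ (1 - 1 / p) * b i) =
      c i ^ (1 / p) * c i ^ (1 - 1 / p) * (a i * b i) by ring,
      ← ENNReal.rpow_add_of_nonneg _ _ (by positivity) hp0]
    simp
  · congr 2
    · refine Finset.sum_congr rfl fun i _ => ?_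
      rw [ENNReal.mul_rpow_of_nonneg _ _ (by positivity), ← ENNReal.rpow_mul,
        one_div_mul_cancel (by positivity), ENNReal.rpow_one]
    · refine Finset.sum_congr rfl fun i _ => ?_
      rw [ENNReal.mul_rpow_of_nonneg _ _ (by positivity), ← ENNReal.rpow_mul, ← hpp,
        one_div_mul_cancel (by positivity), ENNReal.rpow_one]

/-- The diagonal sum `∑ |E_Q| ⟨v⟩_{k,Q}^q`. -/
lemma Carried.sum_lpAvg_norm_le (h : Carried F E) {k q η : ℝ} (hk : 1 ≤ k)
    (hq : 0 < q) (hη : 0 < η) (hkq : 1 / k = 1 / q + η) {u : (Fin d → ℝ) → ℝ≥0∞}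
    (hu : AEMeasurable u) :
    (∑ Q ∈ F, volume (E Q) * lpAvg k u Q ^ q) ^ (1 / q) ≤
      ENNReal.ofReal (3 * (1 / η) ^ (1 / q)) * (∫⁻ x, u x ^ q) ^ (1 / q) := by
  refine le_trans ?_ (maxOn_lpAvg_norm_le h.laminar h.isCube hk hq hη hkq hu)
  exact ENNReal.rpow_le_rpow (h.sum_le (fun R => lpAvg k u R) (Θ := fun t => t ^ q)
    (fun a b hab => ENNReal.rpow_le_rpow hab hq.le)) (by positivity)

end Maximal

/-! ### Adjacent dyadic grids and the reduction to finite dyadic sparse families. -/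

/-- The translation, in units of the side length, of the two dyadic grids of the line. -/
def gridShift (b : Bool) (k : ℤ) : ℝ := if b then (if Even k then 1 / 3 else -1 / 3) else 0

/-- The index of the interval of generation `k` (and length `2 ^ (-k)`) containing `t`. -/
def gridIndex (b : Bool) (k : ℤ) (t : ℝ) : ℤ := ⌊2 ^ k * t - gridShift b k⌋

/-- The cubes of the adjacent dyadic grid `α`. -/
def gridCube (α : Fin d → Bool) (k : ℤ) (m : Fin d → ℤ) : Set (Fin d → ℝ) :=
  {x | ∀ i, gridIndex (α i) k (x i) = m i}

lemma floor_eq_of_floor_two_mul_eq {y z : ℝ} (h : ⌊2 * y⌋ = ⌊2 * z⌋) : ⌊y⌋ = ⌊z⌋ := by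
  have key : ∀ t : ℝ, ⌊t⌋ = ⌊2 * t⌋ / 2 := by
    intro t
    have h1 := Int.floor_le t
    have h2 := Int.lt_floor_add_one t
    have h3 : 2 * ⌊t⌋ ≤ ⌊2 * t⌋ := Int.le_floor.mpr (by push_cast; linarith)
    have h4 : ⌊2 * t⌋ < 2 * ⌊t⌋ + 2 := Int.floor_lt.mpr (by push_cast; linarith)
    omega
  rw [key y, key z, h]

/-- Consecutive generations are nested because the shift alternates between 1/3 and -1/3: twice the
shift of one generation minus that of the next is the integer 1 or -1, so only halving an integer
index remains. -/
lemma gridIndex_eq_of_succ {b : Bool} {k : ℤ} {t u : ℝ}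
    (h : gridIndex b (k + 1) t = gridIndex b (k + 1) u) : gridIndex b k t = gridIndex b k u := by
  obtain ⟨c, hc⟩ : ∃ c : ℤ, 2 * gridShift b k - gridShift b (k + 1) = c := by
    unfold gridShift
    cases b
    · exact ⟨0, by simp⟩
    · rcases Int.even_or_odd k with hk | hk
      · refine ⟨1, ?_⟩
        have : ¬ Even (k + 1) := by simpa [Int.even_add_one] using hk
        simp only [hk, this, if_true, if_false]; norm_num
      · refine ⟨-1, ?_⟩
        have h1 : ¬ Even k := Int.not_even_iff_odd.mpr hk
        have h2 : Even (k + 1) := Int.even_add_one.mpr h1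
        simp only [h1, h2, if_true, if_false]; norm_num
  have e : ∀ v : ℝ, gridIndex b (k + 1) v = ⌊2 * (2 ^ k * v - gridShift b k)⌋ + c := by
    intro v
    rw [gridIndex, ← Int.floor_add_intCast, ← hc, zpow_add_one₀ two_ne_zero]
    congr 1; ring
  rw [e, e, add_left_inj] at h
  exact floor_eq_of_floor_two_mul_eq h

lemma gridIndex_eq_of_le {b : Bool} {k k' : ℤ} (hk : k ≤ k') {t u : ℝ}
    (h : gridIndex b k' t = gridIndex b k' u) : gridIndex b k t = gridIndex b k u := by
  induction k', hk using Int.leInduction with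
  | base => exact h
  | succ n _ ih => exact ih (gridIndex_eq_of_succ h)

lemma gridIndex_eq_iff {b : Bool} {k m : ℤ} {t : ℝ} :
    gridIndex b k t = m ↔
      t ∈ Set.Ico ((m + gridShift b k) * 2 ^ (-k)) ((m + gridShift b k) * 2 ^ (-k) + 2 ^ (-k)) := by
  have h2 : (0 : ℝ) < 2 ^ k := by positivity
  rw [gridIndex, Int.floor_eq_iff, Set.mem_Ico, zpow_neg, ← div_eq_mul_inv, div_le_iff₀ h2,
    inv_eq_one_div, ← add_div, lt_div_iff₀ h2]
  constructor <;> rintro ⟨h, h'⟩ <;> constructor <;> linarith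

lemma gridCube_eq_pi (α : Fin d → Bool) (k : ℤ) (m : Fin d → ℤ) :
    gridCube α k m = Set.univ.pi fun i =>
      Set.Ico ((m i + gridShift (α i) k) * 2 ^ (-k))
        ((m i + gridShift (α i) k) * 2 ^ (-k) + 2 ^ (-k)) := by
  ext x
  simp only [gridCube, mem_ofPred_eq, Set.mem_pi, mem_univ, true_imp_iff, gridIndex_eq_iff]

lemma isCube_gridCube (α : Fin d → Bool) (k : ℤ) (m : Fin d → ℤ) : IsCube (gridCube α k m) :=
  ⟨_, 2 ^ (-k), by positivity, gridCube_eq_pi α k m⟩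

lemma volume_gridCube (α : Fin d → Bool) (k : ℤ) (m : Fin d → ℤ) :
    volume (gridCube α k m) = ENNReal.ofReal (2 ^ (-k)) ^ d := by
  rw [gridCube_eq_pi, volume_cube]

/-- The grid cube of generation `k` containing `x`. -/
def gridCubeAt (α : Fin d → Bool) (k : ℤ) (x : Fin d → ℝ) : Set (Fin d → ℝ) :=
  gridCube α k fun i => gridIndex (α i) k (x i)

lemma mem_gridCubeAt (α : Fin d → Bool) (k : ℤ) (x : Fin d → ℝ) : x ∈ gridCubeAt α k x :=
  fun _ => rfl

lemma gridCube_eq_gridCubeAt {α : Fin d → Bool} {k : ℤ} {m : Fin d → ℤ} {x : Fin d → ℝ}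
    (h : x ∈ gridCube α k m) : gridCube α k m = gridCubeAt α k x := by
  rw [gridCubeAt, funext h]

lemma gridCubeAt_subset {α : Fin d → Bool} {k k' : ℤ} (hk : k ≤ k') (x : Fin d → ℝ) :
    gridCubeAt α k' x ⊆ gridCubeAt α k x :=
  fun _ hy i => gridIndex_eq_of_le hk (hy i)

/-- The cubes of the grid `α`. -/
def grid (α : Fin d → Bool) : Set (Set (Fin d → ℝ)) := {Q | ∃ k m, Q = gridCube α k m}

lemma grid_countable (α : Fin d → Bool) : (grid α).Countable := by
  have : grid α = Set.range fun p : ℤ × (Fin d → ℤ) => gridCube α p.1 p.2 := by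
    ext Q
    simp [grid, eq_comm]
  rw [this]
  exact Set.countable_range _

lemma isCube_of_mem_grid {α : Fin d → Bool} {Q : Set (Fin d → ℝ)} (h : Q ∈ grid α) : IsCube Q := by
  obtain ⟨k, m, rfl⟩ := h
  exact isCube_gridCube α k m

lemma laminar_of_subset_grid {α : Fin d → Bool} {F : Finset (Set (Fin d → ℝ))}
    (h : ∀ Q ∈ F, Q ∈ grid α) : Laminar F := by
  refine ⟨fun A hA => (isCube_of_mem_grid (h A hA)).nonempty, fun A hA B hB => ?_⟩
  by_cases hd : Disjoint A B
  · exact Or.inr (Or.inr hd)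
  obtain ⟨x, hxA, hxB⟩ := Set.not_disjoint_iff.mp hd
  obtain ⟨k, m, rfl⟩ := h A hA
  obtain ⟨k', m', rfl⟩ := h B hB
  rw [gridCube_eq_gridCubeAt hxA, gridCube_eq_gridCubeAt hxB]
  rcases le_total k k' with hk | hk
  · exact Or.inr (Or.inl (gridCubeAt_subset hk x))
  · exact Or.inl (gridCubeAt_subset hk x)

/-- The one-third trick. If a rescaled interval of length below 1/3 crosses an integer n, it lies
within 1/3 of n, hence strictly between the neighbouring breakpoints of the lattice translated by
1/3 or -1/3. -/
lemma exists_gridIndex_const {k : ℤ} {a l : ℝ} (h : 2 ^ k * l < 1 / 3) :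
    ∃ b : Bool, ∀ t ∈ Set.Ico a (a + l), gridIndex b k t = gridIndex b k a := by
  have hscale : ∀ t ∈ Set.Ico a (a + l), 2 ^ k * a ≤ 2 ^ k * t ∧ 2 ^ k * t < 2 ^ k * a + 1 / 3 := by
    intro t ht
    have h2 : (0 : ℝ) < 2 ^ k := by positivity
    constructor
    · exact mul_le_mul_of_nonneg_left ht.1 h2.le
    · have := mul_lt_mul_of_pos_left ht.2 h2
      rw [mul_add] at this
      linarith
  by_cases hb : ∀ t ∈ Set.Ico a (a + l), gridIndex false k t = gridIndex false k a
  · exact ⟨false, hb⟩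
  push Not at hb
  obtain ⟨u, hu, hne⟩ := hb
  obtain ⟨hu1, hu2⟩ := hscale u hu
  simp only [gridIndex, gridShift, Bool.false_eq_true, if_false, sub_zero] at hne
  set A := (2 : ℝ) ^ k * a
  have hA1 := Int.floor_le A
  have hA2 := Int.lt_floor_add_one A
  have hfl : ((⌊A⌋ + 1 : ℤ) : ℝ) ≤ 2 ^ k * u := by
    apply Int.le_floor.mp
    have : ⌊A⌋ ≤ ⌊(2 : ℝ) ^ k * u⌋ := Int.floor_mono hu1
    omega
  push_cast at hfl
  refine ⟨true, fun t ht => ?_⟩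
  obtain ⟨h1, h2⟩ := hscale t ht
  simp only [gridIndex, gridShift, if_true]
  split_ifs
  · exact ((Int.floor_eq_iff (z := ⌊A⌋)).mpr ⟨by linarith, by linarith⟩).trans
      ((Int.floor_eq_iff (z := ⌊A⌋)).mpr ⟨by linarith, by linarith⟩).symm
  · exact ((Int.floor_eq_iff (z := ⌊A⌋ + 1)).mpr
      ⟨by push_cast; linarith, by push_cast; linarith⟩).trans
      ((Int.floor_eq_iff (z := ⌊A⌋ + 1)).mpr ⟨by push_cast; linarith, by push_cast; linarith⟩).symm

/-- Every cube is contained in a cube of comparable size of one of the adjacent grids. -/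
lemma exists_gridCube_superset {Q : Set (Fin d → ℝ)} (hQ : IsCube Q) :
    ∃ (α : Fin d → Bool) (R : Set (Fin d → ℝ)), R ∈ grid α ∧ Q ⊆ R ∧
      volume R ≤ 6 ^ d * volume Q := by
  obtain ⟨a, l, hl, rfl⟩ := hQ
  -- The side length 2^(n+1) of the new cube exceeds 3 l, as the one-third trick requires, and is at
  -- most 6 l. Each coordinate picks its own shift, whence 2^d grids.
  obtain ⟨n, hn1, hn2⟩ := exists_mem_Ico_zpow (show 0 < 3 * l by positivity) (one_lt_two (α := ℝ))
  have hk : (2 : ℝ) ^ (-(n + 1)) * l < 1 / 3 := by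
    rw [zpow_neg, inv_mul_lt_iff₀ (by positivity)]
    linarith
  choose α hα using fun i => exists_gridIndex_const (a := a i) hk
  refine ⟨α, gridCubeAt α (-(n + 1)) a, ⟨_, _, rfl⟩, fun x hx i => hα i _ (hx i (mem_univ i)), ?_⟩
  rw [gridCubeAt, volume_gridCube, volume_cube, ← mul_pow]
  gcongr
  rw [show (6 : ℝ≥0∞) = ENNReal.ofReal 6 by simp, ← ENNReal.ofReal_mul (by norm_num)]
  apply ENNReal.ofReal_le_ofReal
  rw [neg_neg, zpow_add_one₀ two_ne_zero]
  linarith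

/-- Finite sparse families of cubes of a grid. -/
structure GridSparse (α : Fin d → Bool) (F : Finset (Set (Fin d → ℝ)))
    (E : Set (Fin d → ℝ) → Set (Fin d → ℝ)) : Prop extends Carried F E where
  mem_grid : ∀ Q ∈ F, Q ∈ grid α
  volume_le : ∀ Q ∈ F, volume Q ≤ 2 * 6 ^ d * volume (E Q)

/-- Bounds for sparse forms over finite sparse subfamilies of a dyadic grid imply bounds for
general sparse forms. -/
theorem sparseForm_le {S : Set (Set (Fin d → ℝ))} (hS : IsSparse (1 / 2) S) {s : ℝ} (hs : 1 ≤ s)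
    {f₁ f₂ : (Fin d → ℝ) → ℂ} {B : ℝ≥0∞}
    (hB : ∀ (α : Fin d → Bool) (F : Finset (Set (Fin d → ℝ)))
      (E : Set (Fin d → ℝ) → Set (Fin d → ℝ)), GridSparse α F E →
      ∑ Q ∈ F, volume (E Q) * (lpAvg s (absFun f₁) Q * lpAvg s (absFun f₂) Q) ≤ B) :
    sparseForm S s s f₁ f₂ ≤ 2 ^ d * (6 ^ d * 6 ^ d * 2) * B := by
  classical
  obtain ⟨-, hcube, E, hE, hdisj⟩ := hS
  choose! α R hR hQR hvol using fun Q (hQ : Q ∈ S) => exists_gridCube_superset (hcube Q hQ)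
  have h2E : ∀ Q ∈ S, volume Q ≤ 2 * volume (E Q) := by
    intro Q hQ
    have h := (hE Q hQ).2.2
    calc volume Q = 2 * (ENNReal.ofReal (1 / 2) * volume Q) := by
          rw [← mul_assoc, show (2 : ℝ≥0∞) = ENNReal.ofReal 2 by simp,
            ← ENNReal.ofReal_mul (by norm_num)]
          norm_num
      _ ≤ _ := by gcongr
  have h6 : (1 : ℝ≥0∞) ≤ 6 ^ d := one_le_pow₀ (by norm_num)
  have havg : ∀ Q ∈ S, ∀ g : (Fin d → ℝ) → ℝ≥0∞, lpAvg s g Q ≤ 6 ^ d * lpAvg s g (R Q) :=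
    fun Q hQ g => lpAvg_le_of_subset hs (isCube_of_mem_grid (hR Q hQ)) (hQR Q hQ) h6 (hvol Q hQ) g
  rw [sparseForm, ENNReal.tsum_eq_iSup_sum]
  refine iSup_le fun t => ?_
  set Φ : Set (Fin d → ℝ) → ℝ≥0∞ := fun Q => lpAvg s (absFun f₁) Q * lpAvg s (absFun f₂) Q
  have hΦ : ∀ Q ∈ S, Φ Q ≤ 6 ^ d * 6 ^ d * Φ (R Q) := by
    intro Q hQ
    calc Φ Q ≤ (6 ^ d * lpAvg s (absFun f₁) (R Q)) * (6 ^ d * lpAvg s (absFun f₂) (R Q)) :=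
          mul_le_mul' (havg Q hQ _) (havg Q hQ _)
      _ = _ := by ring
  set t₀ : Finset (Set (Fin d → ℝ)) := t.map (Function.Embedding.subtype _)
  have ht₀ : ∀ Q ∈ t₀, Q ∈ S := by
    intro Q hQ
    simp only [t₀, Finset.mem_map, Function.Embedding.subtype_apply] at hQ
    obtain ⟨a, -, rfl⟩ := hQ
    exact a.2
  have hsum : ∑ Q ∈ t, volume (Q : Set (Fin d → ℝ)) * Φ Q = ∑ Q ∈ t₀, volume Q * Φ Q := by
    simp [t₀]
  change ∑ Q ∈ t, volume (Q : Set (Fin d → ℝ)) * Φ Q ≤ _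
  rw [hsum, ← Finset.sum_fiberwise t₀ α]
  have hα : ∀ β : Fin d → Bool, ∑ Q ∈ t₀ with α Q = β, volume Q * Φ Q ≤
      6 ^ d * 6 ^ d * 2 * B := by
    intro β
    set t₁ := t₀.filter (α · = β)
    have ht₁ : ∀ Q ∈ t₁, Q ∈ S ∧ α Q = β := fun Q hQ =>
      ⟨ht₀ Q (Finset.mem_filter.mp hQ).1, (Finset.mem_filter.mp hQ).2⟩
    -- Several cubes may be enlarged to the same dyadic cube; pooling their carriers keeps the
    -- carriers disjoint and makes the sum over the fibre exact.
    set E' : Set (Fin d → ℝ) → Set (Fin d → ℝ) := fun P => ⋃ Q ∈ t₁.filter (R · = P), E Q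
    have hfib : ∀ P, ∀ Q ∈ t₁.filter (R · = P), Q ∈ S ∧ α Q = β ∧ R Q = P := fun P Q hQ =>
      ⟨(ht₁ Q (Finset.mem_filter.mp hQ).1).1, (ht₁ Q (Finset.mem_filter.mp hQ).1).2,
        (Finset.mem_filter.mp hQ).2⟩
    have hvolE' : ∀ P, volume (E' P) = ∑ Q ∈ t₁.filter (R · = P), volume (E Q) := by
      intro P
      refine measure_biUnion_finset (fun I hI J hJ hIJ => ?_) fun Q hQ => (hE Q (hfib P Q hQ).1).1
      exact Set.disjoint_iff_inter_eq_empty.mpr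
        (hdisj I (hfib P I hI).1 J (hfib P J hJ).1 hIJ)
    have hgrid : ∀ P ∈ t₁.image R, P ∈ grid β := by
      intro P hP
      obtain ⟨Q, hQ, rfl⟩ := Finset.mem_image.mp hP
      rw [← (ht₁ Q hQ).2]
      exact hR Q (ht₁ Q hQ).1
    have hsp : GridSparse β (t₁.image R) E' := by
      refine ⟨⟨laminar_of_subset_grid hgrid, fun P hP => isCube_of_mem_grid (hgrid P hP), ?_, ?_,
        ?_⟩, hgrid, ?_⟩
      · exact fun P _ => Finset.measurableSet_biUnion _ fun Q hQ => (hE Q (hfib P Q hQ).1).1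
      · intro P _
        refine iUnion₂_subset fun Q hQ => ?_
        rw [← (hfib P Q hQ).2.2]
        exact (hE Q (hfib P Q hQ).1).2.1.trans (hQR Q (hfib P Q hQ).1)
      · intro I _ J _ hIJ
        rw [← Set.disjoint_iff_inter_eq_empty]
        refine Set.disjoint_iUnion₂_left.mpr fun A hA => Set.disjoint_iUnion₂_right.mpr fun C hC => ?_
        refine Set.disjoint_iff_inter_eq_empty.mpr
          (hdisj A (hfib I A hA).1 C (hfib J C hC).1 ?_)
        rintro rfl
        exact hIJ ((hfib I A hA).2.2.symm.trans (hfib J A hC).2.2)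
      · intro P hP
        obtain ⟨Q, hQ, rfl⟩ := Finset.mem_image.mp hP
        have hQS := (ht₁ Q hQ).1
        have hsub : E Q ⊆ E' (R Q) :=
          Set.subset_biUnion_of_mem (u := E) (s := {x | x ∈ t₁.filter (R · = R Q)})
            (by simp [hQ])
        calc volume (R Q) ≤ 6 ^ d * volume Q := hvol Q hQS
          _ ≤ 6 ^ d * (2 * volume (E Q)) := by gcongr; exact h2E Q hQS
          _ ≤ 6 ^ d * (2 * volume (E' (R Q))) := by gcongr
          _ = _ := by ring
    rw [← Finset.sum_fiberwise_of_maps_to (g := R) (t := t₁.image R)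
      fun Q hQ => Finset.mem_image_of_mem R hQ]
    calc ∑ P ∈ t₁.image R, ∑ Q ∈ t₁ with R Q = P, volume Q * Φ Q
        ≤ ∑ P ∈ t₁.image R, ∑ Q ∈ t₁ with R Q = P,
            6 ^ d * 6 ^ d * 2 * (volume (E Q) * Φ P) := by
          refine Finset.sum_le_sum fun P _ => Finset.sum_le_sum fun Q hQ => ?_
          obtain ⟨hQS, -, hRQ⟩ := hfib P Q hQ
          calc volume Q * Φ Q ≤ (2 * volume (E Q)) * (6 ^ d * 6 ^ d * Φ (R Q)) :=
                mul_le_mul' (h2E Q hQS) (hΦ Q hQS)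
            _ = _ := by rw [hRQ]; ring
      _ = 6 ^ d * 6 ^ d * 2 * ∑ P ∈ t₁.image R, volume (E' P) * Φ P := by
          rw [Finset.mul_sum]
          refine Finset.sum_congr rfl fun P _ => ?_
          rw [hvolE', Finset.sum_mul, Finset.mul_sum]
      _ ≤ 6 ^ d * 6 ^ d * 2 * B := by
          gcongr
          exact hB β _ E' hsp
  calc ∑ β, ∑ Q ∈ t₀ with α Q = β, volume Q * Φ Q
      ≤ ∑ _β : Fin d → Bool, 6 ^ d * 6 ^ d * 2 * B := Finset.sum_le_sum fun β _ => hα β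
    _ = _ := by simp; ring

/-! ### The reverse Hölder inequality with exponent governed by the Fujii–Wilson constant. -/

section ReverseHolder

open Filter Topology

lemma lintegral_maximalFn_le_aInftyConst {w : (Fin d → ℝ) → ℝ≥0∞} (hA : aInftyConst w ≠ ∞)
    {Q : Set (Fin d → ℝ)} (hQ : IsCube Q) (hfin : ∫⁻ x in Q, w x ≠ ∞) :
    ∫⁻ x in Q, maximalFn 1 (Q.indicator w) x ≤ aInftyConst w * ∫⁻ x in Q, w x := by
  have h : (∫⁻ x in Q, maximalFn 1 (Q.indicator w) x) / ∫⁻ x in Q, w x ≤ aInftyConst w :=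
    le_iSup₂ (f := fun (Q : Set (Fin d → ℝ)) (_ : IsCube Q) =>
      (∫⁻ x in Q, maximalFn 1 (Q.indicator w) x) / ∫⁻ x in Q, w x) Q hQ
  refine (ENNReal.div_le_iff_le_mul (Or.inr hA) (Or.inl hfin)).mp h

lemma le_maximalFn {r : ℝ} {g : (Fin d → ℝ) → ℝ≥0∞} {Q : Set (Fin d → ℝ)} (hQ : IsCube Q)
    {x : Fin d → ℝ} (hx : x ∈ Q) : lpAvg r g Q ≤ maximalFn r g x := by
  unfold maximalFn
  exact le_iSup_of_le Q (le_iSup_of_le hQ (le_iSup_of_le hx le_rfl))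

lemma setLAverage_le_maximalFn_indicator {w : (Fin d → ℝ) → ℝ≥0∞} {Q R : Set (Fin d → ℝ)}
    (hQ : IsCube Q) (hQR : Q ⊆ R) {x : Fin d → ℝ} (hx : x ∈ Q) :
    ⨍⁻ y in Q, w y ∂volume ≤ maximalFn 1 (R.indicator w) x := by
  refine le_trans ?_ (le_maximalFn hQ hx)
  rw [lpAvg_one]
  refine (setLAverage_congr_fun hQ.measurableSet fun y hy => ?_).le
  rw [indicator_of_mem (hQR hy)]

/-- Young's inequality for b a^δ. What matters is the small factor δ on the right: it is what allows
absorption when δ is a small multiple of the inverse A_∞ constant. -/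
lemma rpow_sub_mul_le {δ : ℝ} (hδ : 0 < δ) {a b : ℝ≥0∞} (hba : b ≤ a) (ha : a ≠ ∞) :
    (a ^ δ - b ^ δ) * b ≤ ENNReal.ofReal δ * (a ^ (1 + δ) - b ^ (1 + δ)) := by
  have hp0 : (0 : ℝ) ≤ 1 + δ := by linarith
  lift a to ℝ≥0 using ha
  lift b to ℝ≥0 using ne_top_of_le_ne_top ENNReal.coe_ne_top hba
  have hba' : b ≤ a := by exact_mod_cast hba
  have hb0 : (0 : ℝ) ≤ b := b.2
  have ha0 : (0 : ℝ) ≤ a := a.2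
  rw [← ENNReal.coe_rpow_of_nonneg _ hδ.le, ← ENNReal.coe_rpow_of_nonneg _ hδ.le,
    ← ENNReal.coe_rpow_of_nonneg _ hp0, ← ENNReal.coe_rpow_of_nonneg _ hp0, ENNReal.ofReal]
  norm_cast
  rw [← NNReal.coe_le_coe, NNReal.coe_mul, NNReal.coe_mul,
    NNReal.coe_sub (NNReal.rpow_le_rpow hba' hδ.le), NNReal.coe_sub (NNReal.rpow_le_rpow hba' hp0),
    Real.coe_toNNReal _ hδ.le]
  push_cast
  have hconj : (1 + δ).HolderConjugate ((1 + δ) / (1 + δ - 1)) :=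
    Real.HolderConjugate.conjExponent (by linarith)
  have hy := Real.young_inequality_of_nonneg hb0 (Real.rpow_nonneg ha0 δ) hconj
  have e1 : ((a : ℝ) ^ δ) ^ ((1 + δ) / (1 + δ - 1)) = (a : ℝ) ^ (1 + δ) := by
    rw [← Real.rpow_mul ha0]; congr 1; rw [add_sub_cancel_left]; field_simp
  have e2 : (b : ℝ) ^ δ * b = (b : ℝ) ^ (1 + δ) := by
    rw [Real.rpow_one_add' hb0 (by linarith), mul_comm]
  have hmono : (b : ℝ) ^ (1 + δ) ≤ (a : ℝ) ^ (1 + δ) :=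
    Real.rpow_le_rpow hb0 (by exact_mod_cast hba') hp0
  rw [e1] at hy
  set A := (a : ℝ) ^ (1 + δ)
  set B := (b : ℝ) ^ (1 + δ)
  have e3 : B / (1 + δ) + A / ((1 + δ) / (1 + δ - 1)) = B + δ / (1 + δ) * (A - B) := by
    field_simp; ring
  have e4 : δ / (1 + δ) * (A - B) ≤ δ * (A - B) := by
    have : δ / (1 + δ) ≤ δ := div_le_self hδ.le (by linarith)
    have h : 0 ≤ A - B := by linarith
    gcongr
  rw [sub_mul, e2]
  linarith

/-- The core of the reverse Hölder inequality, on a finite tree of subcubes of `Q`. -/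
lemma lintegral_mul_maxOn_rpow_le {w : (Fin d → ℝ) → ℝ≥0∞} (hw : AEMeasurable w)
    (hA : aInftyConst w ≠ ∞) {F : Finset (Set (Fin d → ℝ))} (hF : Laminar F)
    (hc : ∀ R ∈ F, IsCube R) {Q : Set (Fin d → ℝ)} (hsub : ∀ R ∈ F, R ⊆ Q)
    (hpar : ∀ R ∈ F, R ≠ Q → ∃ R' ∈ F, R ⊂ R' ∧ volume R' ≤ 2 ^ d * volume R)
    (hfin : ∫⁻ x in Q, w x ≠ ∞) {δ : ℝ} (hδ : 0 < δ)
    (hδA : ENNReal.ofReal δ * (2 ^ (d + 1) * aInftyConst w) ≤ 1) :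
    ∫⁻ x, w x * maxOn F (fun R => ⨍⁻ y in R, w y ∂volume) x ^ δ ≤
      2 * ((⨍⁻ y in Q, w y ∂volume) ^ δ * ∫⁻ x in Q, w x) := by
  set φ : Set (Fin d → ℝ) → ℝ≥0∞ := fun R => ⨍⁻ y in R, w y ∂volume with hφ
  set M := maxOn F φ
  have hm : ∀ R ∈ F, MeasurableSet R := fun R hR => (hc R hR).measurableSet
  have hM : Measurable M := measurable_maxOn hm φ
  have hfinR : ∀ R ∈ F, ∫⁻ x in R, w x ≠ ∞ := fun R hR =>
    ne_top_of_le_ne_top hfin (lintegral_mono_set (hsub R hR))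
  have hφfin : ∀ R ∈ F, φ R ≠ ∞ := fun R hR => (setLAverage_lt_top (hfinR R hR)).ne
  have hUfin : ∀ R, upSup F φ R ≠ ∞ := fun R =>
    ne_top_of_le_ne_top (ENNReal.sum_ne_top.mpr hφfin) (upSup_le fun A hA _ =>
      Finset.single_le_sum (f := φ) (fun _ _ => zero_le) hA)
  have hmon : ∀ s : ℝ, 0 < s → Monotone fun t : ℝ≥0∞ => t ^ s :=
    fun s hs a b h => ENNReal.rpow_le_rpow h hs.le
  have hz : ∀ s : ℝ, 0 < s → (0 : ℝ≥0∞) ^ s = 0 := fun s hs => ENNReal.zero_rpow_of_pos hs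
  set Z := ∫⁻ x, w x * M x ^ δ
  set Y := ∫⁻ x, M x ^ (1 + δ)
  have hZ : Z = ∑ R ∈ F, incr F φ (fun t => t ^ δ) R * ∫⁻ x in R, w x :=
    lintegral_mul_comp_maxOn hF hm φ (hmon δ hδ) (hz δ hδ) hw
  have hY1 : Y = ∑ R ∈ F, incr F φ (fun t => t ^ (1 + δ)) R * volume R :=
    lintegral_comp_maxOn hF hm φ (hmon _ (by linarith)) (hz _ (by linarith)) volume
  -- `Y` is expanded a second time, with M^(1+δ) = M · M^δ, so that the integrals of `M` over single
  -- cubes appear, which is what A_∞ controls.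
  have hY2 : Y = ∑ R ∈ F, incr F φ (fun t => t ^ δ) R * ∫⁻ x in R, M x := by
    rw [← lintegral_mul_comp_maxOn hF hm φ (hmon δ hδ) (hz δ hδ) hM.aemeasurable]
    refine lintegral_congr fun x => ?_
    rw [ENNReal.rpow_add_of_nonneg _ _ zero_le_one hδ.le, ENNReal.rpow_one]
  have hYZ : Y ≤ aInftyConst w * Z := by
    rw [hY2, hZ, Finset.mul_sum]
    refine Finset.sum_le_sum fun R hR => ?_
    by_cases h0 : incr F φ (fun t => t ^ δ) R = 0
    · simp [h0]
    have hU := upSup_eq_of_incr_ne_zero hR h0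
    -- On `R` the maximum over the whole tree is dominated by the maximal function of the weight
    -- localised to `R`: the ancestors contribute at most φ R because the increment at `R` is
    -- nonzero.
    have : ∫⁻ x in R, M x ≤ aInftyConst w * ∫⁻ x in R, w x := by
      refine le_trans (setLIntegral_mono' (hm R hR) fun x hx => ?_)
        (lintegral_maximalFn_le_aInftyConst hA (hc R hR) (hfinR R hR))
      refine maxOn_le fun P hP hxP => ?_
      rcases hF.comparable hP hR hxP hx with h | h
      · exact setLAverage_le_maximalFn_indicator (hc P hP) h hxP
      · refine ((le_upSup φ hP h).trans hU.le).trans ?_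
        exact setLAverage_le_maximalFn_indicator (hc R hR) subset_rfl hx
    calc _ ≤ incr F φ (fun t => t ^ δ) R * (aInftyConst w * ∫⁻ x in R, w x) := by gcongr
      _ = _ := by ring
  -- Below the root, the mass of w on R is at most 2^d |R| times the average over the parent, hence
  -- times the strict running maximum, and `rpow_sub_mul_le` applies. The root has no parent and
  -- gives the first term.
  have hZY : Z ≤ φ Q ^ δ * (∫⁻ x in Q, w x) + ENNReal.ofReal δ * 2 ^ d * Y := by
    classical
    have hterm : ∀ R ∈ F, incr F φ (fun t => t ^ δ) R * ∫⁻ x in R, w x ≤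
        (if R = Q then φ Q ^ δ * ∫⁻ x in Q, w x else 0) +
          ENNReal.ofReal δ * 2 ^ d * (incr F φ (fun t => t ^ (1 + δ)) R * volume R) := by
      intro R hR
      split_ifs with hRQ
      · subst hRQ
        refine le_add_right ?_
        gcongr
        refine tsub_le_self.trans (ENNReal.rpow_le_rpow (upSup_le fun P hP hRP => ?_) hδ.le)
        rw [subset_antisymm (hsub P hP) hRP]
      · obtain ⟨P, hP, hRP, hvol⟩ := hpar R hR hRQ
        rw [zero_add]
        have hb : ∫⁻ x in R, w x ≤ 2 ^ d * volume R * strictUpSup F φ R := by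
          calc ∫⁻ x in R, w x ≤ ∫⁻ x in P, w x := lintegral_mono_set hRP.subset
            _ = volume P * φ P := (measure_mul_setLAverage _ (hc P hP).volume_ne_top).symm
            _ ≤ _ := mul_le_mul' hvol (le_strictUpSup φ hP hRP)
        calc incr F φ (fun t => t ^ δ) R * ∫⁻ x in R, w x
            ≤ incr F φ (fun t => t ^ δ) R * (2 ^ d * volume R * strictUpSup F φ R) := by gcongr
          _ = (incr F φ (fun t => t ^ δ) R * strictUpSup F φ R) * (2 ^ d * volume R) := by ring
          _ ≤ (ENNReal.ofReal δ * incr F φ (fun t => t ^ (1 + δ)) R) * (2 ^ d * volume R) := by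
              refine mul_le_mul_left ?_ _
              exact rpow_sub_mul_le hδ (strictUpSup_le_upSup φ R) (hUfin R)
          _ = _ := by ring
    rw [hZ]
    refine (Finset.sum_le_sum hterm).trans ?_
    rw [Finset.sum_add_distrib, ← Finset.mul_sum, ← hY1]
    gcongr
    rw [Finset.sum_ite_eq']
    split_ifs <;> simp
  have hZfin : Z ≠ ∞ := by
    rw [hZ]
    refine ENNReal.sum_ne_top.mpr fun R hR => ENNReal.mul_ne_top ?_ (hfinR R hR)
    exact ne_top_of_le_ne_top (ENNReal.rpow_ne_top_of_nonneg hδ.le (hUfin R)) tsub_le_self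
  -- The power 2^(d+1) in the hypothesis on δ is chosen so that exactly half of `Z` is absorbed;
  -- `hZfin` permits the subtraction.
  have hhalf : ENNReal.ofReal δ * 2 ^ d * Y ≤ Z / 2 := by
    rw [ENNReal.le_div_iff_mul_le (by simp) (by simp)]
    calc ENNReal.ofReal δ * 2 ^ d * Y * 2
        ≤ ENNReal.ofReal δ * 2 ^ d * (aInftyConst w * Z) * 2 := by gcongr
      _ = ENNReal.ofReal δ * (2 ^ (d + 1) * aInftyConst w) * Z := by ring
      _ ≤ 1 * Z := by gcongr
      _ = Z := one_mul Z
  have h2 : Z / 2 + Z / 2 ≤ φ Q ^ δ * (∫⁻ x in Q, w x) + Z / 2 := by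
    rw [ENNReal.add_halves]
    exact hZY.trans (by gcongr)
  have h3 : Z / 2 ≤ φ Q ^ δ * ∫⁻ x in Q, w x :=
    (ENNReal.add_le_add_iff_right (ENNReal.div_ne_top hZfin (by simp))).mp h2
  calc Z = 2 * (Z / 2) := (ENNReal.mul_div_cancel (by simp) (by simp)).symm
    _ ≤ _ := by gcongr

/-- Grid cubes are balls of the sup norm up to null sets, so the Vitali differentiation theorem for
closed balls applies to them. The point need not be the centre, which is why membership in a ball
dilated by the factor 1 is recorded. -/
lemma gridCubeAt_ae_eq_closedBall (α : Fin d → Bool) (k : ℤ) (x : Fin d → ℝ) :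
    ∃ c : Fin d → ℝ, x ∈ Metric.closedBall c (1 * (2 ^ (-k) / 2)) ∧
      gridCubeAt α k x =ᵐ[volume] Metric.closedBall c (2 ^ (-k) / 2) := by
  have hr : (0 : ℝ) ≤ 2 ^ (-k) / 2 := by positivity
  set m : Fin d → ℤ := fun i => gridIndex (α i) k (x i)
  refine ⟨fun i => (m i + gridShift (α i) k) * 2 ^ (-k) + 2 ^ (-k) / 2, ?_⟩
  set c : Fin d → ℝ := fun i => (m i + gridShift (α i) k) * 2 ^ (-k) + 2 ^ (-k) / 2 with hc
  have hsub : gridCubeAt α k x ⊆ Metric.closedBall c (2 ^ (-k) / 2) := by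
    intro y hy
    rw [gridCubeAt, gridCube_eq_pi] at hy
    rw [Metric.mem_closedBall, dist_pi_le_iff hr]
    intro i
    obtain ⟨h1, h2⟩ := hy i (mem_univ i)
    rw [Real.dist_eq, abs_le, hc]
    constructor <;> linarith
  refine ⟨by rw [one_mul]; exact hsub (mem_gridCubeAt α k x), ?_⟩
  refine ae_eq_of_subset_of_measure_ge hsub ?_
    (isCube_gridCube α k m).measurableSet.nullMeasurableSet ?_
  · rw [gridCubeAt, volume_gridCube, Real.volume_pi_closedBall _ hr, Fintype.card_fin,
      ENNReal.ofReal_pow (by positivity), mul_div_cancel₀ _ two_ne_zero]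
  · rw [Real.volume_pi_closedBall _ hr]
    exact ENNReal.ofReal_ne_top

/-- Lebesgue differentiation along the cubes of a grid. -/
lemma ae_tendsto_setLAverage_gridCubeAt (α : Fin d → Bool) (k : ℤ) {f : (Fin d → ℝ) → ℝ≥0∞}
    (hf : AEMeasurable f) (hfin : ∫⁻ x, f x ≠ ∞) :
    ∀ᵐ x, Tendsto (fun n : ℕ => ⨍⁻ y in gridCubeAt α (k + n) x, f y ∂volume) atTop (𝓝 (f x)) := by
  filter_upwards [(IsUnifLocDoublingMeasure.vitaliFamily
    (volume : Measure (Fin d → ℝ)) 1).ae_tendsto_lintegral_div hf hfin] with x hx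
  choose c hc1 hc2 using fun n : ℕ => gridCubeAt_ae_eq_closedBall α (k + n) x
  have hlim : Tendsto (fun n : ℕ => (2 : ℝ) ^ (-(k + n)) / 2) atTop (𝓝[>] 0) := by
    refine tendsto_nhdsWithin_iff.mpr ⟨?_, Eventually.of_forall fun n => ?_⟩
    · have : ∀ n : ℕ, (2 : ℝ) ^ (-(k + n)) / 2 = (2 : ℝ) ^ (-k) / 2 * (1 / 2) ^ n := by
        intro n
        rw [neg_add, zpow_add₀ two_ne_zero, zpow_neg _ (n : ℤ), zpow_natCast, one_div, inv_pow]
        ring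
      simp_rw [this]
      have := (tendsto_pow_atTop_nhds_zero_of_lt_one (r := (1 / 2 : ℝ)) (by norm_num)
        (by norm_num)).const_mul ((2 : ℝ) ^ (-k) / 2)
      simpa using this
    · exact mem_Ioi.mpr (by positivity)
  have := hx.comp (IsUnifLocDoublingMeasure.tendsto_closedBall_filterAt volume c _ hlim
    (Eventually.of_forall hc1))
  refine this.congr fun n => ?_
  simp only [Function.comp]
  rw [setLAverage_eq, setLIntegral_congr (hc2 n), measure_congr (hc2 n)]

/-- The grid subcubes of `Q` of the generations `k, …, k + n`. -/
def subcubes (α : Fin d → Bool) (k : ℤ) (n : ℕ) (Q : Set (Fin d → ℝ)) : Set (Set (Fin d → ℝ)) :=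
  {P | ∃ j : ℤ, k ≤ j ∧ j ≤ k + n ∧ ∃ x ∈ Q, P = gridCubeAt α j x}

lemma finite_subcubes (α : Fin d → Bool) (k : ℤ) (n : ℕ) {Q : Set (Fin d → ℝ)} (hQ : IsCube Q) :
    (subcubes α k n Q).Finite := by
  obtain ⟨a, l, hl, rfl⟩ := hQ
  have hmono : ∀ (b : Bool) (j : ℤ), Monotone (gridIndex b j) := by
    intro b j t u htu
    refine Int.floor_mono (sub_le_sub_right ?_ _)
    exact mul_le_mul_of_nonneg_left htu (by positivity)
  have hfin : (⋃ j ∈ Set.Icc k (k + n), (fun m => gridCube α j m) ''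
      Set.Icc (fun i => gridIndex (α i) j (a i)) (fun i => gridIndex (α i) j (a i + l))).Finite :=
    (Set.finite_Icc _ _).biUnion fun j _ => (Set.finite_Icc _ _).image _
  refine hfin.subset ?_
  rintro P ⟨j, hj1, hj2, x, hx, rfl⟩
  refine mem_biUnion (x := j) ⟨hj1, hj2⟩ ⟨_, ⟨fun i => ?_, fun i => ?_⟩, rfl⟩
  · exact hmono _ _ (hx i (mem_univ i)).1
  · exact hmono _ _ (hx i (mem_univ i)).2.le

/-- The sharp reverse Hölder inequality for `A_∞` weights. -/
theorem reverse_holder (hd : 1 ≤ d) {w : (Fin d → ℝ) → ℝ≥0∞} (hw : AEMeasurable w)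
    (hA : aInftyConst w ≠ ∞)
    {α : Fin d → Bool} {Q : Set (Fin d → ℝ)} (hQ : Q ∈ grid α) (hfin : ∫⁻ x in Q, w x ≠ ∞)
    {δ : ℝ} (hδ : 0 < δ) (hδA : ENNReal.ofReal δ * (2 ^ (d + 1) * aInftyConst w) ≤ 1) :
    lpAvg (1 + δ) w Q ≤ 2 * lpAvg 1 w Q := by
  have hQc := isCube_of_mem_grid hQ
  obtain ⟨k, m, hQk⟩ := hQ
  set φ : Set (Fin d → ℝ) → ℝ≥0∞ := fun R => ⨍⁻ y in R, w y ∂volume with hφ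
  have hQat : ∀ x ∈ Q, Q = gridCubeAt α k x := fun x hx => by
    rw [hQk] at hx ⊢; exact gridCube_eq_gridCubeAt hx
  set F : ℕ → Finset (Set (Fin d → ℝ)) := fun n => (finite_subcubes α k n hQc).toFinset
  have memF : ∀ {n : ℕ} {P}, P ∈ F n ↔ P ∈ subcubes α k n Q := by
    intro n P; simp [F]
  have hgrid : ∀ n, ∀ P ∈ F n, P ∈ grid α := by
    intro n P hP
    obtain ⟨j, -, -, x, -, rfl⟩ := memF.mp hP
    exact ⟨_, _, rfl⟩
  have hbound : ∀ n, ∫⁻ x in Q, w x * maxOn (F n) φ x ^ δ ≤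
      2 * (φ Q ^ δ * ∫⁻ x in Q, w x) := by
    intro n
    refine (lintegral_mono' Measure.restrict_le_self le_rfl).trans ?_
    refine lintegral_mul_maxOn_rpow_le hw hA (laminar_of_subset_grid (hgrid n))
      (fun R hR => isCube_of_mem_grid (hgrid n R hR)) ?_ ?_ hfin hδ hδA
    · intro R hR
      obtain ⟨j, hj, -, x, hx, rfl⟩ := memF.mp hR
      rw [hQat x hx]
      exact gridCubeAt_subset hj x
    · intro R hR hRQ
      obtain ⟨j, hj1, hj2, x, hx, rfl⟩ := memF.mp hR
      have hjk : k < j := lt_of_le_of_ne hj1 (by rintro rfl; exact hRQ (hQat x hx).symm)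
      have hvol : volume (gridCubeAt α (j - 1) x) = 2 ^ d * volume (gridCubeAt α j x) := by
        rw [gridCubeAt, gridCubeAt, volume_gridCube, volume_gridCube, ← mul_pow,
          show (2 : ℝ≥0∞) = ENNReal.ofReal 2 by simp, ← ENNReal.ofReal_mul (by norm_num),
          show -(j - 1) = -j + 1 by ring, zpow_add_one₀ two_ne_zero, mul_comm]
      have hsub := gridCubeAt_subset (α := α) (show j - 1 ≤ j by omega) x
      refine ⟨gridCubeAt α (j - 1) x, memF.mpr ⟨j - 1, by omega, by omega, x, hx, rfl⟩, ?_,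
        hvol.le⟩
      -- Strictness of the parent uses d ≥ 1: equality would force 2^d = 1.
      refine hsub.ssubset_of_ne fun h => ?_
      rw [← h] at hvol
      have hc := isCube_gridCube α j fun i => gridIndex (α i) j (x i)
      have h1 : (1 : ℝ≥0∞) = 2 ^ d :=
        (ENNReal.mul_left_inj hc.volume_ne_zero hc.volume_ne_top).mp ((one_mul _).trans hvol)
      exact (one_lt_pow₀ (by norm_num : (1 : ℝ≥0∞) < 2) (by omega)).ne h1
  -- Lebesgue differentiation recovers w from averages over ever smaller subcubes, and Fatou
  -- transfers the bounds for finite trees, which do not depend on the depth.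
  have hae : ∀ᵐ x ∂volume.restrict Q, w x ^ (1 + δ) ≤
      liminf (fun n => w x * maxOn (F n) φ x ^ δ) atTop := by
    have hfin' : ∫⁻ x, Q.indicator w x ≠ ∞ := by rwa [lintegral_indicator hQc.measurableSet]
    have hlt : ∀ᵐ x ∂volume.restrict Q, w x < ∞ := ae_lt_top' hw.restrict hfin
    filter_upwards [ae_restrict_of_ae (ae_tendsto_setLAverage_gridCubeAt α k
      (hw.indicator hQc.measurableSet) hfin'), ae_restrict_mem hQc.measurableSet, hlt]
      with x hx hxQ hwx
    rw [indicator_of_mem hxQ] at hx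
    have h1 : Tendsto (fun n : ℕ => w x *
        (⨍⁻ y in gridCubeAt α (k + n) x, Q.indicator w y ∂volume) ^ δ) atTop
        (𝓝 (w x * w x ^ δ)) :=
      ENNReal.Tendsto.const_mul ((ENNReal.continuous_rpow_const.tendsto _).comp hx)
        (Or.inr hwx.ne)
    rw [ENNReal.rpow_add_of_nonneg _ _ zero_le_one hδ.le, ENNReal.rpow_one, ← h1.liminf_eq]
    refine liminf_le_liminf (Eventually.of_forall fun n => ?_)
    have hsub : gridCubeAt α (k + n) x ⊆ Q := by
      rw [hQat x hxQ]; exact gridCubeAt_subset (by omega) x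
    have e : ⨍⁻ y in gridCubeAt α (k + n) x, Q.indicator w y ∂volume =
        φ (gridCubeAt α (k + n) x) :=
      setLAverage_congr_fun (isCube_gridCube _ _ _).measurableSet fun y hy => by
        rw [indicator_of_mem (hsub hy)]
    rw [e]
    gcongr
    exact le_maxOn φ (memF.mpr ⟨k + n, by omega, le_rfl, x, hxQ, rfl⟩) (mem_gridCubeAt _ _ _)
  have hint : ∫⁻ x in Q, w x ^ (1 + δ) ≤ 2 * (φ Q ^ δ * ∫⁻ x in Q, w x) := by
    refine (lintegral_mono_ae hae).trans ?_
    refine (lintegral_liminf_le' fun n => ?_).trans ?_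
    · refine (hw.mul ((measurable_maxOn ?_ φ).pow_const δ).aemeasurable).restrict
      exact fun R hR => (isCube_of_mem_grid (hgrid n R hR)).measurableSet
    · exact (liminf_le_of_le (h := fun b hb => by
        obtain ⟨n, hn⟩ := hb.exists
        exact hn.trans (hbound n)))
  have hav : ⨍⁻ x in Q, w x ^ (1 + δ) ∂volume ≤ 2 * lpAvg 1 w Q ^ (1 + δ) := by
    rw [setLAverage_eq]
    refine ENNReal.div_le_of_le_mul (hint.trans_eq ?_)
    rw [← volume_mul_lpAvg_one w hQc, lpAvg_one, ENNReal.rpow_add_of_nonneg _ _ zero_le_one hδ.le,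
      ENNReal.rpow_one]
    ring
  calc lpAvg (1 + δ) w Q ≤ (2 * lpAvg 1 w Q ^ (1 + δ)) ^ (1 / (1 + δ)) :=
        ENNReal.rpow_le_rpow hav (by positivity)
    _ = 2 ^ (1 / (1 + δ)) * lpAvg 1 w Q := by
        rw [ENNReal.mul_rpow_of_nonneg _ _ (by positivity), ← ENNReal.rpow_mul,
          mul_one_div_cancel (by positivity), ENNReal.rpow_one]
    _ ≤ 2 * lpAvg 1 w Q := by
        gcongr
        calc (2 : ℝ≥0∞) ^ (1 / (1 + δ)) ≤ 2 ^ (1 : ℝ) :=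
              ENNReal.rpow_le_rpow_of_exponent_le (by norm_num)
                (by rw [div_le_one] <;> linarith)
          _ = 2 := ENNReal.rpow_one 2

end ReverseHolder

/-! ### Muckenhoupt pairs, and the A_∞ constant as at most a multiple of the A_p constant. -/

/-- A weight `w` and its dual weight `σ = w ^ (1 - p')`, both locally integrable, with `A_p`
constant at most `A`. -/
structure MuckenhouptPair (p : ℝ) (w σ : (Fin d → ℝ) → ℝ≥0∞) (A : ℝ≥0∞) : Prop where
  aemeasurable_left : AEMeasurable w
  aemeasurable_right : AEMeasurable σ
  left_ne_top : ∀ Q, IsCube Q → ∫⁻ x in Q, w x ≠ ∞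
  right_ne_top : ∀ Q, IsCube Q → ∫⁻ x in Q, σ x ≠ ∞
  ae_dual : ∀ᵐ x, w x ≠ 0 ∧ w x ≠ ∞ ∧ σ x = w x ^ (-(1 / (p - 1)))
  le : ∀ Q, IsCube Q → (⨍⁻ x in Q, w x ∂volume) * (⨍⁻ x in Q, σ x ∂volume) ^ (p - 1) ≤ A

namespace MuckenhouptPair

variable {p : ℝ} {w σ : (Fin d → ℝ) → ℝ≥0∞} {A : ℝ≥0∞}

lemma ae_right (h : MuckenhouptPair p w σ A) : ∀ᵐ x, σ x ≠ 0 ∧ σ x ≠ ∞ := by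
  filter_upwards [h.ae_dual] with x ⟨h0, h1, h2⟩
  rw [h2]
  exact ⟨by simp [ENNReal.rpow_eq_zero_iff, h0, h1], ENNReal.rpow_ne_top_of_ne_zero h0 h1⟩

/-- Raising the A_p condition to the power 1/(p-1) = p' - 1 exchanges the roles of the two weights.
Statements proved for w are thereby available for σ. -/
lemma symm (hp : 1 < p) (h : MuckenhouptPair p w σ A) :
    MuckenhouptPair (p / (p - 1)) σ w (A ^ (1 / (p - 1))) := by
  have hp1 : 0 < p - 1 := by linarith
  have e : p / (p - 1) - 1 = 1 / (p - 1) := by field_simp; ring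
  refine ⟨h.aemeasurable_right, h.aemeasurable_left, h.right_ne_top, h.left_ne_top, ?_, ?_⟩
  · filter_upwards [h.ae_dual, h.ae_right] with x ⟨_, _, h2⟩ ⟨h3, h4⟩
    refine ⟨h3, h4, ?_⟩
    rw [h2, ← ENNReal.rpow_mul, e, one_div_one_div]
    rw [show -(1 / (p - 1)) * -(p - 1) = 1 by field_simp, ENNReal.rpow_one]
  · intro Q hQ
    have := ENNReal.rpow_le_rpow (h.le Q hQ) (by positivity : 0 ≤ 1 / (p - 1))
    rw [ENNReal.mul_rpow_of_nonneg _ _ (by positivity), ← ENNReal.rpow_mul,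
      mul_one_div_cancel hp1.ne', ENNReal.rpow_one] at this
    rwa [e, mul_comm]

lemma lintegral_left_ne_zero (h : MuckenhouptPair p w σ A) {Q : Set (Fin d → ℝ)}
    (hQ : IsCube Q) : ∫⁻ x in Q, w x ≠ 0 := by
  rw [Ne, lintegral_eq_zero_iff' h.aemeasurable_left.restrict]
  intro h0
  have : ∀ᵐ _ ∂volume.restrict Q, False := by
    filter_upwards [h0, ae_restrict_of_ae h.ae_dual] with x hx1 hx2
    exact hx2.1 hx1
  rw [ae_iff] at this
  exact hQ.volume_ne_zero (by simpa using this)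

lemma lintegral_right_ne_zero (hp : 1 < p) (h : MuckenhouptPair p w σ A) {Q : Set (Fin d → ℝ)}
    (hQ : IsCube Q) : ∫⁻ x in Q, σ x ≠ 0 :=
  (h.symm hp).lintegral_left_ne_zero hQ

end MuckenhouptPair

section Density

variable {w : (Fin d → ℝ) → ℝ≥0∞}

lemma lintegral_withDensity_restrict (hw : AEMeasurable w) {Q : Set (Fin d → ℝ)}
    (hQ : MeasurableSet Q) {f : (Fin d → ℝ) → ℝ≥0∞} (hf : AEMeasurable f) :
    ∫⁻ x in Q, f x ∂(volume.withDensity w) = ∫⁻ x in Q, f x * w x := by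
  rw [restrict_withDensity hQ, lintegral_withDensity_eq_lintegral_mul₀ hw.restrict hf.restrict]
  simp [mul_comm]

lemma lintegral_withDensity' (hw : AEMeasurable w) {f : (Fin d → ℝ) → ℝ≥0∞}
    (hf : AEMeasurable f) :
    ∫⁻ x, f x ∂(volume.withDensity w) = ∫⁻ x, f x * w x := by
  rw [lintegral_withDensity_eq_lintegral_mul₀ hw hf]
  simp [mul_comm]

lemma setLAverage_withDensity (hw : AEMeasurable w) {Q : Set (Fin d → ℝ)}
    (hQ : MeasurableSet Q) {f : (Fin d → ℝ) → ℝ≥0∞} (hf : AEMeasurable f) :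
    ⨍⁻ x in Q, f x ∂(volume.withDensity w) = (∫⁻ x in Q, f x * w x) / ∫⁻ x in Q, w x := by
  rw [setLAverage_eq, lintegral_withDensity_restrict hw hQ hf, withDensity_apply _ hQ]

end Density

/-- Buckley's theorem, tested on indicators, for finite laminar families. -/
lemma MuckenhouptPair.lintegral_maxOn_le {p : ℝ} (hp : 1 < p) {w σ : (Fin d → ℝ) → ℝ≥0∞}
    {A : ℝ≥0∞} (h : MuckenhouptPair p w σ A) {F : Finset (Set (Fin d → ℝ))} (hF : Laminar F)
    (hc : ∀ R ∈ F, IsCube R) {R : Set (Fin d → ℝ)} (hR : IsCube R) :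
    ∫⁻ x in R, maxOn F (fun Q => ⨍⁻ y in Q, R.indicator w y ∂volume) x ≤
      ENNReal.ofReal (p / (p - 1)) ^ (p - 1) * ENNReal.ofReal p * A * ∫⁻ x in R, w x := by
  have hp0 : 0 < p := by linarith
  have hp1 : 0 < p - 1 := by linarith
  have hw := h.aemeasurable_left
  have hσ := h.aemeasurable_right
  have hm : ∀ Q ∈ F, MeasurableSet Q := fun Q hQ => (hc Q hQ).measurableSet
  have hRm := hR.measurableSet
  set μw := (volume : Measure (Fin d → ℝ)).withDensity w
  set μσ := (volume : Measure (Fin d → ℝ)).withDensity σ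
  set one : (Fin d → ℝ) → ℝ≥0∞ := R.indicator 1
  have hone : Measurable one := measurable_one.indicator hRm
  -- Two iterated weighted maximal functions: `a` averages the indicator of `R` against w, `u` is a
  -- power of its maximal function, and `b` averages u/σ against σ. Each is bounded by Doob for its
  -- own measure, with constants independent of the weight.
  set a : Set (Fin d → ℝ) → ℝ≥0∞ := fun Q => ⨍⁻ y in Q, one y ∂μw
  set u : (Fin d → ℝ) → ℝ≥0∞ := fun x => maxOn F a x ^ (1 / (p - 1))
  have hu : Measurable u := (measurable_maxOn hm a).pow_const _
  set b : Set (Fin d → ℝ) → ℝ≥0∞ := fun Q => ⨍⁻ y in Q, u y * (σ y)⁻¹ ∂μσ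
  have huσ : AEMeasurable fun y => u y * (σ y)⁻¹ := hu.aemeasurable.mul hσ.inv
  have hbM : Measurable (maxOn F b) := measurable_maxOn hm b
  -- The unweighted average is a_Q ⟨w⟩_Q, and a_Q ≤ (b_Q ⟨σ⟩_Q)^(p-1) since u ≥ a_Q^(1/(p-1)) on Q.
  -- The A_p condition is used here only, hence the linear dependence on `A`.
  have hφ : ∀ Q ∈ F, ⨍⁻ y in Q, R.indicator w y ∂volume ≤ A * b Q ^ (p - 1) := by
    intro Q hQ
    have hQc := hc Q hQ
    have hσQ0 := h.lintegral_right_ne_zero hp hQc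
    have hσQ := h.right_ne_top Q hQc
    have hwQ0 := h.lintegral_left_ne_zero hQc
    have hwQ := h.left_ne_top Q hQc
    have ha : a Q = (∫⁻ x in Q, R.indicator w x) / ∫⁻ x in Q, w x := by
      simp only [a, μw]
      rw [setLAverage_withDensity hw (hm Q hQ) hone.aemeasurable]
      congr 1
      refine lintegral_congr fun x => ?_
      by_cases hx : x ∈ R <;> simp [one, hx]
    have hb : b Q = (∫⁻ x in Q, u x) / ∫⁻ x in Q, σ x := by
      simp only [b, μσ]
      rw [setLAverage_withDensity hσ (hm Q hQ) huσ]
      congr 1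
      refine lintegral_congr_ae ?_
      filter_upwards [ae_restrict_of_ae h.ae_right] with x ⟨h0, h1⟩
      rw [mul_assoc, ENNReal.inv_mul_cancel h0 h1, mul_one]
    have hub : a Q ^ (1 / (p - 1)) * volume Q ≤ ∫⁻ x in Q, u x := by
      rw [← setLIntegral_const]
      refine setLIntegral_mono' (hm Q hQ) fun x hx => ?_
      exact ENNReal.rpow_le_rpow (le_maxOn a hQ hx) (by positivity)
    have hb' : a Q ^ (1 / (p - 1)) ≤ b Q * ⨍⁻ x in Q, σ x ∂volume := by
      rw [hb, setLAverage_eq]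
      calc a Q ^ (1 / (p - 1)) = a Q ^ (1 / (p - 1)) * volume Q / volume Q :=
            (ENNReal.mul_div_cancel_right hQc.volume_ne_zero hQc.volume_ne_top).symm
        _ ≤ (∫⁻ x in Q, u x) / volume Q := by gcongr
        _ = (∫⁻ x in Q, u x) / (∫⁻ x in Q, σ x) * (∫⁻ x in Q, σ x) / volume Q := by
            rw [ENNReal.div_mul_cancel hσQ0 hσQ]
        _ = _ := by rw [mul_div_assoc]
    have ha' : a Q ≤ b Q ^ (p - 1) * (⨍⁻ x in Q, σ x ∂volume) ^ (p - 1) := by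
      have := ENNReal.rpow_le_rpow hb' hp1.le
      rwa [← ENNReal.rpow_mul, one_div_mul_cancel hp1.ne', ENNReal.rpow_one,
        ENNReal.mul_rpow_of_nonneg _ _ hp1.le] at this
    calc ⨍⁻ y in Q, R.indicator w y ∂volume
        = a Q * ⨍⁻ x in Q, w x ∂volume := by
          rw [ha, setLAverage_eq, setLAverage_eq, ← mul_div_assoc,
            ENNReal.div_mul_cancel hwQ0 hwQ]
      _ ≤ b Q ^ (p - 1) * (⨍⁻ x in Q, σ x ∂volume) ^ (p - 1) * ⨍⁻ x in Q, w x ∂volume := by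
          gcongr
      _ = ((⨍⁻ x in Q, w x ∂volume) * (⨍⁻ x in Q, σ x ∂volume) ^ (p - 1)) * b Q ^ (p - 1) := by
          ring
      _ ≤ A * b Q ^ (p - 1) := by gcongr; exact h.le Q hQc
  have hmax : ∀ x, maxOn F (fun Q => ⨍⁻ y in Q, R.indicator w y ∂volume) x ≤
      A * maxOn F b x ^ (p - 1) := fun x =>
    maxOn_le fun Q hQ hx => (hφ Q hQ).trans (by gcongr; exact le_maxOn b hQ hx)
  have doobσ : ∫⁻ x, maxOn F b x ^ p * σ x ≤
      ENNReal.ofReal (p / (p - 1)) ^ p * ∫⁻ x, u x ^ p * w x := by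
    have := lintegral_maxOn_rpow_le hF hm (μ := μσ)
      (fun Q hQ => by rw [withDensity_apply _ (hm Q hQ)]; exact h.right_ne_top Q (hc Q hQ))
      (huσ.mono_ac (withDensity_absolutelyContinuous _ _)) hp
    rw [lintegral_withDensity' hσ (hbM.pow_const p).aemeasurable,
      lintegral_withDensity' hσ (huσ.pow_const p)] at this
    refine this.trans_eq ?_
    congr 1
    refine lintegral_congr_ae ?_
    filter_upwards [h.ae_right, (h.symm hp).ae_dual] with x ⟨h0, h1⟩ ⟨_, _, h2⟩
    rw [ENNReal.mul_rpow_of_nonneg _ _ hp0.le, mul_assoc, h2, ← ENNReal.rpow_neg_one,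
      ← ENNReal.rpow_mul (σ x)]
    congr 1
    calc σ x ^ (-1 * p) * σ x = σ x ^ (-1 * p) * σ x ^ (1 : ℝ) := by rw [ENNReal.rpow_one]
      _ = σ x ^ (-1 * p + 1) := (ENNReal.rpow_add _ _ h0 h1).symm
      _ = _ := by congr 1; field_simp; ring
  -- Here u^p is the maximal function of `a` to the power p', so Doob is applied in L^(p')(w), whose
  -- constant is (p')' = p.
  have doobw : ∫⁻ x, u x ^ p * w x ≤
      ENNReal.ofReal p ^ (p / (p - 1)) * ∫⁻ x in R, w x := by
    have hpp : 1 < p / (p - 1) := by rw [lt_div_iff₀ hp1]; linarith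
    have := lintegral_maxOn_rpow_le hF hm (μ := μw)
      (fun Q hQ => by rw [withDensity_apply _ (hm Q hQ)]; exact h.left_ne_top Q (hc Q hQ))
      hone.aemeasurable hpp
    rw [lintegral_withDensity' hw ((measurable_maxOn hm _).pow_const _).aemeasurable,
      lintegral_withDensity' hw (hone.pow_const _).aemeasurable,
      show p / (p - 1) / (p / (p - 1) - 1) = p by field_simp; ring] at this
    convert this using 2
    · ext x
      rw [← ENNReal.rpow_mul]
      congr 2; field_simp
    · rw [← lintegral_indicator hRm]
      refine lintegral_congr fun x => ?_
      have : 0 < p / (p - 1) := by positivity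
      by_cases hx : x ∈ R <;> simp [one, hx, this]
  set W := ∫⁻ x in R, w x
  calc ∫⁻ x in R, maxOn F (fun Q => ⨍⁻ y in Q, R.indicator w y ∂volume) x
      ≤ ∫⁻ x in R, A * maxOn F b x ^ (p - 1) := lintegral_mono hmax
    _ = A * ∫⁻ x in R, maxOn F b x ^ (p - 1) := lintegral_const_mul _ (hbM.pow_const _)
    -- The inserted factor σ^(1/p') w^(1/p) equals one almost everywhere; it prepares Hölder between
    -- the two weights.
    _ = A * ∫⁻ x in R, (maxOn F b x ^ p * σ x) ^ (1 - 1 / p) * w x ^ (1 / p) := by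
        congr 1
        refine lintegral_congr_ae ?_
        filter_upwards [ae_restrict_of_ae h.ae_dual] with x ⟨h0, h1, h2⟩
        have hp' : 0 ≤ 1 - 1 / p := by
          rw [sub_nonneg, div_le_one hp0]; exact hp.le
        rw [ENNReal.mul_rpow_of_nonneg _ _ hp', mul_assoc, h2, ← ENNReal.rpow_mul,
          ← ENNReal.rpow_mul, ← ENNReal.rpow_add _ _ h0 h1,
          show -(1 / (p - 1)) * (1 - 1 / p) + 1 / p = 0 by field_simp; ring, ENNReal.rpow_zero,
          mul_one]
        congr 1; field_simp
    _ ≤ A * ((∫⁻ x in R, maxOn F b x ^ p * σ x) ^ (1 - 1 / p) * W ^ (1 / p)) := by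
        gcongr
        exact ENNReal.lintegral_mul_norm_pow_le
          ((hbM.pow_const _).aemeasurable.mul hσ).restrict hw.restrict
          (by rw [sub_nonneg, div_le_one hp0]; exact hp.le) (by positivity) (by ring)
    _ ≤ A * ((ENNReal.ofReal (p / (p - 1)) ^ p * (ENNReal.ofReal p ^ (p / (p - 1)) * W)) ^
          (1 - 1 / p) * W ^ (1 / p)) := by
        have hp' : 0 ≤ 1 - 1 / p := by
          rw [sub_nonneg, div_le_one hp0]; exact hp.le
        gcongr
        refine (lintegral_mono' Measure.restrict_le_self le_rfl).trans (doobσ.trans ?_)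
        gcongr
    _ = _ := by
        have hp' : 0 ≤ 1 - 1 / p := by
          rw [sub_nonneg, div_le_one hp0]; exact hp.le
        rw [ENNReal.mul_rpow_of_nonneg _ _ hp', ENNReal.mul_rpow_of_nonneg _ _ hp',
          ← ENNReal.rpow_mul, ← ENNReal.rpow_mul,
          show p * (1 - 1 / p) = p - 1 by field_simp,
          show p / (p - 1) * (1 - 1 / p) = 1 by field_simp, ENNReal.rpow_one]
        calc A * (ENNReal.ofReal (p / (p - 1)) ^ (p - 1) *
              (ENNReal.ofReal p * W ^ (1 - 1 / p)) * W ^ (1 / p))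
            = ENNReal.ofReal (p / (p - 1)) ^ (p - 1) * ENNReal.ofReal p * A *
              (W ^ (1 - 1 / p) * W ^ (1 / p)) := by ring
          _ = _ := by
              rw [← ENNReal.rpow_add_of_nonneg _ _ hp' (by positivity)]
              simp

/-- Bounds over finite subfamilies of the grids imply bounds for the maximal function. -/
lemma lintegral_maximalFn_one_le {g : (Fin d → ℝ) → ℝ≥0∞} {R : Set (Fin d → ℝ)} {B : ℝ≥0∞}
    (hB : ∀ (α : Fin d → Bool) (F : Finset (Set (Fin d → ℝ))), (∀ Q ∈ F, Q ∈ grid α) →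
      ∫⁻ x in R, maxOn F (fun Q => ⨍⁻ y in Q, g y ∂volume) x ≤ B) :
    ∫⁻ x in R, maximalFn 1 g x ≤ 6 ^ d * (2 ^ d * B) := by
  classical
  set φ : Set (Fin d → ℝ) → ℝ≥0∞ := fun Q => ⨍⁻ y in Q, g y ∂volume
  have hne : ∀ α : Fin d → Bool, (grid α).Nonempty := fun α => ⟨_, 0, 0, rfl⟩
  -- Each grid is enumerated so that finite subfamilies increase to it and monotone convergence
  -- applies.
  choose e he using fun α : Fin d → Bool => (grid_countable α).exists_eq_range (hne α)
  set F : (Fin d → Bool) → ℕ → Finset (Set (Fin d → ℝ)) := fun α n =>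
    (Finset.range n).image (e α)
  have hF : ∀ α n, ∀ Q ∈ F α n, Q ∈ grid α := by
    intro α n Q hQ
    obtain ⟨i, -, rfl⟩ := Finset.mem_image.mp hQ
    rw [he α]; exact mem_range_self i
  have hmeas : ∀ α n, Measurable (maxOn (F α n) φ) := fun α n =>
    measurable_maxOn (fun Q hQ => (isCube_of_mem_grid (hF α n Q hQ)).measurableSet) φ
  have hmono : ∀ α, Monotone fun n => maxOn (F α n) φ := by
    intro α n m hnm x
    refine maxOn_le fun Q hQ hx => le_maxOn φ ?_ hx
    exact Finset.image_subset_image (Finset.range_mono hnm) hQ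
  have hpt : ∀ x, maximalFn 1 g x ≤ 6 ^ d * ∑ α, ⨆ n, maxOn (F α n) φ x := by
    intro x
    refine iSup_le fun Q => iSup_le fun hQ => iSup_le fun hx => ?_
    obtain ⟨α, P, hP, hQP, hvol⟩ := exists_gridCube_superset hQ
    refine (lpAvg_le_of_subset le_rfl (isCube_of_mem_grid hP) hQP (one_le_pow₀ (by norm_num))
      hvol g).trans ?_
    gcongr
    rw [lpAvg_one]
    obtain ⟨n, hn⟩ : P ∈ range (e α) := he α ▸ hP
    calc φ P ≤ maxOn (F α (n + 1)) φ x :=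
          le_maxOn φ (Finset.mem_image.mpr ⟨n, by simp, hn⟩) (hQP hx)
      _ ≤ ⨆ n, maxOn (F α n) φ x := le_iSup (fun n => maxOn (F α n) φ x) (n + 1)
      _ ≤ _ := Finset.single_le_sum (f := fun α => ⨆ n, maxOn (F α n) φ x)
          (fun _ _ => zero_le) (Finset.mem_univ α)
  have hsup : ∀ α, Measurable fun x => ⨆ n, maxOn (F α n) φ x := fun α => Measurable.iSup (hmeas α)
  calc ∫⁻ x in R, maximalFn 1 g x ≤ ∫⁻ x in R, 6 ^ d * ∑ α, ⨆ n, maxOn (F α n) φ x :=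
        lintegral_mono hpt
    _ = 6 ^ d * ∑ α, ∫⁻ x in R, ⨆ n, maxOn (F α n) φ x := by
        rw [lintegral_const_mul _ (Finset.measurable_fun_sum _ fun α _ => hsup α),
          lintegral_finsetSum _ fun α _ => hsup α]
    _ ≤ 6 ^ d * ∑ _α : Fin d → Bool, B := by
        gcongr with α
        rw [lintegral_iSup (hmeas α) (hmono α)]
        exact iSup_le fun n => hB α (F α n) (hF α n)
    _ = _ := by simp

/-- The Fujii–Wilson quotient is exactly Buckley's estimate tested on the indicator of a cube. -/
theorem MuckenhouptPair.aInftyConst_le {p : ℝ} (hp : 1 < p) {w σ : (Fin d → ℝ) → ℝ≥0∞}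
    {A : ℝ≥0∞} (h : MuckenhouptPair p w σ A) :
    aInftyConst w ≤
      6 ^ d * (2 ^ d * (ENNReal.ofReal (p / (p - 1)) ^ (p - 1) * ENNReal.ofReal p)) * A := by
  refine iSup₂_le fun R hR => ENNReal.div_le_of_le_mul ?_
  refine (lintegral_maximalFn_one_le fun α F hF => h.lintegral_maxOn_le hp
    (laminar_of_subset_grid hF) (fun Q hQ => isCube_of_mem_grid (hF Q hQ)) hR).trans_eq ?_
  ring

/-! ### Duality, and the passage from sparse sums to weighted bounds for T f. -/

lemma enorm_rpow_sub_two_mul {p : ℝ} (hp : 1 < p) (z : ℂ) {c : ℝ≥0∞} (hc : c ≠ ∞) :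
    ‖((‖z‖ ^ (p - 2) * c.toReal : ℝ) : ℂ) * z‖ₑ = ‖z‖ₑ ^ (p - 1) * c := by
  have h1 : 0 < p - 1 := by linarith
  rw [← ofReal_norm, ← ofReal_norm, ENNReal.ofReal_rpow_of_nonneg (norm_nonneg z) h1.le]
  nth_rewrite 2 [← ENNReal.ofReal_toReal hc]
  rw [← ENNReal.ofReal_mul (by positivity), norm_mul, Complex.norm_real, Real.norm_eq_abs,
    abs_of_nonneg (by positivity)]
  congr 1
  rcases eq_or_lt_of_le (norm_nonneg z) with h | h
  · rw [← h, Real.zero_rpow h1.ne']; simp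
  · rw [show p - 1 = (p - 2) + 1 by ring, Real.rpow_add_one h.ne']
    ring

/-- The weighted `L^p` norm by duality. -/
theorem wNorm_le_of_dual {p : ℝ} (hp : 1 < p) {g : (Fin d → ℝ) → ℂ}
    (hg : AEStronglyMeasurable g volume) {w : (Fin d → ℝ) → ℝ≥0∞} (hw : AEMeasurable w)
    (hwfin : ∀ᵐ x, w x ≠ ∞) {N : ℝ≥0∞}
    (h : ∀ (f₂ : (Fin d → ℝ) → ℂ) (v : (Fin d → ℝ) → ℝ≥0∞), IsBddCompSupp f₂ → AEMeasurable v →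
      absFun f₂ =ᵐ[volume] (fun x => v x * w x ^ (1 / p)) → ∫⁻ x, v x ^ (p / (p - 1)) ≠ ∞ →
      ‖∫ x, g x * conj (f₂ x)‖ₑ ≤ N * (∫⁻ x, v x ^ (p / (p - 1))) ^ (1 - 1 / p)) :
    wNorm p w (absFun g) ≤ N := by
  have hp0 : 0 < p := by linarith
  have hp1 : 0 < p - 1 := by linarith
  have hp' : 0 ≤ 1 - 1 / p := by rw [sub_nonneg, div_le_one hp0]; exact hp.le
  set g₀ := hg.mk g with hg₀
  have hg₀m : Measurable g₀ := hg.stronglyMeasurable_mk.measurable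
  have hgg : g =ᵐ[volume] g₀ := hg.ae_eq_mk
  set w₀ := hw.mk w
  have hw₀m : Measurable w₀ := hw.measurable_mk
  have hww : w =ᵐ[volume] w₀ := hw.ae_eq_mk
  -- Truncation to bounded position, function and weight, so that the extremal dual function
  -- |g|^(p-2) g w is admissible and all integrals are finite.
  set S : ℕ → Set (Fin d → ℝ) := fun n =>
    Metric.closedBall 0 n ∩ ({x | ‖g₀ x‖ ≤ n} ∩ {x | w₀ x ≤ n}) with hS
  have hSm : ∀ n, MeasurableSet (S n) := fun n =>
    Metric.isClosed_closedBall.measurableSet.inter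
      ((measurableSet_le hg₀m.norm measurable_const).inter (measurableSet_le hw₀m measurable_const))
  set Φ : (Fin d → ℝ) → ℝ≥0∞ := fun x => ‖g₀ x‖ₑ ^ p * w₀ x
  have hΦm : Measurable Φ := (hg₀m.enorm.pow_const p).mul hw₀m
  have hI : ∀ n, (∫⁻ x in S n, Φ x) ^ (1 / p) ≤ N := by
    intro n
    have hwS : ∀ x ∈ S n, w₀ x ≠ ∞ := fun x hx =>
      ne_top_of_le_ne_top (ENNReal.natCast_ne_top n) hx.2.2
    have hgS : ∀ x ∈ S n, ‖g₀ x‖ₑ ≤ n := fun x hx => by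
      rw [← ofReal_norm, ← ENNReal.ofReal_natCast]
      exact ENNReal.ofReal_le_ofReal hx.2.1
    set f₂ : (Fin d → ℝ) → ℂ := (S n).indicator fun x =>
      ((‖g₀ x‖ ^ (p - 2) * (w₀ x).toReal : ℝ) : ℂ) * g₀ x with hf₂
    have hf₂m : Measurable f₂ := by
      refine Measurable.indicator ?_ (hSm n)
      exact (Complex.measurable_ofReal.comp ((hg₀m.norm.pow_const _).mul hw₀m.ennreal_toReal)).mul
        hg₀m
    set v : (Fin d → ℝ) → ℝ≥0∞ := (S n).indicator fun x =>
      ‖g₀ x‖ₑ ^ (p - 1) * w₀ x ^ (1 - 1 / p) with hv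
    have hvm : Measurable v :=
      ((hg₀m.enorm.pow_const _).mul (hw₀m.pow_const _)).indicator (hSm n)
    have hf₂v : ∀ x, ‖f₂ x‖ₑ = v x * w₀ x ^ (1 / p) := by
      intro x
      by_cases hx : x ∈ S n
      · simp only [hf₂, hv, indicator_of_mem hx]
        rw [enorm_rpow_sub_two_mul hp _ (hwS x hx), mul_assoc,
          ← ENNReal.rpow_add_of_nonneg _ _ hp' (by positivity)]
        simp
      · simp [hf₂, hv, hx]
    have hbound : ∀ x, ‖f₂ x‖ₑ ≤ (n : ℝ≥0∞) ^ (p - 1) * n := by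
      intro x
      by_cases hx : x ∈ S n
      · simp only [hf₂, indicator_of_mem hx]
        rw [enorm_rpow_sub_two_mul hp _ (hwS x hx)]
        gcongr
        · exact hgS x hx
        · exact hx.2.2
      · simp [hf₂, hx]
    have hbs : IsBddCompSupp f₂ := by
      constructor
      · refine ⟨hf₂m.aestronglyMeasurable, ?_⟩
        rw [eLpNorm_exponent_top]
        refine (essSup_le_of_ae_le _ (Filter.Eventually.of_forall hbound)).trans_lt ?_
        exact ENNReal.mul_lt_top (ENNReal.rpow_lt_top_of_nonneg hp1.le (ENNReal.natCast_ne_top n))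
          (ENNReal.natCast_lt_top n)
      · refine HasCompactSupport.intro (isCompact_closedBall (0 : Fin d → ℝ) n) fun x hx => ?_
        exact indicator_of_notMem (fun h => hx h.1) _
    have hvint : ∫⁻ x, v x ^ (p / (p - 1)) = ∫⁻ x in S n, Φ x := by
      rw [← lintegral_indicator (hSm n)]
      refine lintegral_congr fun x => ?_
      have hpp : 0 < p / (p - 1) := by positivity
      by_cases hx : x ∈ S n
      · simp only [hv, indicator_of_mem hx, Φ]
        rw [ENNReal.mul_rpow_of_nonneg _ _ hpp.le, ← ENNReal.rpow_mul, ← ENNReal.rpow_mul,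
          show (p - 1) * (p / (p - 1)) = p by field_simp,
          show (1 - 1 / p) * (p / (p - 1)) = 1 by field_simp, ENNReal.rpow_one]
      · simp [hv, hx, hpp]
    have hIfin : ∫⁻ x in S n, Φ x ≠ ∞ := by
      refine ne_top_of_le_ne_top ?_ (setLIntegral_mono' (hSm n)
        (fun x hx => (mul_le_mul' (ENNReal.rpow_le_rpow (hgS x hx) hp0.le) hx.2.2 :
          Φ x ≤ (n : ℝ≥0∞) ^ p * n)))
      rw [setLIntegral_const]
      refine ENNReal.mul_ne_top (ENNReal.mul_ne_top (ENNReal.rpow_ne_top_of_nonneg hp0.le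
        (ENNReal.natCast_ne_top n)) (ENNReal.natCast_ne_top n)) ?_
      exact ne_top_of_le_ne_top (measure_closedBall_lt_top (x := (0 : Fin d → ℝ)) (r := n)).ne
        (measure_mono inter_subset_left)
    have key := h f₂ v hbs hvm.aemeasurable (by
      filter_upwards [hww] with x hx
      rw [hx]; exact hf₂v x) (by rw [hvint]; exact hIfin)
    have hpair : ‖∫ x, g x * conj (f₂ x)‖ₑ = ∫⁻ x in S n, Φ x := by
      set r : (Fin d → ℝ) → ℝ := fun x => (((S n).indicator Φ) x).toReal
      have e1 : ∫ x, g x * conj (f₂ x) = ∫ x, ((r x : ℝ) : ℂ) := by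
        refine integral_congr_ae ?_
        filter_upwards [hgg] with x hx
        rw [hx]
        by_cases hxS : x ∈ S n
        · simp only [hf₂, r, indicator_of_mem hxS, Φ, map_mul, Complex.conj_ofReal]
          rw [show g₀ x * (((‖g₀ x‖ ^ (p - 2) * (w₀ x).toReal : ℝ) : ℂ) * conj (g₀ x)) =
            ((‖g₀ x‖ ^ (p - 2) * (w₀ x).toReal : ℝ) : ℂ) * (g₀ x * conj (g₀ x)) by ring,
            Complex.mul_conj, Complex.normSq_eq_norm_sq, ← Complex.ofReal_mul]
          congr 1
          rw [ENNReal.toReal_mul, ← ENNReal.toReal_rpow, toReal_enorm]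
          rcases eq_or_lt_of_le (norm_nonneg (g₀ x)) with h0 | h0
          · rw [← h0, Real.zero_rpow hp0.ne']; simp
          · have : ‖g₀ x‖ ^ p = ‖g₀ x‖ ^ (p - 2) * ‖g₀ x‖ ^ 2 := by
              rw [← Real.rpow_natCast, ← Real.rpow_add h0]; congr 1; push_cast; ring
            rw [this]; ring
        · simp [hf₂, r, hxS]
      rw [e1, integral_complex_ofReal, integral_toReal (hΦm.indicator (hSm n)).aemeasurable
        (ae_lt_top (hΦm.indicator (hSm n)) (by rwa [lintegral_indicator (hSm n)])),
        lintegral_indicator (hSm n)]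
      rw [← ofReal_norm, Complex.norm_real, Real.norm_eq_abs, abs_of_nonneg ENNReal.toReal_nonneg,
        ENNReal.ofReal_toReal hIfin]
    rw [hpair, hvint] at key
    set I := ∫⁻ x in S n, Φ x
    by_cases hI0 : I = 0
    · rw [hI0, ENNReal.zero_rpow_of_pos (by positivity)]; exact zero_le
    have e : I = I ^ (1 / p) * I ^ (1 - 1 / p) := by
      rw [← ENNReal.rpow_add _ _ hI0 hIfin]; simp
    have hne : I ^ (1 - 1 / p) ≠ 0 := by
      simp [ENNReal.rpow_eq_zero_iff, hI0, hIfin]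
    have hne' : I ^ (1 - 1 / p) ≠ ∞ := ENNReal.rpow_ne_top_of_nonneg hp' hIfin
    refine (ENNReal.mul_le_mul_iff_left hne hne').mp ?_
    rwa [← e]
  have hmono : Monotone S := by
    intro n m hnm
    have hr : (n : ℝ) ≤ m := by exact_mod_cast hnm
    have hr' : (n : ℝ≥0∞) ≤ m := by exact_mod_cast hnm
    exact inter_subset_inter (Metric.closedBall_subset_closedBall hr)
      (inter_subset_inter (fun x hx => le_trans hx hr) fun x hx => le_trans hx hr')
  have hcover : ∀ᵐ x, x ∈ ⋃ n, S n := by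
    filter_upwards [hww, hwfin] with x hx hx'
    rw [hx] at hx'
    obtain ⟨n₁, h₁⟩ := exists_nat_ge ‖x‖
    obtain ⟨n₂, h₂⟩ := exists_nat_ge ‖g₀ x‖
    obtain ⟨n₃, h₃⟩ := ENNReal.exists_nat_gt hx'
    refine mem_iUnion.mpr ⟨max n₁ (max n₂ n₃), ?_, ?_, ?_⟩
    · rw [mem_closedBall_zero_iff]
      exact h₁.trans (by exact_mod_cast le_max_left _ _)
    · exact h₂.trans (by exact_mod_cast (le_max_left n₂ n₃).trans (le_max_right _ _))
    · exact h₃.le.trans (by exact_mod_cast (le_max_right n₂ n₃).trans (le_max_right _ _))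
  have htot : ∫⁻ x, absFun g x ^ p * w x = ⨆ n, ∫⁻ x in S n, Φ x := by
    rw [← setLIntegral_iUnion_of_directed _ hmono.directed_le,
      Measure.restrict_eq_self_of_ae_mem hcover]
    refine lintegral_congr_ae ?_
    filter_upwards [hgg, hww] with x hx hx'
    simp only [absFun, Φ, hx, hx']
  rw [wNorm, htot, one_div, ENNReal.rpow_inv_le_iff hp0]
  refine iSup_le fun n => ?_
  rw [← ENNReal.rpow_inv_le_iff hp0, ← one_div]
  exact hI n

/-- The dimensional constant in the reduction to dyadic sparse forms. -/
def reductionConst (d : ℕ) : ℝ≥0 := 2 ^ d * (6 ^ d * 6 ^ d * 2)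

/-- The sparse norm is an infimum, and the sparse collection depends on the constant chosen. A bound
uniform over all collections survives the limit of constants decreasing to C t. -/
lemma enorm_integral_le {T : ((Fin d → ℝ) → ℂ) → ((Fin d → ℝ) → ℂ)} {C : ℝ≥0}
    (hT : HasLinearSparseGrowth T C) {t : ℝ} (ht : 1 < t) {f₁ f₂ : (Fin d → ℝ) → ℂ}
    (hf₁ : IsBddCompSupp f₁) (hf₂ : IsBddCompSupp f₂) {B : ℝ≥0∞} (hBfin : B ≠ ∞)
    (hB : ∀ (α : Fin d → Bool) (F : Finset (Set (Fin d → ℝ)))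
      (E : Set (Fin d → ℝ) → Set (Fin d → ℝ)), GridSparse α F E →
      ∑ Q ∈ F, volume (E Q) *
        (lpAvg (1 + 1 / t) (absFun f₁) Q * lpAvg (1 + 1 / t) (absFun f₂) Q) ≤ B) :
    ‖∫ x, T f₁ x * conj (f₂ x)‖ₑ ≤ C * ENNReal.ofReal t * (reductionConst d * B) := by
  have hs : (1 : ℝ) ≤ 1 + 1 / t := by
    have : 0 < 1 / t := by positivity
    linarith
  set B' : ℝ≥0∞ := reductionConst d * B
  have hB'fin : B' ≠ ∞ := ENNReal.mul_ne_top ENNReal.coe_ne_top hBfin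
  have hlt : ∀ c : ℝ≥0∞, C * ENNReal.ofReal t < c →
      ‖∫ x, T f₁ x * conj (f₂ x)‖ₑ ≤ c * B' := by
    intro c hc
    have := (hT.2 t ht).trans_lt hc
    simp only [sparseNorm, iInf_lt_iff] at this
    obtain ⟨A, hA, hAc⟩ := this
    obtain ⟨S, hS, hbd⟩ := hA f₁ f₂ hf₁ hf₂
    calc _ ≤ A * sparseForm S (1 + 1 / t) (1 + 1 / t) f₁ f₂ := hbd
      _ ≤ c * B' := by
          refine mul_le_mul' hAc.le ((sparseForm_le hS hs hB).trans_eq ?_)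
          simp [B', reductionConst]
  -- If the form vanishes, the constant ∞ may be used, since ∞ · 0 = 0.
  by_cases hB0 : B' = 0
  · have hCt : C * ENNReal.ofReal t < ∞ := by finiteness
    have := hlt ∞ hCt
    rw [hB0] at this ⊢
    simpa using this
  rw [← ENNReal.div_le_iff_le_mul (Or.inl hB0) (Or.inl hB'fin)]
  refine le_of_forall_gt_imp_ge_of_dense fun c hc => ?_
  rw [ENNReal.div_le_iff_le_mul (Or.inl hB0) (Or.inl hB'fin)]
  exact hlt c hc

/-- Weighted bounds for `T f` from bounds for dyadic sparse forms. -/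
theorem wNorm_le_of_sparse {T : ((Fin d → ℝ) → ℂ) → ((Fin d → ℝ) → ℂ)} {C : ℝ≥0}
    (hT : HasLinearSparseGrowth T C) {t : ℝ} (ht : 1 < t) {p : ℝ} (hp : 1 < p)
    {f : (Fin d → ℝ) → ℂ} (hf : IsBddCompSupp f) {w : (Fin d → ℝ) → ℝ≥0∞}
    (hw : AEMeasurable w) (hwfin : ∀ᵐ x, w x ≠ ∞) {N : ℝ≥0∞} (hN : N ≠ ∞)
    (h : ∀ (α : Fin d → Bool) (F : Finset (Set (Fin d → ℝ)))
      (E : Set (Fin d → ℝ) → Set (Fin d → ℝ)), GridSparse α F E →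
      ∀ v : (Fin d → ℝ) → ℝ≥0∞, AEMeasurable v →
      ∑ Q ∈ F, volume (E Q) * (lpAvg (1 + 1 / t) (absFun f) Q *
        lpAvg (1 + 1 / t) (fun x => v x * w x ^ (1 / p)) Q) ≤
        N * (∫⁻ x, v x ^ (p / (p - 1))) ^ (1 - 1 / p)) :
    wNorm p w (absFun (T f)) ≤ C * ENNReal.ofReal t * (reductionConst d * N) := by
  have hp' : 0 ≤ 1 - 1 / p := by
    rw [sub_nonneg, div_le_one (by linarith)]; exact hp.le
  refine wNorm_le_of_dual hp (hT.1.locallyIntegrable f hf).aestronglyMeasurable hw hwfin ?_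
  intro f₂ v hf₂ hv hfv hvfin
  have := enorm_integral_le hT ht hf hf₂
    (ENNReal.mul_ne_top hN (ENNReal.rpow_ne_top_of_nonneg hp' hvfin)) (fun α F E hFE => by
      simp only [lpAvg_congr_ae hfv]
      exact h α F E hFE v hv)
  refine this.trans_eq ?_
  ring

/-! ### Degenerate weights: what a finite A_p constant implies qualitatively. -/

lemma wNorm_eq_zero {p : ℝ} (hp : 1 < p) {w : (Fin d → ℝ) → ℝ≥0∞} (hw : w =ᵐ[volume] 0)
    (g : (Fin d → ℝ) → ℝ≥0∞) : wNorm p w g = 0 := by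
  have : ∫⁻ x, g x ^ p * w x = 0 := by
    rw [← lintegral_zero (μ := (volume : Measure (Fin d → ℝ)))]
    refine lintegral_congr_ae ?_
    filter_upwards [hw] with x hx
    simp [hx]
  rw [wNorm, this, ENNReal.zero_rpow_of_pos (by positivity)]

/-- The cubes `[-n - 1, n + 1)^d`. -/
def centeredCube (d n : ℕ) : Set (Fin d → ℝ) :=
  Set.univ.pi fun _ => Set.Ico (-(n + 1) : ℝ) (-(n + 1) + 2 * (n + 1))

lemma isCube_centeredCube (n : ℕ) : IsCube (centeredCube d n) :=
  ⟨_, 2 * (n + 1), by positivity, rfl⟩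

lemma exists_subset_centeredCube {Q : Set (Fin d → ℝ)} (hQ : IsCube Q) :
    ∃ n₀, ∀ n, n₀ ≤ n → Q ⊆ centeredCube d n := by
  obtain ⟨a, l, hl, rfl⟩ := hQ
  obtain ⟨n₀, h₀⟩ := exists_nat_ge (∑ i, |a i| + l)
  refine ⟨n₀, fun n hn x hx i _ => ?_⟩
  have hn' : (n₀ : ℝ) ≤ n := by exact_mod_cast hn
  have hi : |a i| ≤ ∑ i, |a i| :=
    Finset.single_le_sum (f := fun i => |a i|) (fun _ _ => abs_nonneg _) (Finset.mem_univ i)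
  have h1 := hx i (mem_univ i)
  have h2 := abs_le.mp (le_refl |a i|)
  constructor
  · linarith [h1.1]
  · linarith [h1.2]

lemma ae_eq_zero_of_centeredCube {w : (Fin d → ℝ) → ℝ≥0∞} (hw : AEMeasurable w) {n₀ : ℕ}
    (h : ∀ n, n₀ ≤ n → ∫⁻ x in centeredCube d n, w x = 0) : w =ᵐ[volume] 0 := by
  have hcov : (⋃ n : ℕ, centeredCube d (n₀ + n)) = univ := by
    rw [eq_univ_iff_forall]
    intro x
    have hc : IsCube (Set.univ.pi fun i => Set.Ico (x i) (x i + 1)) := ⟨x, 1, one_pos, rfl⟩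
    obtain ⟨n₁, h₁⟩ := exists_subset_centeredCube hc
    exact mem_iUnion.mpr ⟨n₁, h₁ _ (by omega) (by simp)⟩
  have : w =ᵐ[volume.restrict (⋃ n : ℕ, centeredCube d (n₀ + n))] 0 := by
    rw [Filter.EventuallyEq, ae_restrict_iUnion_iff]
    intro n
    exact (lintegral_eq_zero_iff' hw.restrict).mp (h _ (by omega))
  rwa [hcov, Measure.restrict_univ] at this

lemma IsWeight.ae_ne_top {w : (Fin d → ℝ) → ℝ≥0∞} (hw : IsWeight w) : ∀ᵐ x, w x ≠ ∞ := by
  have hcov : (⋃ n : ℕ, centeredCube d n) = univ := by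
    rw [eq_univ_iff_forall]
    intro x
    have hc : IsCube (Set.univ.pi fun i => Set.Ico (x i) (x i + 1)) := ⟨x, 1, one_pos, rfl⟩
    obtain ⟨n₁, h₁⟩ := exists_subset_centeredCube hc
    exact mem_iUnion.mpr ⟨n₁, h₁ _ le_rfl (by simp)⟩
  have : ∀ᵐ x ∂volume.restrict (⋃ n : ℕ, centeredCube d n), w x ≠ ∞ := by
    rw [ae_restrict_iUnion_iff]
    intro n
    exact (ae_lt_top' hw.1.restrict (hw.lintegral_cube_ne_top (isCube_centeredCube n))).mono
      fun x hx => hx.ne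
  rwa [hcov, Measure.restrict_univ] at this

lemma dualWeight_exponent {p : ℝ} (hp : 1 < p) : 1 - p / (p - 1) = -(1 / (p - 1)) := by
  have : 0 < p - 1 := by linarith
  field_simp; ring

/-- A nonzero `A_p` weight and its dual weight form a Muckenhoupt pair. -/
theorem muckenhouptPair {p : ℝ} (hp : 1 < p) {w : (Fin d → ℝ) → ℝ≥0∞} (hw : IsWeight w)
    (hA : apConst p w < ∞) (h0 : ¬ w =ᵐ[volume] 0) :
    MuckenhouptPair p w (dualWeight p w) (apConst p w) := by
  have hp1 : 0 < p - 1 := by linarith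
  have hle : ∀ Q, IsCube Q → (⨍⁻ x in Q, w x ∂volume) *
      (⨍⁻ x in Q, dualWeight p w x ∂volume) ^ (p - 1) ≤ apConst p w := by
    intro Q hQ
    rw [apConst, if_neg hp.ne']
    exact le_iSup₂ (f := fun (Q : Set (Fin d → ℝ)) (_ : IsCube Q) => (⨍⁻ x in Q, w x ∂volume) *
      (⨍⁻ x in Q, dualWeight p w x ∂volume) ^ (p - 1)) Q hQ
  have hσm : AEMeasurable (dualWeight p w) := hw.1.pow_const _
  have hσfin : ∀ Q, IsCube Q → ∫⁻ x in Q, dualWeight p w x ≠ ∞ := by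
    intro Q hQ
    obtain ⟨n₀, hn₀⟩ := exists_subset_centeredCube hQ
    -- On a larger cube where w has positive mass, an infinite integral of σ would make the A_p
    -- constant infinite.
    obtain ⟨n, hn, hwn⟩ : ∃ n, n₀ ≤ n ∧ ∫⁻ x in centeredCube d n, w x ≠ 0 := by
      by_contra! hcon
      exact h0 (ae_eq_zero_of_centeredCube hw.1 hcon)
    have hc := isCube_centeredCube (d := d) n
    refine ne_top_of_le_ne_top ?_ (lintegral_mono_set (hn₀ n hn))
    intro htop
    have h1 := hle _ hc
    rw [setLAverage_eq volume (dualWeight p w), htop, ENNReal.top_div_of_ne_top hc.volume_ne_top,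
      ENNReal.top_rpow_of_pos hp1, ENNReal.mul_top] at h1
    · exact hA.ne (top_le_iff.mp h1)
    · rw [setLAverage_eq]
      exact (ENNReal.div_pos hwn hc.volume_ne_top).ne'
  have hσae : ∀ᵐ x, dualWeight p w x ≠ ∞ := by
    refine IsWeight.ae_ne_top ⟨hσm, fun K hK => ?_⟩
    obtain ⟨r, hr⟩ := hK.isBounded.subset_closedBall 0
    obtain ⟨n, hn⟩ := exists_nat_ge r
    refine (lintegral_mono_set ?_).trans_lt (hσfin _ (isCube_centeredCube (d := d) n)).lt_top
    intro x hx i _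
    have h1 := hr hx
    rw [mem_closedBall_zero_iff] at h1
    have h2 := abs_le.mp ((norm_le_pi_norm x i).trans (h1.trans hn))
    constructor <;> linarith [h2.1, h2.2]
  refine ⟨hw.1, hσm, fun Q hQ => hw.lintegral_cube_ne_top hQ, hσfin, ?_, hle⟩
  filter_upwards [hw.ae_ne_top, hσae] with x hx1 hx2
  refine ⟨?_, hx1, by rw [dualWeight, dualWeight_exponent hp]⟩
  rintro h
  apply hx2
  rw [dualWeight, dualWeight_exponent hp, h, ENNReal.zero_rpow_of_neg]
  simpa using hp1

/-- The average of 1/w is at most its essential supremum. This brings q = 1 under the qualitative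
theory of exponents above one. -/
lemma apConst_two_le_apConst_one (w : (Fin d → ℝ) → ℝ≥0∞) : apConst 2 w ≤ apConst 1 w := by
  rw [apConst, if_neg (by norm_num), apConst, if_pos rfl]
  refine iSup₂_mono fun Q hQ => ?_
  gcongr
  have hQ' : IsFiniteMeasure (volume.restrict Q) := ⟨by simpa using hQ.volume_ne_top.lt_top⟩
  have : NeZero (volume.restrict Q) := ⟨by simpa using hQ.volume_ne_zero⟩
  norm_num
  calc ⨍⁻ x in Q, dualWeight 2 w x ∂volume
      ≤ ⨍⁻ _ in Q, essSup (fun x => (w x)⁻¹) (volume.restrict Q) ∂volume := by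
        refine laverage_mono_ae ?_
        filter_upwards [ENNReal.ae_le_essSup fun x => (w x)⁻¹] with x hx
        rw [dualWeight, show (1 : ℝ) - 2 / (2 - 1) = -1 by norm_num, ENNReal.rpow_neg_one]
        exact hx
    _ = _ := laverage_const _ _

/-! ### The Fefferman–Stein inequality. -/

lemma one_sub_one_div_nonneg {p : ℝ} (hp : 1 < p) : 0 ≤ 1 - 1 / p := by
  rw [sub_nonneg, div_le_one (by linarith)]; exact hp.le

lemma one_div_one_add_one_div {t : ℝ} (ht : 0 < t) : 1 / (1 + 1 / t) = 1 - 1 / (t + 1) := by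
  field_simp; ring

/-- The bilinear diagonal bound. -/
lemma Carried.sum_mul_lpAvg_le {F : Finset (Set (Fin d → ℝ))}
    {E : Set (Fin d → ℝ) → Set (Fin d → ℝ)} (h : Carried F E) {p k₁ k₂ η₁ η₂ : ℝ} (hp : 1 < p)
    (hk₁ : 1 ≤ k₁) (hk₂ : 1 ≤ k₂) (hη₁ : 0 < η₁) (hη₂ : 0 < η₂) (e₁ : 1 / k₁ = 1 / p + η₁)
    (e₂ : 1 / k₂ = 1 - 1 / p + η₂) {u v : (Fin d → ℝ) → ℝ≥0∞} (hu : AEMeasurable u)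
    (hv : AEMeasurable v) :
    ∑ Q ∈ F, volume (E Q) * (lpAvg k₁ u Q * lpAvg k₂ v Q) ≤
      ENNReal.ofReal (3 * (1 / η₁) ^ (1 / p)) * (∫⁻ x, u x ^ p) ^ (1 / p) *
        (ENNReal.ofReal (3 * (1 / η₂) ^ (1 - 1 / p)) *
          (∫⁻ x, v x ^ (p / (p - 1))) ^ (1 - 1 / p)) := by
  have hp1 : 0 < p - 1 := by linarith
  have hpp : 1 / (p / (p - 1)) = 1 - 1 / p := by field_simp
  have h1 := h.sum_lpAvg_norm_le hk₁ (by linarith) hη₁ e₁ hu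
  have h2 := h.sum_lpAvg_norm_le (q := p / (p - 1)) hk₂ (by positivity) hη₂ (by rw [hpp, e₂]) hv
  rw [hpp] at h2
  exact (sum_mul_mul_le F hp _ _ _).trans (mul_le_mul' h1 h2)

/-- Hölder separates the dual function from the weight. The latter appears in L^r average, to be met
by M_r w or by reverse Hölder. -/
lemma lpAvg_mul_rpow_one_div_le {s k r p : ℝ} (hs : 0 < s) (hsk : s < k) (hp : 0 < p)
    (h : 1 / s = 1 / k + 1 / (p * r)) {v w : (Fin d → ℝ) → ℝ≥0∞} (hv : AEMeasurable v)
    (hw : AEMeasurable w) (Q : Set (Fin d → ℝ)) :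
    lpAvg s (fun x => v x * w x ^ (1 / p)) Q ≤ lpAvg k v Q * lpAvg r w Q ^ (1 / p) := by
  refine (lpAvg_mul_le hs hsk h hv (hw.pow_const _) Q).trans_eq ?_
  rw [lpAvg_rpow (by positivity)]
  congr 3
  field_simp

lemma wNorm_eq_of_mul {p : ℝ} (hp : 0 < p) (w g : (Fin d → ℝ) → ℝ≥0∞) :
    (∫⁻ x, (g x * w x ^ (1 / p)) ^ p) ^ (1 / p) = wNorm p w g := by
  simp_rw [ENNReal.mul_rpow_of_nonneg _ _ hp.le, ← ENNReal.rpow_mul, one_div_mul_cancel hp.ne',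
    ENNReal.rpow_one]
  rfl

lemma IsBddCompSupp.aemeasurable_absFun {f : (Fin d → ℝ) → ℂ} (hf : IsBddCompSupp f) :
    AEMeasurable (absFun f) :=
  hf.1.1.enorm

/-- The Fefferman–Stein inequality when the right-hand side is finite. -/
lemma feffermanStein_of_ne_top {p r : ℝ} (hr : 1 < r) (hrp : r < p)
    {T : ((Fin d → ℝ) → ℂ) → ((Fin d → ℝ) → ℂ)} {C : ℝ≥0} (hT : HasLinearSparseGrowth T C)
    {w : (Fin d → ℝ) → ℝ≥0∞} (hw : IsWeight w) {f : (Fin d → ℝ) → ℂ} (hf : IsBddCompSupp f)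
    (hfin : wNorm p (maximalFn r w) (absFun f) ≠ ∞) :
    wNorm p w (absFun (T f)) ≤ (72 * reductionConst d : ℝ≥0) * C *
      ENNReal.ofReal (p ^ 2 * (p / (p - 1)) ^ (1 / p) *
        (r / (r - 1)) ^ (1 + (1 - 1 / p))) * wNorm p (maximalFn r w) (absFun f) := by
  have hp : 1 < p := hr.trans hrp
  have hp0 : 0 < p := by linarith
  have hp1 : 0 < p - 1 := by linarith
  have hr0 : 0 < r := by linarith
  have hr1 : 0 < r - 1 := by linarith
  have hp' := one_sub_one_div_nonneg hp
  set r' := r / (r - 1) with hr'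
  set p' := p / (p - 1) with hpp'
  have hr'1 : 1 < r' := by rw [hr', lt_div_iff₀ hr1]; linarith
  have hp'1 : 1 < p' := by rw [hpp', lt_div_iff₀ hp1]; linarith
  -- Then 1/s = 1 - 1/(2 p r'). Hölder against w^(1/p) offers a gap 1/(p r') above 1/p'; half is
  -- spent on s and the other half is `η₂`.
  set t := 2 * p * r' - 1 with ht
  have hpr : 1 < p * r' := by nlinarith
  have ht1 : 1 < t := by rw [ht]; linarith
  have ht0 : 0 < t := by linarith
  have hs : 1 / (1 + 1 / t) = 1 - 1 / (2 * p * r') := by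
    rw [one_div_one_add_one_div ht0, ht]; congr 2; ring
  set s := 1 + 1 / t with hs_def
  have hs1 : 1 < s := by
    have : 0 < 1 / t := by positivity
    linarith
  set η₂ := 1 / (2 * p * r') with hη₂
  have hη₂0 : 0 < η₂ := by positivity
  set k := 1 / (1 - 1 / p + η₂) with hk
  have hk0 : 0 < 1 - 1 / p + η₂ := by linarith
  have e₂ : 1 / k = 1 - 1 / p + η₂ := by rw [hk, one_div_one_div]
  have hη₂p : η₂ ≤ 1 / p / 2 := by
    rw [hη₂, div_div]
    apply one_div_le_one_div_of_le (by positivity)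
    nlinarith
  have hk1 : 1 ≤ k := by
    rw [hk, one_le_div hk0]
    have : 0 < 1 / p := by positivity
    linarith
  have hskr : 1 / s = 1 / k + 1 / (p * r) := by
    rw [hs, e₂, hη₂, hr']
    field_simp
    ring
  have hsk : s < k := by
    have : 0 < 1 / (p * r) := by positivity
    exact lt_of_one_div_lt_one_div (by linarith) (by linarith)
  set η₁ := 1 / s - 1 / p with hη₁
  -- The gap on the side of f stays at least half of 1/p', because r < p gives 1/(p r') ≤ 1/p'.
  have hη₁' : 1 / (2 * p') ≤ η₁ := by
    have h1 : 1 / (2 * p') = (1 - 1 / p) / 2 := by rw [hpp']; field_simp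
    have h2 : η₂ = (1 / p) * (1 - 1 / r) / 2 := by rw [hη₂, hr']; field_simp
    have h3 : (1 / p) * (1 - 1 / r) ≤ 1 * (1 - 1 / p) := by
      have : 1 / p ≤ 1 / r := one_div_le_one_div_of_le hr0 hrp.le
      have h4 : 1 / p ≤ 1 := by linarith
      have h5 : (1:ℝ) / p > 0 := by positivity
      have h6 : (1:ℝ) / r ≤ 1 := by rw [div_le_one hr0]; exact hr.le
      have h7 : 1 - 1 / r ≤ 1 - 1 / p := by linarith
      exact mul_le_mul h4 h7 (by linarith) (by norm_num)
    rw [h1, hη₁, hs]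
    linarith
  have hη₁0 : 0 < η₁ := lt_of_lt_of_le (by positivity) hη₁'
  have e₁ : 1 / s = 1 / p + η₁ := by rw [hη₁]; ring
  set c := 3 * (1 / η₁) ^ (1 / p) * (3 * (1 / η₂) ^ (1 - 1 / p)) with hc
  have hc0 : 0 ≤ c := by positivity
  have main := wNorm_le_of_sparse hT ht1 hp hf hw.1 hw.ae_ne_top
    (N := ENNReal.ofReal c * wNorm p (maximalFn r w) (absFun f))
    (ENNReal.mul_ne_top ENNReal.ofReal_ne_top hfin) (fun α F E hFE v hv => by
      set W := maxOn F (fun Q => lpAvg r w Q)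
      have hWm : Measurable W := measurable_maxOn (fun Q hQ => (hFE.isCube Q hQ).measurableSet) _
      -- The constant ⟨w⟩_{r,Q}^(1/p) is pulled inside the average of f and dominated pointwise
      -- there by `W`, itself below M_r w.
      set u : (Fin d → ℝ) → ℝ≥0∞ := fun x => absFun f x * W x ^ (1 / p)
      have hum : AEMeasurable u := hf.aemeasurable_absFun.mul (hWm.pow_const _).aemeasurable
      have hterm : ∀ Q ∈ F, lpAvg s (absFun f) Q * lpAvg s (fun x => v x * w x ^ (1 / p)) Q ≤
          lpAvg s u Q * lpAvg k v Q := by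
        intro Q hQ
        calc lpAvg s (absFun f) Q * lpAvg s (fun x => v x * w x ^ (1 / p)) Q
            ≤ lpAvg s (absFun f) Q * (lpAvg k v Q * lpAvg r w Q ^ (1 / p)) := by
              gcongr
              exact lpAvg_mul_rpow_one_div_le (by linarith) hsk hp0 hskr hv hw.1 Q
          _ = (lpAvg r w Q ^ (1 / p) * lpAvg s (absFun f) Q) * lpAvg k v Q := by ring
          _ = lpAvg s (fun x => lpAvg r w Q ^ (1 / p) * absFun f x) Q * lpAvg k v Q := by
              rw [lpAvg_const_mul (by linarith) _ hf.aemeasurable_absFun]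
          _ ≤ _ := by
              gcongr
              refine lpAvg_mono_on (by linarith) (hFE.isCube Q hQ).measurableSet fun x hx => ?_
              rw [mul_comm]
              simp only [u]
              gcongr
              exact le_maxOn (fun Q => lpAvg r w Q) hQ hx
      have hu : (∫⁻ x, u x ^ p) ^ (1 / p) ≤ wNorm p (maximalFn r w) (absFun f) := by
        rw [wNorm_eq_of_mul hp0]
        refine ENNReal.rpow_le_rpow (lintegral_mono fun x => ?_) (by positivity)
        gcongr
        exact maxOn_le fun Q hQ hx => le_maximalFn (hFE.isCube Q hQ) hx
      calc _ ≤ ∑ Q ∈ F, volume (E Q) * (lpAvg s u Q * lpAvg k v Q) :=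
            Finset.sum_le_sum fun Q hQ => mul_le_mul_right (hterm Q hQ) _
        _ ≤ _ := hFE.toCarried.sum_mul_lpAvg_le hp hs1.le hk1 hη₁0 hη₂0 e₁ e₂ hum hv
        _ ≤ ENNReal.ofReal (3 * (1 / η₁) ^ (1 / p)) * wNorm p (maximalFn r w) (absFun f) *
            (ENNReal.ofReal (3 * (1 / η₂) ^ (1 - 1 / p)) *
              (∫⁻ x, v x ^ (p / (p - 1))) ^ (1 - 1 / p)) := by gcongr
        _ = _ := by
            rw [hc, ENNReal.ofReal_mul (p := 3 * (1 / η₁) ^ (1 / p)) (by positivity)]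
            ring)
  refine main.trans ?_
  have hconst : t * c ≤ 72 * (p ^ 2 * p' ^ (1 / p) * r' ^ (1 + (1 - 1 / p))) := by
    have hle1 : 1 / p ≤ 1 := by linarith
    have h2 : ∀ y : ℝ, 0 ≤ y → y ≤ 1 → (2 : ℝ) ^ y ≤ 2 := fun y _ hy => by
      calc (2 : ℝ) ^ y ≤ 2 ^ (1 : ℝ) := Real.rpow_le_rpow_of_exponent_le (by norm_num) hy
        _ = 2 := Real.rpow_one 2
    have hb1 : (1 / η₁) ^ (1 / p) ≤ 2 * p' ^ (1 / p) := by
      have : 1 / η₁ ≤ 2 * p' := by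
        rw [div_le_comm₀ hη₁0 (by positivity)]; exact hη₁'
      calc (1 / η₁) ^ (1 / p) ≤ (2 * p') ^ (1 / p) :=
            Real.rpow_le_rpow (by positivity) this (by positivity)
        _ = 2 ^ (1 / p) * p' ^ (1 / p) := Real.mul_rpow (by norm_num) (by positivity)
        _ ≤ _ := by
            gcongr
            exact h2 _ (by positivity) hle1
    have hb2 : (1 / η₂) ^ (1 - 1 / p) ≤ 2 * p * r' ^ (1 - 1 / p) := by
      have h3 : 0 < 1 / p := by positivity
      rw [hη₂, one_div_one_div, Real.mul_rpow (by positivity) (by positivity)]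
      gcongr
      calc (2 * p) ^ (1 - 1 / p) ≤ (2 * p) ^ (1 : ℝ) :=
            Real.rpow_le_rpow_of_exponent_le (by linarith) (by linarith)
        _ = 2 * p := Real.rpow_one _
    have hr'e : r' ^ (1 + (1 - 1 / p)) = r' * r' ^ (1 - 1 / p) := by
      rw [Real.rpow_add (by linarith), Real.rpow_one]
    have htle : t ≤ 2 * p * r' := by rw [ht]; linarith
    calc t * c ≤ (2 * p * r') * (3 * (2 * p' ^ (1 / p)) * (3 * (2 * p * r' ^ (1 - 1 / p)))) := by
          rw [hc]; gcongr
      _ = 72 * (p ^ 2 * p' ^ (1 / p) * r' ^ (1 + (1 - 1 / p))) := by rw [hr'e]; ring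
  calc _ = (reductionConst d * C) * ENNReal.ofReal (t * c) *
        wNorm p (maximalFn r w) (absFun f) := by
        rw [ENNReal.ofReal_mul ht0.le]; ring
    _ ≤ (reductionConst d * C) *
        ENNReal.ofReal (72 * (p ^ 2 * p' ^ (1 / p) * r' ^ (1 + (1 - 1 / p)))) *
        wNorm p (maximalFn r w) (absFun f) := by gcongr
    _ = _ := by
        rw [ENNReal.ofReal_mul (by norm_num : (0 : ℝ) ≤ 72), ENNReal.ofReal_ofNat]
        push_cast
        ring

/-! ### Removing the finiteness of the right-hand side. -/

lemma IsBddCompSupp.lintegral_rpow_ne_top {f : (Fin d → ℝ) → ℂ} (hf : IsBddCompSupp f) {p : ℝ}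
    (hp : 0 < p) : ∫⁻ x, absFun f x ^ p ≠ ∞ := by
  have hK : IsCompact (tsupport f) := hf.2
  have hbound : ∀ᵐ x, absFun f x ^ p ≤
      (tsupport f).indicator (fun _ => eLpNorm f ∞ volume ^ p) x := by
    filter_upwards [enorm_ae_le_eLpNormEssSup f volume] with x hx
    by_cases h : x ∈ tsupport f
    · rw [indicator_of_mem h, eLpNorm_exponent_top]
      exact ENNReal.rpow_le_rpow hx hp.le
    · simp [absFun, image_eq_zero_of_notMem_tsupport h, hp]
  refine ne_top_of_le_ne_top ?_ (lintegral_mono_ae hbound)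
  rw [lintegral_indicator (isClosed_tsupport f).measurableSet, setLIntegral_const]
  exact ENNReal.mul_ne_top (ENNReal.rpow_ne_top_of_nonneg hp.le hf.1.2.ne)
    hK.measure_lt_top.ne

/-- If the sparse norms of `T` vanish then `T f = 0`. -/
lemma wNorm_eq_zero_of_growth_zero {T : ((Fin d → ℝ) → ℂ) → ((Fin d → ℝ) → ℂ)}
    (hT : HasLinearSparseGrowth T 0) {f : (Fin d → ℝ) → ℂ} (hf : IsBddCompSupp f) {p : ℝ}
    (hp : 1 < p) (w : (Fin d → ℝ) → ℝ≥0∞) : wNorm p w (absFun (T f)) = 0 := by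
  have hone : IsWeight (fun _ : Fin d → ℝ => (1 : ℝ≥0∞)) :=
    ⟨aemeasurable_const, fun K hK => by simpa using hK.measure_lt_top⟩
  have hmax : ∀ x, maximalFn (3 / 2) (fun _ : Fin d → ℝ => (1 : ℝ≥0∞)) x ≤ 1 := fun x =>
    iSup_le fun Q => iSup_le fun hQ => iSup_le fun _ => (lpAvg_const (by norm_num) hQ 1).le
  have hfin : wNorm 2 (maximalFn (3 / 2) (fun _ : Fin d → ℝ => (1 : ℝ≥0∞))) (absFun f) ≠ ∞ := by
    refine ENNReal.rpow_ne_top_of_nonneg (by norm_num)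
      (ne_top_of_le_ne_top (hf.lintegral_rpow_ne_top two_pos) (lintegral_mono fun x => ?_))
    exact (mul_le_mul_right (hmax x) _).trans_eq (mul_one _)
  -- With w = 1 the right-hand side is finite, hence zero when C = 0, so T f vanishes almost
  -- everywhere and its norm is zero for every weight.
  have h := feffermanStein_of_ne_top (by norm_num) (by norm_num : (3 / 2 : ℝ) < 2) hT hone hf hfin
  simp only [ENNReal.coe_zero, mul_zero, zero_mul, nonpos_iff_eq_zero] at h
  have h2 : ∫⁻ x, absFun (T f) x ^ (2 : ℝ) = 0 := by
    rw [wNorm, ENNReal.rpow_eq_zero_iff] at h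
    rcases h with h | h
    · simpa using h.1
    · exact absurd h.2 (by norm_num)
  have hm : AEMeasurable (absFun (T f)) :=
    (hT.1.locallyIntegrable f hf).aestronglyMeasurable.enorm
  have h3 : absFun (T f) =ᵐ[volume] 0 :=
    ENNReal.ae_eq_zero_of_lintegral_rpow_eq_zero (by norm_num) hm h2
  have : ∫⁻ x, absFun (T f) x ^ p * w x = 0 := by
    rw [← lintegral_zero (μ := (volume : Measure (Fin d → ℝ)))]
    refine lintegral_congr_ae ?_
    filter_upwards [h3] with x hx
    rw [hx]
    simp [show 0 < p by linarith]
  rw [wNorm, this, ENNReal.zero_rpow_of_pos (by positivity)]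

/-- Reduction to finite right-hand sides. -/
lemma wNorm_le_of_finite {T : ((Fin d → ℝ) → ℂ) → ((Fin d → ℝ) → ℂ)} {C : ℝ≥0}
    (hT : HasLinearSparseGrowth T C) {f : (Fin d → ℝ) → ℂ} (hf : IsBddCompSupp f) {p : ℝ}
    (hp : 1 < p) {w : (Fin d → ℝ) → ℝ≥0∞} {K : ℝ≥0} {M N : ℝ≥0∞} (hK : K ≠ 0) (hM : M ≠ 0)
    (h : N ≠ ∞ → wNorm p w (absFun (T f)) ≤ K * C * M * N) :
    wNorm p w (absFun (T f)) ≤ K * C * M * N := by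
  -- For C = 0 and N = ∞ the right-hand side is 0 by the convention 0 · ∞ = 0, so this case is not
  -- vacuous.
  by_cases hC : C = 0
  · subst hC
    rw [wNorm_eq_zero_of_growth_zero hT hf hp]
    exact zero_le
  by_cases hN : N = ∞
  · rw [hN, ENNReal.mul_top]
    · exact le_top
    · simp [hK, hC, hM]
  · exact h hN

theorem feffermanStein {p r : ℝ} (hr : 1 < r) (hrp : r < p)
    {T : ((Fin d → ℝ) → ℂ) → ((Fin d → ℝ) → ℂ)} {C : ℝ≥0} (hT : HasLinearSparseGrowth T C)
    {w : (Fin d → ℝ) → ℝ≥0∞} (hw : IsWeight w) {f : (Fin d → ℝ) → ℂ} (hf : IsBddCompSupp f) :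
    wNorm p w (absFun (T f)) ≤ (72 * reductionConst d : ℝ≥0) * C *
      ENNReal.ofReal (p ^ 2 * (p / (p - 1)) ^ (1 / p) *
        (r / (r - 1)) ^ (1 + (1 - 1 / p))) * wNorm p (maximalFn r w) (absFun f) := by
  refine wNorm_le_of_finite hT hf (hr.trans hrp) (by simp [reductionConst]) ?_
    (feffermanStein_of_ne_top hr hrp hT hw hf)
  have h1 : 0 < p - 1 := by linarith
  have h2 : 0 < r - 1 := by linarith
  have h3 : 0 < p := by linarith
  have h4 : 0 < r := by linarith
  have : 0 < p ^ 2 * (p / (p - 1)) ^ (1 / p) * (r / (r - 1)) ^ (1 + (1 - 1 / p)) := by positivity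
  simpa using this

/-! ### The A_∞ bump, Carleson embedding and the Coifman–Fefferman inequality. -/

lemma one_le_aInftyConst_of_cube {w : (Fin d → ℝ) → ℝ≥0∞} {Q : Set (Fin d → ℝ)} (hQ : IsCube Q)
    (h0 : ∫⁻ x in Q, w x ≠ 0) (hfin : ∫⁻ x in Q, w x ≠ ∞) : 1 ≤ aInftyConst w := by
  refine le_trans ?_ (le_iSup₂ (f := fun (Q : Set (Fin d → ℝ)) (_ : IsCube Q) =>
      (∫⁻ x in Q, maximalFn 1 (Q.indicator w) x) / ∫⁻ x in Q, w x) _ hQ)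
  rw [ENNReal.le_div_iff_mul_le (Or.inl h0) (Or.inl hfin), one_mul]
  calc ∫⁻ x in Q, w x = ∫⁻ _ in Q, ⨍⁻ y in Q, w y ∂volume := by
        rw [setLIntegral_const, mul_comm, measure_mul_setLAverage _ hQ.volume_ne_top]
    _ ≤ _ := setLIntegral_mono' hQ.measurableSet fun x hx =>
        setLAverage_le_maximalFn_indicator hQ subset_rfl hx

lemma one_le_aInftyConst {w : (Fin d → ℝ) → ℝ≥0∞} (hw : IsWeight w) (h0 : ¬ w =ᵐ[volume] 0) :
    1 ≤ aInftyConst w := by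
  obtain ⟨n, hn⟩ : ∃ n, ∫⁻ x in centeredCube d n, w x ≠ 0 := by
    by_contra! h
    exact h0 (ae_eq_zero_of_centeredCube hw.1 (n₀ := 0) fun n _ => h n)
  have hQ := isCube_centeredCube (d := d) n
  exact one_le_aInftyConst_of_cube hQ hn (hw.lintegral_cube_ne_top hQ)

/-- The improved integrability of an `A_∞` weight, as used against the dual function. -/
lemma exists_lpAvg_mul_rpow_le (hd : 1 ≤ d) {w : (Fin d → ℝ) → ℝ≥0∞} (hw : AEMeasurable w) {a : ℝ}
    (ha : 1 ≤ a) (hA : aInftyConst w = ENNReal.ofReal a) {p t : ℝ} (hp : 1 < p)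
    (ht : 2 ^ (d + 3) * p * a ≤ t) :
    ∃ k η : ℝ, 1 ≤ k ∧ 0 < η ∧ 1 / k = 1 - 1 / p + η ∧
      ENNReal.ofReal (3 * (1 / η) ^ (1 - 1 / p)) ≤
        ENNReal.ofReal (3 * (2 ^ (d + 3) * p)) * aInftyConst w ^ (1 - 1 / p) ∧
      ∀ α, ∀ Q ∈ grid α, ∫⁻ x in Q, w x ≠ ∞ → ∀ v : (Fin d → ℝ) → ℝ≥0∞, AEMeasurable v →
        lpAvg (1 + 1 / t) (fun x => v x * w x ^ (1 / p)) Q ≤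
          2 * (lpAvg k v Q * lpAvg 1 w Q ^ (1 / p)) := by
  have hp0 : 0 < p := by linarith
  have hp' := one_sub_one_div_nonneg hp
  have h2d : (1 : ℝ) ≤ 2 ^ d := one_le_pow₀ (by norm_num)
  set δ : ℝ := 1 / (2 ^ (d + 1) * a) with hδ
  have hδ0 : 0 < δ := by positivity
  have hδ1 : δ ≤ 1 := by
    rw [hδ, div_le_one (by positivity)]
    calc (1 : ℝ) = 1 * 1 := by norm_num
      _ ≤ 2 ^ (d + 1) * a := by gcongr; exact one_le_pow₀ (by norm_num)
  set r := 1 + δ with hr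
  have hr0 : 0 < r := by linarith
  set B : ℝ := 2 ^ (d + 3) * p * a with hB
  have hB0 : 0 < B := by positivity
  have hB1 : 1 ≤ B := by
    calc (1 : ℝ) = 1 * 1 * 1 := by norm_num
      _ ≤ B := by rw [hB]; gcongr; exact one_le_pow₀ (by norm_num)
  have ht0 : 0 < t := by linarith
  have hs : 1 / (1 + 1 / t) = 1 - 1 / (t + 1) := one_div_one_add_one_div ht0
  set s := 1 + 1 / t with hsd
  have hs1 : 1 < s := by
    have : 0 < 1 / t := by positivity
    linarith
  set η := (1 - 1 / r) / p - 1 / (t + 1) with hη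
  have hζ : δ / 2 ≤ 1 - 1 / r := by
    rw [show 1 - 1 / r = δ / r by rw [hr]; field_simp; ring]
    exact div_le_div_of_nonneg_left hδ0.le hr0 (by linarith)
  -- Reverse Hölder provides a gap of at least δ/(2p) = 2/B, and t ≥ B spends at most half of it.
  have hηB : 1 / B ≤ η := by
    have h1 : 1 / (t + 1) ≤ 1 / B := one_div_le_one_div_of_le hB0 (by linarith)
    have h2 : 2 * (1 / B) = δ / 2 / p := by rw [hB, hδ, pow_add, pow_add]; field_simp
    have h3 : δ / 2 / p ≤ (1 - 1 / r) / p := by gcongr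
    rw [hη]; linarith
  have hη0 : 0 < η := lt_of_lt_of_le (by positivity) hηB
  have hη1 : η ≤ 1 / p := by
    have h1 : 0 < 1 / (t + 1) := by positivity
    have h2 : 0 < 1 / r := by positivity
    have h3 : (1 - 1 / r) / p ≤ 1 / p := by gcongr; linarith
    rw [hη]; linarith
  have hk0 : 0 < 1 - 1 / p + η := by linarith
  set k := 1 / (1 - 1 / p + η) with hk
  have ek : 1 / k = 1 - 1 / p + η := by rw [hk, one_div_one_div]
  have hk1 : 1 ≤ k := by rw [hk, one_le_div hk0]; linarith
  have hskr : 1 / s = 1 / k + 1 / (p * r) := by rw [hs, ek, hη]; field_simp; ring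
  have hsk : s < k := by
    have : 0 < 1 / (p * r) := by positivity
    exact lt_of_one_div_lt_one_div (by linarith) (by linarith)
  refine ⟨k, η, hk1, hη0, ek, ?_, ?_⟩
  · rw [hA, ENNReal.ofReal_rpow_of_pos (by linarith), ← ENNReal.ofReal_mul (by positivity)]
    apply ENNReal.ofReal_le_ofReal
    have h1 : (1 / η) ^ (1 - 1 / p) ≤ B ^ (1 - 1 / p) := by
      apply Real.rpow_le_rpow (by positivity) _ hp'
      rw [div_le_comm₀ hη0 hB0]; exact hηB
    have hc1 : (1 : ℝ) ≤ 2 ^ (d + 3) * p := by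
      calc (1 : ℝ) = 1 * 1 := by norm_num
        _ ≤ _ := by gcongr; exact one_le_pow₀ (by norm_num)
    have h2 : ((2 : ℝ) ^ (d + 3) * p) ^ (1 - 1 / p) ≤ 2 ^ (d + 3) * p := by
      calc ((2 : ℝ) ^ (d + 3) * p) ^ (1 - 1 / p) ≤ (2 ^ (d + 3) * p) ^ (1 : ℝ) := by
            apply Real.rpow_le_rpow_of_exponent_le hc1
            have : 0 < 1 / p := by positivity
            linarith
        _ = _ := Real.rpow_one _
    calc 3 * (1 / η) ^ (1 - 1 / p) ≤ 3 * B ^ (1 - 1 / p) := by gcongr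
      _ = 3 * ((2 ^ (d + 3) * p) ^ (1 - 1 / p) * a ^ (1 - 1 / p)) := by
          rw [hB, Real.mul_rpow (by positivity) (by positivity)]
      _ ≤ 3 * ((2 ^ (d + 3) * p) * a ^ (1 - 1 / p)) := by gcongr
      _ = _ := by ring
  · intro α Q hQ hfin v hv
    have hRH := reverse_holder hd hw (by rw [hA]; exact ENNReal.ofReal_ne_top) hQ hfin hδ0 (by
      rw [hA, show (2 : ℝ≥0∞) ^ (d + 1) = ENNReal.ofReal (2 ^ (d + 1)) by
        rw [ENNReal.ofReal_pow (by norm_num), ENNReal.ofReal_ofNat],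
        ← ENNReal.ofReal_mul (by positivity), ← ENNReal.ofReal_mul hδ0.le, hδ,
        one_div_mul_cancel (by positivity), ENNReal.ofReal_one])
    refine (lpAvg_mul_rpow_one_div_le (by linarith) hsk hp0 hskr hv hw Q).trans ?_
    calc lpAvg k v Q * lpAvg r w Q ^ (1 / p) ≤ lpAvg k v Q * (2 * lpAvg 1 w Q) ^ (1 / p) := by
          gcongr
      _ = lpAvg k v Q * (2 ^ (1 / p) * lpAvg 1 w Q ^ (1 / p)) := by
          rw [ENNReal.mul_rpow_of_nonneg _ _ (by positivity)]
      _ ≤ lpAvg k v Q * (2 * lpAvg 1 w Q ^ (1 / p)) := by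
          gcongr
          calc (2 : ℝ≥0∞) ^ (1 / p) ≤ 2 ^ (1 : ℝ) :=
                ENNReal.rpow_le_rpow_of_exponent_le (by norm_num) (by linarith)
            _ = 2 := ENNReal.rpow_one _
      _ = _ := by ring

open scoped Classical in
/-- The Carleson embedding theorem for a finite laminar family. -/
lemma Laminar.carleson_embedding {F : Finset (Set (Fin d → ℝ))} (hF : Laminar F)
    (hm : ∀ R ∈ F, MeasurableSet R) (φ : Set (Fin d → ℝ) → ℝ≥0∞) {Θ : ℝ≥0∞ → ℝ≥0∞}
    (hΘ : Monotone Θ) (h0 : Θ 0 = 0) {μ : Measure (Fin d → ℝ)} {f : (Fin d → ℝ) → ℝ≥0∞}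
    (hf : AEMeasurable f μ) {c : Set (Fin d → ℝ) → ℝ≥0∞} {B : ℝ≥0∞}
    (h : ∀ R ∈ F, ∑ Q ∈ F.filter (· ⊆ R), c Q ≤ B * ∫⁻ x in R, f x ∂μ) :
    ∑ Q ∈ F, c Q * Θ (upSup F φ Q) ≤ B * ∫⁻ x, f x * Θ (maxOn F φ x) ∂μ := by
  rw [sum_mul_upSup hF φ hΘ h0, lintegral_mul_comp_maxOn hF hm φ hΘ h0 hf, Finset.mul_sum]
  refine Finset.sum_le_sum fun R hR => ?_
  rw [mul_left_comm]
  exact mul_le_mul_right (h R hR) _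

open scoped Classical in
/-- `A_∞` weights satisfy the Carleson packing condition. -/
lemma Carried.sum_lpAvg_one_le {F : Finset (Set (Fin d → ℝ))}
    {E : Set (Fin d → ℝ) → Set (Fin d → ℝ)} (h : Carried F E) {w : (Fin d → ℝ) → ℝ≥0∞}
    (hA : aInftyConst w ≠ ∞) {R : Set (Fin d → ℝ)} (hR : IsCube R)
    (hfin : ∫⁻ x in R, w x ≠ ∞) :
    ∑ Q ∈ F.filter (· ⊆ R), volume (E Q) * lpAvg 1 w Q ≤ aInftyConst w * ∫⁻ x in R, w x := by
  refine le_trans ?_ (lintegral_maximalFn_le_aInftyConst hA hR hfin)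
  have h' := h.mono (Finset.filter_subset (· ⊆ R) F)
  refine sum_carrier_le h'.measurableSet h'.disjoint
    (fun Q hQ => (h'.subset Q hQ).trans (Finset.mem_filter.mp hQ).2) fun Q hQ x hx => ?_
  rw [lpAvg_one]
  exact setLAverage_le_maximalFn_indicator (h'.isCube Q hQ) (Finset.mem_filter.mp hQ).2
    (h'.subset Q hQ hx)

/-- The Coifman–Fefferman inequality when the right-hand side is finite. -/
lemma coifmanFefferman_of_ne_top (hd : 1 ≤ d) {p : ℝ} (hp : 1 < p)
    {T : ((Fin d → ℝ) → ℂ) → ((Fin d → ℝ) → ℂ)} {C : ℝ≥0} (hT : HasLinearSparseGrowth T C)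
    {w : (Fin d → ℝ) → ℝ≥0∞} (hw : IsWeight w) (hA : aInftyConst w < ∞)
    (h0 : ¬ w =ᵐ[volume] 0) {ε : ℝ} (hε : 0 < ε) {f : (Fin d → ℝ) → ℂ} (hf : IsBddCompSupp f)
    (hfin : wNorm p w (maximalFn (1 + ε) (absFun f)) ≠ ∞) :
    wNorm p w (absFun (T f)) ≤ (6 * (2 ^ (d + 3) * p).toNNReal ^ 2 * reductionConst d : ℝ≥0) * C *
      (ENNReal.ofReal ((1 + ε) / ε) * aInftyConst w ^ 2) *
        wNorm p w (maximalFn (1 + ε) (absFun f)) := by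
  have hp0 : 0 < p := by linarith
  have hp' := one_sub_one_div_nonneg hp
  set a := (aInftyConst w).toReal with ha_def
  have hAa : aInftyConst w = ENNReal.ofReal a := (ENNReal.ofReal_toReal hA.ne).symm
  have ha : 1 ≤ a := by
    have := one_le_aInftyConst hw h0
    rwa [hAa, ENNReal.one_le_ofReal] at this
  set c : ℝ := 2 ^ (d + 3) * p with hc
  have hc1 : 1 ≤ c := by
    calc (1 : ℝ) = 1 * 1 := by norm_num
      _ ≤ _ := by rw [hc]; gcongr; exact one_le_pow₀ (by norm_num)
  -- The product exceeds both c a, as the bump of w requires, and 1/ε, which puts the exponent of f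
  -- below 1 + ε.
  set t := c * a * ((1 + ε) / ε) with ht
  have hca : 1 ≤ c * a := by nlinarith
  have hεε : (1 + ε) / ε = 1 + 1 / ε := by field_simp; ring
  have hε' : 0 < 1 / ε := by positivity
  have htca : c * a ≤ t := by rw [ht, hεε]; nlinarith
  have htε : 1 / ε ≤ t := by rw [ht, hεε]; nlinarith
  have ht1 : 1 < t := by rw [ht, hεε]; nlinarith
  have hsε : 1 + 1 / t ≤ 1 + ε := by
    have : 1 / t ≤ ε := by rw [div_le_comm₀ (by linarith) hε]; exact htε
    linarith
  obtain ⟨k, η, hk1, hη0, ek, hηc, hbump⟩ := exists_lpAvg_mul_rpow_le hd hw.1 ha hAa hp htca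
  have main := wNorm_le_of_sparse hT ht1 hp hf hw.1 hw.ae_ne_top
    (N := 2 * (aInftyConst w ^ (1 / p) * wNorm p w (maximalFn (1 + ε) (absFun f)) *
      (ENNReal.ofReal (3 * c) * aInftyConst w ^ (1 - 1 / p))))
    (by
      have := ENNReal.rpow_ne_top_of_nonneg (y := 1 / p) (by positivity) hA.ne
      have := ENNReal.rpow_ne_top_of_nonneg hp' hA.ne
      finiteness) (fun α F E hFE v hv => by
      have hterm : ∀ Q ∈ F, lpAvg (1 + 1 / t) (absFun f) Q *
          lpAvg (1 + 1 / t) (fun x => v x * w x ^ (1 / p)) Q ≤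
          2 * ((lpAvg (1 + ε) (absFun f) Q * lpAvg 1 w Q ^ (1 / p)) * lpAvg k v Q) := by
        intro Q hQ
        have hQc := hFE.isCube Q hQ
        calc _ ≤ lpAvg (1 + ε) (absFun f) Q * (2 * (lpAvg k v Q * lpAvg 1 w Q ^ (1 / p))) :=
              mul_le_mul' (lpAvg_le_lpAvg (by positivity) hsε hf.aemeasurable_absFun hQc)
                (hbump α Q (hFE.mem_grid Q hQ) (hw.lintegral_cube_ne_top hQc) v hv)
          _ = _ := by ring
      have hpp : 1 / (p / (p - 1)) = 1 - 1 / p := by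
        have : 0 < p - 1 := by linarith
        field_simp
      have hvsum := hFE.toCarried.sum_lpAvg_norm_le (q := p / (p - 1)) hk1
        (by have : 0 < p - 1 := by linarith
            positivity) hη0 (by rw [hpp, ek]) hv
      rw [hpp] at hvsum
      set φ : Set (Fin d → ℝ) → ℝ≥0∞ := fun Q => lpAvg (1 + ε) (absFun f) Q
      have hmono : Monotone fun y : ℝ≥0∞ => y ^ p := fun a b h => ENNReal.rpow_le_rpow h hp0.le
      -- The p-th power turns the coefficients into |E_Q| ⟨w⟩_Q, which is a Carleson sequence for w
      -- with constant the A_∞ constant.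
      have hfsum : ∑ Q ∈ F, volume (E Q) * (φ Q * lpAvg 1 w Q ^ (1 / p)) ^ p ≤
          aInftyConst w * ∫⁻ x, maximalFn (1 + ε) (absFun f) x ^ p * w x := by
        calc ∑ Q ∈ F, volume (E Q) * (φ Q * lpAvg 1 w Q ^ (1 / p)) ^ p
            ≤ ∑ Q ∈ F, volume (E Q) * lpAvg 1 w Q * upSup F φ Q ^ p := by
              refine Finset.sum_le_sum fun Q hQ => ?_
              rw [ENNReal.mul_rpow_of_nonneg _ _ hp0.le, ← ENNReal.rpow_mul,
                one_div_mul_cancel hp0.ne', ENNReal.rpow_one, mul_comm (φ Q ^ p), ← mul_assoc]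
              gcongr
              exact le_upSup φ hQ subset_rfl
          _ ≤ aInftyConst w * ∫⁻ x, w x * maxOn F φ x ^ p :=
              hFE.laminar.carleson_embedding (fun R hR => (hFE.isCube R hR).measurableSet) φ hmono
                (ENNReal.zero_rpow_of_pos hp0) hw.1 fun R hR =>
                hFE.toCarried.sum_lpAvg_one_le hA.ne (hFE.isCube R hR)
                  (hw.lintegral_cube_ne_top (hFE.isCube R hR))
          _ ≤ _ := by
              refine mul_le_mul_right (lintegral_mono fun x => ?_) _
              rw [mul_comm]
              gcongr
              exact maxOn_le fun Q hQ hx => le_maximalFn (hFE.isCube Q hQ) hx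
      calc _ ≤ ∑ Q ∈ F, volume (E Q) * (2 * ((φ Q * lpAvg 1 w Q ^ (1 / p)) * lpAvg k v Q)) :=
            Finset.sum_le_sum fun Q hQ => mul_le_mul_right (hterm Q hQ) _
        _ = 2 * ∑ Q ∈ F, volume (E Q) * ((φ Q * lpAvg 1 w Q ^ (1 / p)) * lpAvg k v Q) := by
            rw [Finset.mul_sum]
            exact Finset.sum_congr rfl fun _ _ => by ring
        _ ≤ 2 * ((∑ Q ∈ F, volume (E Q) * (φ Q * lpAvg 1 w Q ^ (1 / p)) ^ p) ^ (1 / p) *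
            (∑ Q ∈ F, volume (E Q) * lpAvg k v Q ^ (p / (p - 1))) ^ (1 - 1 / p)) := by
            gcongr
            exact sum_mul_mul_le F hp _ _ _
        _ ≤ 2 * ((aInftyConst w * ∫⁻ x, maximalFn (1 + ε) (absFun f) x ^ p * w x) ^ (1 / p) *
            (ENNReal.ofReal (3 * c) * aInftyConst w ^ (1 - 1 / p) *
              (∫⁻ x, v x ^ (p / (p - 1))) ^ (1 - 1 / p))) := by
            gcongr
            exact hvsum.trans (mul_le_mul_left hηc _)
        _ = _ := by
            rw [ENNReal.mul_rpow_of_nonneg _ _ (by positivity), wNorm]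
            ring)
  refine main.trans (le_of_eq ?_)
  have e1 : aInftyConst w ^ (1 / p) * aInftyConst w ^ (1 - 1 / p) = aInftyConst w := by
    rw [← ENNReal.rpow_add_of_nonneg _ _ (by positivity) hp']
    simp
  have e2 : ENNReal.ofReal t = ENNReal.ofReal c * aInftyConst w * ENNReal.ofReal ((1 + ε) / ε) := by
    rw [ht, ENNReal.ofReal_mul (by positivity), ENNReal.ofReal_mul (by positivity), hAa]
  rw [e2, ENNReal.ofReal_mul (by norm_num : (0 : ℝ) ≤ 3), ENNReal.ofReal_ofNat]
  have e3 : ((c.toNNReal : ℝ≥0) : ℝ≥0∞) = ENNReal.ofReal c := rfl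
  push_cast
  rw [e3]
  calc _ = 6 * ENNReal.ofReal c ^ 2 * reductionConst d * C *
      (ENNReal.ofReal ((1 + ε) / ε) * (aInftyConst w *
        (aInftyConst w ^ (1 / p) * aInftyConst w ^ (1 - 1 / p)))) *
        wNorm p w (maximalFn (1 + ε) (absFun f)) := by ring
    _ = _ := by rw [e1]; ring

theorem coifmanFefferman (hd : 1 ≤ d) {p : ℝ} (hp : 1 < p)
    {T : ((Fin d → ℝ) → ℂ) → ((Fin d → ℝ) → ℂ)} {C : ℝ≥0} (hT : HasLinearSparseGrowth T C)
    {w : (Fin d → ℝ) → ℝ≥0∞} (hw : IsWeight w) (hA : aInftyConst w < ∞)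
    {ε : ℝ} (hε : 0 < ε) {f : (Fin d → ℝ) → ℂ} (hf : IsBddCompSupp f) :
    wNorm p w (absFun (T f)) ≤ (6 * (2 ^ (d + 3) * p).toNNReal ^ 2 * reductionConst d : ℝ≥0) * C *
      (ENNReal.ofReal ((1 + ε) / ε) * aInftyConst w ^ 2) *
        wNorm p w (maximalFn (1 + ε) (absFun f)) := by
  by_cases h0 : w =ᵐ[volume] 0
  · rw [wNorm_eq_zero hp h0]
    exact zero_le
  have hp0 : 0 < p := by linarith
  have hc : 0 < (2 ^ (d + 3) * p).toNNReal := by rw [Real.toNNReal_pos]; positivity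
  have hA1 := one_le_aInftyConst hw h0
  refine wNorm_le_of_finite hT hf hp ?_ ?_ (coifmanFefferman_of_ne_top hd hp hT hw hA h0 hε hf)
  · have : 0 < reductionConst d := by unfold reductionConst; positivity
    positivity
  · refine mul_ne_zero ?_ (pow_ne_zero _ (zero_lt_one.trans_le hA1).ne')
    rw [Ne, ENNReal.ofReal_eq_zero, not_le]
    positivity

/-! ### The A_q–A_∞ estimate. -/

/-- `A_q` bump against a larger exponent. -/
lemma lpAvg_mul_rpow_le_of_apConst {p q s κ : ℝ} (hp : 0 < p) (hq : 1 ≤ q) (hs : 0 < s)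
    (hκ : 0 < κ) (e : 1 / κ = 1 / s - (q - 1) / p) {w : (Fin d → ℝ) → ℝ≥0∞} (hw : AEMeasurable w)
    (hpos : ∀ᵐ x, w x ≠ 0 ∧ w x ≠ ∞) {Q : Set (Fin d → ℝ)} (hQ : IsCube Q)
    {f : (Fin d → ℝ) → ℝ≥0∞} (hf : AEMeasurable f) :
    lpAvg s f Q * lpAvg 1 w Q ^ (1 / p) ≤
      apConst q w ^ (1 / p) * lpAvg κ (fun x => f x * w x ^ (1 / p)) Q := by
  have hfm : AEMeasurable fun x => f x * w x ^ (1 / p) := hf.mul (hw.pow_const _)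
  have hrep : f =ᵐ[volume] fun x => (f x * w x ^ (1 / p)) * w x ^ (-(1 / p)) := by
    filter_upwards [hpos] with x hx
    rw [mul_assoc, ← ENNReal.rpow_add _ _ hx.1 hx.2]
    simp
  rw [lpAvg_congr_ae hrep]
  -- For q = 1 the bound 1/w ≤ ess sup is pointwise and no exponent is lost; for q > 1 Hölder with
  -- exponent p/(q-1) produces the dual weight of A_q.
  rcases hq.eq_or_lt with rfl | hq1
  · have hκs : κ = s := by
      have : 1 / κ = 1 / s := by rw [e]; simp
      simpa using this
    subst hκs
    set M := essSup (fun x => (w x)⁻¹) (volume.restrict Q)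
    have h1 : lpAvg κ (fun x => (f x * w x ^ (1 / p)) * w x ^ (-(1 / p))) Q ≤
        M ^ (1 / p) * lpAvg κ (fun x => f x * w x ^ (1 / p)) Q := by
      rw [← lpAvg_const_mul hκ _ hfm]
      refine lpAvg_mono_ae hκ.le ?_
      filter_upwards [ENNReal.ae_le_essSup (μ := volume.restrict Q) fun x => (w x)⁻¹] with x hx
      rw [mul_comm]
      gcongr
      rw [ENNReal.rpow_neg, ← ENNReal.inv_rpow]
      exact ENNReal.rpow_le_rpow hx (by positivity)
    have h2 : lpAvg 1 w Q * M ≤ apConst 1 w := by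
      rw [apConst, if_pos rfl, lpAvg_one]
      exact le_iSup₂ (f := fun (Q : Set (Fin d → ℝ)) (_ : IsCube Q) =>
        (⨍⁻ x in Q, w x ∂volume) * essSup (fun x => (w x)⁻¹) (volume.restrict Q)) Q hQ
    calc _ ≤ (M ^ (1 / p) * lpAvg κ (fun x => f x * w x ^ (1 / p)) Q) * lpAvg 1 w Q ^ (1 / p) := by
          gcongr
      _ = (lpAvg 1 w Q * M) ^ (1 / p) * lpAvg κ (fun x => f x * w x ^ (1 / p)) Q := by
          rw [ENNReal.mul_rpow_of_nonneg _ _ (by positivity)]; ring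
      _ ≤ _ := by gcongr
  · have hq0 : 0 < q - 1 := by linarith
    have hsκ : s < κ := by
      have : 0 < (q - 1) / p := by positivity
      exact lt_of_one_div_lt_one_div hκ (by linarith)
    have h1 := lpAvg_mul_le (m := p / (q - 1)) hs hsκ (by rw [e, one_div_div]; ring) hfm
      (hw.pow_const (-(1 / p))) Q
    have h2 : lpAvg (p / (q - 1)) (fun x => w x ^ (-(1 / p))) Q =
        ((⨍⁻ x in Q, dualWeight q w x ∂volume) ^ (q - 1)) ^ (1 / p) := by
      simp only [lpAvg, dualWeight, dualWeight_exponent hq1, ← ENNReal.rpow_mul]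
      congr 1
      · congr 1
        ext x
        congr 1
        field_simp
      · field_simp
    have h3 : lpAvg 1 w Q * (⨍⁻ x in Q, dualWeight q w x ∂volume) ^ (q - 1) ≤ apConst q w := by
      rw [apConst, if_neg hq1.ne', lpAvg_one]
      exact le_iSup₂ (f := fun (Q : Set (Fin d → ℝ)) (_ : IsCube Q) => (⨍⁻ x in Q, w x ∂volume) *
        (⨍⁻ x in Q, dualWeight q w x ∂volume) ^ (q - 1)) Q hQ
    rw [h2] at h1
    calc _ ≤ (lpAvg κ (fun x => f x * w x ^ (1 / p)) Q *
          ((⨍⁻ x in Q, dualWeight q w x ∂volume) ^ (q - 1)) ^ (1 / p)) * lpAvg 1 w Q ^ (1 / p) := by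
          gcongr
      _ = (lpAvg 1 w Q * (⨍⁻ x in Q, dualWeight q w x ∂volume) ^ (q - 1)) ^ (1 / p) *
          lpAvg κ (fun x => f x * w x ^ (1 / p)) Q := by
          rw [ENNReal.mul_rpow_of_nonneg _ _ (by positivity : 0 ≤ 1 / p)]; ring
      _ ≤ _ := by gcongr

lemma MuckenhouptPair.ne_zero {p : ℝ} (hp : 1 < p) {w σ : (Fin d → ℝ) → ℝ≥0∞} {A : ℝ≥0∞}
    (h : MuckenhouptPair p w σ A) : A ≠ 0 := by
  rintro rfl
  have hp1 : 0 < p - 1 := by linarith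
  have hQ := isCube_centeredCube (d := d) 0
  have := h.le _ hQ
  rw [nonpos_iff_eq_zero, mul_eq_zero, ENNReal.rpow_eq_zero_iff_of_pos hp1, setLAverage_eq,
    setLAverage_eq, ENNReal.div_eq_zero_iff, ENNReal.div_eq_zero_iff] at this
  simp [h.lintegral_left_ne_zero hQ, h.lintegral_right_ne_zero hp hQ, hQ.volume_ne_top] at this

/-- Qualitative properties of nonzero `A_q` weights. -/
lemma apConst_qualitative {q : ℝ} (hq : 1 ≤ q) {w : (Fin d → ℝ) → ℝ≥0∞} (hw : IsWeight w)
    (hA : apConst q w < ∞) (h0 : ¬ w =ᵐ[volume] 0) :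
    apConst q w ≠ 0 ∧ aInftyConst w < ∞ ∧ ∀ᵐ x, w x ≠ 0 ∧ w x ≠ ∞ := by
  obtain ⟨q', hq', hle⟩ : ∃ q', 1 < q' ∧ apConst q' w ≤ apConst q w := by
    rcases hq.eq_or_lt with rfl | hq1
    · exact ⟨2, by norm_num, apConst_two_le_apConst_one w⟩
    · exact ⟨q, hq1, le_rfl⟩
  have hA' := hle.trans_lt hA
  have hpair := muckenhouptPair hq' hw hA' h0
  refine ⟨fun h => hpair.ne_zero hq' (by simpa [h] using hle), ?_, ?_⟩
  · refine (hpair.aInftyConst_le hq').trans_lt (ENNReal.mul_lt_top ?_ hA')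
    finiteness
  · filter_upwards [hpair.ae_dual] with x hx using ⟨hx.1, hx.2.1⟩

/-- The constant in the `A_q`-`A_∞` estimate. -/
def mixedAqConst (d : ℕ) (p q : ℝ) : ℝ≥0 :=
  (18 * (2 ^ (d + 3) * p + 2 * p / (p - q)) * (2 * p / (p - q)) ^ (1 / p) *
    (2 ^ (d + 3) * p)).toNNReal * reductionConst d

/-- Reverse Hölder frees ⟨w⟩^(1/p) from the dual side, and the A_q condition then moves it into the
average of f. The gap on the side of f depends only on p and q, so only the dual side adds the power
1/p' of the A_∞ constant to the factor t. -/
lemma mixedAq_of_ne_top (hd : 1 ≤ d) {p q : ℝ} (hq : 1 ≤ q) (hqp : q < p)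
    {T : ((Fin d → ℝ) → ℂ) → ((Fin d → ℝ) → ℂ)} {C : ℝ≥0} (hT : HasLinearSparseGrowth T C)
    {w : (Fin d → ℝ) → ℝ≥0∞} (hw : IsWeight w) (hAq : apConst q w < ∞)
    (h0 : ¬ w =ᵐ[volume] 0) {f : (Fin d → ℝ) → ℂ} (hf : IsBddCompSupp f)
    (hfin : wNorm p w (absFun f) ≠ ∞) :
    wNorm p w (absFun (T f)) ≤ mixedAqConst d p q * C *
      (apConst q w ^ (1 / p) * aInftyConst w ^ (1 + (1 - 1 / p))) * wNorm p w (absFun f) := by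
  obtain ⟨-, hA, hpos⟩ := apConst_qualitative hq hw hAq h0
  have hp : 1 < p := hq.trans_lt hqp
  have hp0 : 0 < p := by linarith
  have hpq : 0 < p - q := by linarith
  have hp' := one_sub_one_div_nonneg hp
  set a := (aInftyConst w).toReal with ha_def
  have hAa : aInftyConst w = ENNReal.ofReal a := (ENNReal.ofReal_toReal hA.ne).symm
  have ha : 1 ≤ a := by
    have := one_le_aInftyConst hw h0
    rwa [hAa, ENNReal.one_le_ofReal] at this
  set c : ℝ := 2 ^ (d + 3) * p with hc
  have hc1 : 1 ≤ c := by
    calc (1 : ℝ) = 1 * 1 := by norm_num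
      _ ≤ _ := by rw [hc]; gcongr; exact one_le_pow₀ (by norm_num)
  -- The available gap is (p - q)/p = 2/e; since t ≥ e, at least half of it remains.
  set e := 2 * p / (p - q) with he
  have he0 : 0 < e := by positivity
  set t := (c + e) * a with ht
  have htca : c * a ≤ t := by rw [ht]; nlinarith
  have hte : e ≤ t := by rw [ht]; nlinarith
  have ht1 : 1 < t := by rw [ht]; nlinarith
  have hs : 1 / (1 + 1 / t) = 1 - 1 / (t + 1) := one_div_one_add_one_div (by linarith)
  have hs1 : 1 < 1 + 1 / t := by
    have : 0 < 1 / t := by positivity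
    linarith
  set η₁ := (p - q) / p - 1 / (t + 1) with hη₁
  have hη₁e : 1 / e ≤ η₁ := by
    have h1 : 1 / (t + 1) ≤ 1 / e := one_div_le_one_div_of_le he0 (by linarith)
    have h2 : (p - q) / p = 2 * (1 / e) := by rw [he]; field_simp
    rw [hη₁, h2]; linarith
  have hη₁0 : 0 < η₁ := lt_of_lt_of_le (by positivity) hη₁e
  set κ := 1 / (1 / p + η₁) with hκ
  have hκ0 : 0 < 1 / p + η₁ := by positivity
  have eκ : 1 / κ = 1 / p + η₁ := by rw [hκ, one_div_one_div]
  have hκ1 : 1 ≤ κ := by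
    rw [hκ, one_le_div hκ0, hη₁]
    have h1 : 0 < 1 / (t + 1) := by positivity
    have h2 : 1 / p + (p - q) / p ≤ 1 := by
      rw [← add_div, div_le_one hp0]; linarith
    linarith
  have eκs : 1 / κ = 1 / (1 + 1 / t) - (q - 1) / p := by
    rw [eκ, hs, hη₁]; field_simp; ring
  obtain ⟨k, η, hk1, hη0, ek, hηc, hbump⟩ := exists_lpAvg_mul_rpow_le hd hw.1 ha hAa hp htca
  have main := wNorm_le_of_sparse hT ht1 hp hf hw.1 hw.ae_ne_top
    (N := 2 * (apConst q w ^ (1 / p) * (ENNReal.ofReal (3 * e ^ (1 / p)) * wNorm p w (absFun f) *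
      (ENNReal.ofReal (3 * c) * aInftyConst w ^ (1 - 1 / p)))))
    (by
      have := ENNReal.rpow_ne_top_of_nonneg (y := 1 / p) (by positivity) hAq.ne
      have := ENNReal.rpow_ne_top_of_nonneg hp' hA.ne
      finiteness) (fun α F E hFE v hv => by
      set u : (Fin d → ℝ) → ℝ≥0∞ := fun x => absFun f x * w x ^ (1 / p)
      have hum : AEMeasurable u := hf.aemeasurable_absFun.mul (hw.1.pow_const _)
      have hterm : ∀ Q ∈ F, lpAvg (1 + 1 / t) (absFun f) Q *
          lpAvg (1 + 1 / t) (fun x => v x * w x ^ (1 / p)) Q ≤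
          2 * (apConst q w ^ (1 / p) * (lpAvg κ u Q * lpAvg k v Q)) := by
        intro Q hQ
        have hQc := hFE.isCube Q hQ
        calc _ ≤ lpAvg (1 + 1 / t) (absFun f) Q * (2 * (lpAvg k v Q * lpAvg 1 w Q ^ (1 / p))) :=
              mul_le_mul_right
                (hbump α Q (hFE.mem_grid Q hQ) (hw.lintegral_cube_ne_top hQc) v hv) _
          _ = 2 * ((lpAvg (1 + 1 / t) (absFun f) Q * lpAvg 1 w Q ^ (1 / p)) * lpAvg k v Q) := by
              ring
          _ ≤ 2 * ((apConst q w ^ (1 / p) * lpAvg κ u Q) * lpAvg k v Q) := by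
              refine mul_le_mul_right (mul_le_mul_left ?_ _) _
              exact lpAvg_mul_rpow_le_of_apConst hp0 hq (by linarith) (by linarith) eκs hw.1 hpos
                hQc hf.aemeasurable_absFun
          _ = _ := by ring
      calc _ ≤ ∑ Q ∈ F, volume (E Q) * (2 * (apConst q w ^ (1 / p) * (lpAvg κ u Q * lpAvg k v Q))) :=
            Finset.sum_le_sum fun Q hQ => mul_le_mul_right (hterm Q hQ) _
        _ = 2 * (apConst q w ^ (1 / p) * ∑ Q ∈ F, volume (E Q) * (lpAvg κ u Q * lpAvg k v Q)) := by
            rw [Finset.mul_sum, Finset.mul_sum]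
            exact Finset.sum_congr rfl fun _ _ => by ring
        _ ≤ 2 * (apConst q w ^ (1 / p) *
            (ENNReal.ofReal (3 * (1 / η₁) ^ (1 / p)) * (∫⁻ x, u x ^ p) ^ (1 / p) *
              (ENNReal.ofReal (3 * (1 / η) ^ (1 - 1 / p)) *
                (∫⁻ x, v x ^ (p / (p - 1))) ^ (1 - 1 / p)))) := by
            gcongr
            exact hFE.toCarried.sum_mul_lpAvg_le hp hκ1 hk1 hη₁0 hη0 eκ ek hum hv
        _ ≤ 2 * (apConst q w ^ (1 / p) *
            (ENNReal.ofReal (3 * e ^ (1 / p)) * wNorm p w (absFun f) *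
              (ENNReal.ofReal (3 * c) * aInftyConst w ^ (1 - 1 / p) *
                (∫⁻ x, v x ^ (p / (p - 1))) ^ (1 - 1 / p)))) := by
            gcongr
            · rw [div_le_comm₀ hη₁0 he0]; exact hη₁e
            · exact (wNorm_eq_of_mul hp0 w (absFun f)).le
        _ = _ := by ring)
  refine main.trans (le_of_eq ?_)
  have e1 : aInftyConst w ^ (1 + (1 - 1 / p)) = aInftyConst w * aInftyConst w ^ (1 - 1 / p) := by
    rw [ENNReal.rpow_add_of_nonneg _ _ zero_le_one hp', ENNReal.rpow_one]
  have e2 : ENNReal.ofReal t = ENNReal.ofReal (c + e) * aInftyConst w := by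
    rw [ht, ENNReal.ofReal_mul (by positivity), hAa]
  have e3 : ((mixedAqConst d p q : ℝ≥0) : ℝ≥0∞) = 18 * ENNReal.ofReal (c + e) *
      ENNReal.ofReal (e ^ (1 / p)) * ENNReal.ofReal c * reductionConst d := by
    rw [mixedAqConst, ENNReal.coe_mul]
    congr 1
    change ENNReal.ofReal _ = _
    rw [ENNReal.ofReal_mul (by positivity), ENNReal.ofReal_mul (by positivity),
      ENNReal.ofReal_mul (by norm_num), ENNReal.ofReal_ofNat]
  rw [e1, e2, e3, ENNReal.ofReal_mul (by norm_num : (0 : ℝ) ≤ 3),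
    ENNReal.ofReal_mul (by norm_num : (0 : ℝ) ≤ 3), ENNReal.ofReal_ofNat]
  ring

theorem mixedAq (hd : 1 ≤ d) {p q : ℝ} (hq : 1 ≤ q) (hqp : q < p)
    {T : ((Fin d → ℝ) → ℂ) → ((Fin d → ℝ) → ℂ)} {C : ℝ≥0} (hT : HasLinearSparseGrowth T C)
    {w : (Fin d → ℝ) → ℝ≥0∞} (hw : IsWeight w) (hAq : apConst q w < ∞)
    {f : (Fin d → ℝ) → ℂ} (hf : IsBddCompSupp f) :
    wNorm p w (absFun (T f)) ≤ mixedAqConst d p q * C *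
      (apConst q w ^ (1 / p) * aInftyConst w ^ (1 + (1 - 1 / p))) * wNorm p w (absFun f) := by
  have hp : 1 < p := hq.trans_lt hqp
  by_cases h0 : w =ᵐ[volume] 0
  · rw [wNorm_eq_zero hp h0]
    exact zero_le
  have hp0 : 0 < p := by linarith
  have hpq : 0 < p - q := by linarith
  have hp' := one_sub_one_div_nonneg hp
  obtain ⟨hA0, hA, -⟩ := apConst_qualitative hq hw hAq h0
  refine wNorm_le_of_finite hT hf hp ?_ ?_ (mixedAq_of_ne_top hd hq hqp hT hw hAq h0 hf)
  · have h1 : 0 < reductionConst d := by unfold reductionConst; positivity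
    have h2 : 0 < (18 * (2 ^ (d + 3) * p + 2 * p / (p - q)) * (2 * p / (p - q)) ^ (1 / p) *
        (2 ^ (d + 3) * p)).toNNReal := by rw [Real.toNNReal_pos]; positivity
    unfold mixedAqConst
    positivity
  · have hA1 := (zero_lt_one.trans_le (one_le_aInftyConst hw h0)).ne'
    simp [ENNReal.rpow_eq_zero_iff, hA0, hAq.ne, hA1, hA.ne]

/-! ### Kolmogorov's inequality and packing on a level set of the A_p product. -/

/-- Weighted arithmetic-geometric means. This is the increment form of the weak (1,1) bound below
the integrability threshold: the negative power θ - 1 decreases, which reverses the difference on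
the right. -/
lemma rpow_sub_rpow_le_mul_of_lt_one {θ : ℝ} (h0 : 0 < θ) (h1 : θ < 1) {u v : ℝ≥0∞} (hv0 : v ≠ 0)
    (hvu : v ≤ u) (hu : u ≠ ∞) :
    u ^ θ - v ^ θ ≤ u * (ENNReal.ofReal (θ / (1 - θ)) * (v ^ (θ - 1) - u ^ (θ - 1))) := by
  have hu0 : u ≠ 0 := ((pos_iff_ne_zero.mpr hv0).trans_le hvu).ne'
  have h1' : 0 < 1 - θ := by linarith
  lift u to ℝ≥0 using hu
  lift v to ℝ≥0 using ne_top_of_le_ne_top ENNReal.coe_ne_top hvu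
  have hv0' : v ≠ 0 := by exact_mod_cast hv0
  have hu0' : u ≠ 0 := by exact_mod_cast hu0
  have hvu' : v ≤ u := by exact_mod_cast hvu
  have hvp : (0 : ℝ) < v := by exact_mod_cast pos_iff_ne_zero.mpr hv0'
  have hup : (0 : ℝ) < u := by exact_mod_cast pos_iff_ne_zero.mpr hu0'
  rw [← ENNReal.coe_rpow_of_nonneg _ h0.le, ← ENNReal.coe_rpow_of_nonneg _ h0.le,
    ← ENNReal.coe_rpow_of_ne_zero hv0', ← ENNReal.coe_rpow_of_ne_zero hu0', ENNReal.ofReal]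
  norm_cast
  rw [← NNReal.coe_le_coe]
  have m1 : v ^ θ ≤ u ^ θ := NNReal.rpow_le_rpow hvu' h0.le
  have m2 : u ^ (θ - 1) ≤ v ^ (θ - 1) :=
    NNReal.rpow_le_rpow_of_nonpos (pos_iff_ne_zero.mpr hv0') hvu' (by linarith)
  rw [NNReal.coe_sub m1, NNReal.coe_mul, NNReal.coe_mul, NNReal.coe_sub m2]
  push_cast
  rw [Real.coe_toNNReal _ (by positivity)]
  have hy := Real.geom_mean_le_arith_mean2_weighted h0.le h1'.le
    (p₁ := u * (v : ℝ) ^ (θ - 1)) (p₂ := (v : ℝ) ^ θ) (by positivity) (by positivity) (by ring)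
  have e1 : ((u : ℝ) * (v : ℝ) ^ (θ - 1)) ^ θ * ((v : ℝ) ^ θ) ^ (1 - θ) = (u : ℝ) ^ θ := by
    rw [Real.mul_rpow hup.le (by positivity), ← Real.rpow_mul hvp.le, ← Real.rpow_mul hvp.le,
      mul_assoc, ← Real.rpow_add hvp]
    ring_nf
    simp
  rw [e1] at hy
  have e2 : (u : ℝ) * (u : ℝ) ^ (θ - 1) = (u : ℝ) ^ θ := by
    rw [← Real.rpow_one_add' hup.le (by linarith)]; congr 1; ring
  have e3 : (u : ℝ) * (θ / (1 - θ) * ((v : ℝ) ^ (θ - 1) - (u : ℝ) ^ (θ - 1))) =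
      θ * ((u : ℝ) * (v : ℝ) ^ (θ - 1) - (u : ℝ) ^ θ) / (1 - θ) := by rw [← e2]; ring
  rw [e3, le_div_iff₀ h1']
  linarith

open scoped Classical in
/-- Kolmogorov's inequality for a finite laminar family. -/
lemma Carried.sum_rpow_le {F : Finset (Set (Fin d → ℝ))}
    {E : Set (Fin d → ℝ) → Set (Fin d → ℝ)} (h : Carried F E) {σ : (Fin d → ℝ) → ℝ≥0∞}
    (hσ : AEMeasurable σ) (hfin : ∀ Q, IsCube Q → ∫⁻ x in Q, σ x ≠ ∞) {θ : ℝ} (h0 : 0 < θ)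
    (h1 : θ < 1) {R : Set (Fin d → ℝ)} (hR : R ∈ F) (hR0 : ∫⁻ x in R, σ x ≠ 0) :
    ∑ Q ∈ F.filter (· ⊆ R), volume (E Q) * lpAvg 1 σ Q ^ θ ≤
      ENNReal.ofReal (1 / (1 - θ)) * (volume R * lpAvg 1 σ R ^ θ) := by
  have h1' : 0 < 1 - θ := by linarith
  have hG := h.mono (Finset.filter_subset (· ⊆ R) F)
  set G := F.filter (· ⊆ R) with hGdef
  have hRG : R ∈ G := by simp [hGdef, hR]
  have hRc := h.isCube R hR
  set φ : Set (Fin d → ℝ) → ℝ≥0∞ := fun Q => ⨍⁻ y in Q, σ y ∂volume with hφ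
  have hφfin : ∀ Q ∈ G, φ Q ≠ ∞ := fun Q hQ => (setLAverage_lt_top (hfin Q (hG.isCube Q hQ))).ne
  set S := φ R with hS
  have hSfin : S ≠ ∞ := hφfin R hRG
  have hSR : volume R * S = ∫⁻ x in R, σ x := measure_mul_setLAverage _ hRc.volume_ne_top
  have hS0 : S ≠ 0 := by
    intro h
    rw [h, mul_zero] at hSR
    exact hR0 hSR.symm
  have hSθ : S ^ θ ≠ ∞ := ENNReal.rpow_ne_top_of_nonneg h0.le hSfin
  have hSθ1 : S ^ (θ - 1) ≠ ∞ := ENNReal.rpow_ne_top_of_ne_zero hS0 hSfin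
  set M := maxOn G φ
  have hMm : Measurable M := measurable_maxOn (fun Q hQ => (hG.isCube Q hQ).measurableSet) φ
  set c := ENNReal.ofReal (θ / (1 - θ)) with hc
  -- Truncated subtraction makes `Θ₁` and `Θ₂` vanish up to the average `S` over the top cube; below
  -- it the trivial bound S^θ |R| suffices. Hence an argument below `S` may be raised to `S`.
  set Θ₁ : ℝ≥0∞ → ℝ≥0∞ := fun x => x ^ θ - S ^ θ
  set Θ₂ : ℝ≥0∞ → ℝ≥0∞ := fun x => c * (S ^ (θ - 1) - x ^ (θ - 1))
  have anti : ∀ x y : ℝ≥0∞, x ≤ y → y ^ (θ - 1) ≤ x ^ (θ - 1) := fun x y hxy => by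
    rw [← neg_sub 1 θ, ENNReal.rpow_neg, ENNReal.rpow_neg]
    exact ENNReal.inv_le_inv.mpr (ENNReal.rpow_le_rpow hxy h1'.le)
  have mono₁ : Monotone Θ₁ := fun x y hxy =>
    tsub_le_tsub_right (ENNReal.rpow_le_rpow hxy h0.le) _
  have mono₂ : Monotone Θ₂ := fun x y hxy =>
    mul_le_mul_right (tsub_le_tsub_left (anti x y hxy) _) _
  have zero₁ : Θ₁ 0 = 0 := by simp [Θ₁, h0]
  have zero₂ : Θ₂ 0 = 0 := by
    simp [Θ₂, ENNReal.zero_rpow_of_neg (show θ - 1 < 0 by linarith)]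
  have key : ∀ Q ∈ G, ∀ a b, b ≤ a → a = φ Q → Θ₁ a - Θ₁ b ≤ a * (Θ₂ a - Θ₂ b) := by
    intro Q hQ a b hba haQ
    have ha : a ≠ ∞ := haQ ▸ hφfin Q hQ
    rcases le_total a S with haS | hSa
    · have : Θ₁ a = 0 := tsub_eq_zero_of_le (ENNReal.rpow_le_rpow haS h0.le)
      simp [this]
    have f1 : Θ₁ b = Θ₁ (max b S) := by
      rcases le_total b S with h | h
      · rw [max_eq_right h]
        simp [Θ₁, tsub_eq_zero_of_le (ENNReal.rpow_le_rpow h h0.le)]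
      · rw [max_eq_left h]
    have f2 : Θ₂ b = Θ₂ (max b S) := by
      rcases le_total b S with h | h
      · rw [max_eq_right h]
        simp [Θ₂, tsub_eq_zero_of_le (anti _ _ h)]
      · rw [max_eq_left h]
    rw [f1, f2]
    set v := max b S
    have hva : v ≤ a := max_le hba hSa
    have hSv : S ≤ v := le_max_right _ _
    have hv0 : v ≠ 0 := ((pos_iff_ne_zero.mpr hS0).trans_le hSv).ne'
    have hv' : v ^ (θ - 1) ≠ ∞ := ne_top_of_le_ne_top hSθ1 (anti _ _ hSv)
    have e1 : Θ₁ a - Θ₁ v = a ^ θ - v ^ θ :=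
      tsub_tsub_tsub_cancel_right (ENNReal.rpow_le_rpow hSv h0.le)
    have e2 : Θ₂ a - Θ₂ v = c * (v ^ (θ - 1) - a ^ (θ - 1)) := by
      simp only [Θ₂]
      rw [← ENNReal.mul_sub (fun _ _ => ENNReal.ofReal_ne_top),
        ENNReal.sub_sub_sub_cancel_left hSθ1 (anti _ _ hSv)]
    rw [e1, e2]
    exact rpow_sub_rpow_le_mul_of_lt_one h0 h1 hv0 hva ha
  have transfer := lintegral_comp_maxOn_le hG.laminar
    (fun Q hQ => (hG.isCube Q hQ).measurableSet) (fun Q hQ => (hG.isCube Q hQ).volume_ne_top) hσ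
    mono₁ zero₁ mono₂ zero₂ key
  have hM0 : ∀ x, x ∉ R → M x = 0 := fun x hx => by
    rw [← nonpos_iff_eq_zero]
    exact maxOn_le fun Q hQ hxQ => absurd ((Finset.mem_filter.mp hQ).2 hxQ) hx
  have hright : ∫⁻ x, σ x * Θ₂ (M x) ≤ c * (volume R * S ^ θ) := by
    calc ∫⁻ x, σ x * Θ₂ (M x) ≤ ∫⁻ x, R.indicator (fun x => σ x * (c * S ^ (θ - 1))) x := by
          refine lintegral_mono fun x => ?_
          by_cases hx : x ∈ R
          · rw [indicator_of_mem hx]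
            exact mul_le_mul_right (mul_le_mul_right tsub_le_self _) _
          · simp only [hM0 x hx, zero₂, mul_zero, zero_le]
      _ = (∫⁻ x in R, σ x) * (c * S ^ (θ - 1)) := by
          rw [lintegral_indicator hRc.measurableSet, lintegral_mul_const'' _ hσ.restrict]
      _ = c * (volume R * (S * S ^ (θ - 1))) := by rw [← hSR]; ring
      _ = _ := by
          nth_rewrite 1 [← ENNReal.rpow_one S]
          rw [← ENNReal.rpow_add _ _ hS0 hSfin]
          congr 4; ring
  simp only [lpAvg_one]
  calc ∑ Q ∈ G, volume (E Q) * φ Q ^ θ ≤ ∫⁻ x in R, M x ^ θ :=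
        sum_carrier_le hG.measurableSet hG.disjoint
          (fun Q hQ => (hG.subset Q hQ).trans (Finset.mem_filter.mp hQ).2)
          (fun Q hQ x hx => ENNReal.rpow_le_rpow (le_maxOn φ hQ (hG.subset Q hQ hx)) h0.le)
    _ ≤ ∫⁻ x in R, (S ^ θ + Θ₁ (M x)) := lintegral_mono fun x => le_add_tsub
    _ = S ^ θ * volume R + ∫⁻ x in R, Θ₁ (M x) := by
        rw [lintegral_add_left measurable_const, setLIntegral_const]
    _ ≤ S ^ θ * volume R + c * (volume R * S ^ θ) := by
        gcongr
        exact (setLIntegral_le_lintegral _ _).trans (transfer.trans hright)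
    _ = (1 + c) * (volume R * S ^ θ) := by ring
    _ = _ := by
        rw [hc, ← ENNReal.ofReal_one, ← ENNReal.ofReal_add zero_le_one (by positivity)]
        congr 2
        field_simp; ring

-- Hölder with exponents (x+y)/x and (x+y)/y reduces to Kolmogorov for each weight at θ = x + y. It
-- is essential that this sum be below one.
open scoped Classical in
lemma Carried.sum_rpow_mul_rpow_le {F : Finset (Set (Fin d → ℝ))}
    {E : Set (Fin d → ℝ) → Set (Fin d → ℝ)} (h : Carried F E) {σ w : (Fin d → ℝ) → ℝ≥0∞}
    (hσ : AEMeasurable σ) (hσfin : ∀ Q, IsCube Q → ∫⁻ x in Q, σ x ≠ ∞)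
    (hw : AEMeasurable w) (hwfin : ∀ Q, IsCube Q → ∫⁻ x in Q, w x ≠ ∞) {x y : ℝ} (hx : 0 < x)
    (hy : 0 < y) (hxy : x + y < 1) {R : Set (Fin d → ℝ)} (hR : R ∈ F)
    (hσ0 : ∫⁻ x in R, σ x ≠ 0) (hw0 : ∫⁻ x in R, w x ≠ 0) :
    ∑ Q ∈ F.filter (· ⊆ R), volume (E Q) * (lpAvg 1 σ Q ^ x * lpAvg 1 w Q ^ y) ≤
      ENNReal.ofReal (1 / (1 - (x + y))) *
        (volume R * (lpAvg 1 σ R ^ x * lpAvg 1 w R ^ y)) := by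
  have hθ : 0 < x + y := by linarith
  set P := (x + y) / x with hP
  have hP1 : 1 < P := by rw [hP, lt_div_iff₀ hx]; linarith
  have hP' : P / (P - 1) = (x + y) / y := by
    rw [hP, show (x + y) / x - 1 = y / x by field_simp; ring]
    field_simp
  have hPi : 1 / P = x / (x + y) := by rw [hP, one_div_div]
  have hPi' : 1 - 1 / P = y / (x + y) := by rw [hPi]; field_simp; ring
  have e1 : ∀ Q, (lpAvg 1 σ Q ^ x) ^ P = lpAvg 1 σ Q ^ (x + y) := fun Q => by
    rw [← ENNReal.rpow_mul]; congr 1; rw [hP]; field_simp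
  have e2 : ∀ Q, (lpAvg 1 w Q ^ y) ^ (P / (P - 1)) = lpAvg 1 w Q ^ (x + y) := fun Q => by
    rw [← ENNReal.rpow_mul, hP']; congr 1; field_simp
  refine (sum_mul_mul_le _ hP1 _ _ _).trans ?_
  simp only [e1, e2]
  rw [hPi', hPi]
  set κ := ENNReal.ofReal (1 / (1 - (x + y)))
  have hsplit : κ * volume R = (κ * volume R) ^ (x / (x + y)) * (κ * volume R) ^ (y / (x + y)) := by
    rw [← ENNReal.rpow_add_of_nonneg _ _ (by positivity) (by positivity), ← add_div,
      div_self hθ.ne', ENNReal.rpow_one]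
  calc _ ≤ (κ * (volume R * lpAvg 1 σ R ^ (x + y))) ^ (x / (x + y)) *
        (κ * (volume R * lpAvg 1 w R ^ (x + y))) ^ (y / (x + y)) := by
        gcongr
        · exact h.sum_rpow_le hσ hσfin hθ hxy hR hσ0
        · exact h.sum_rpow_le hw hwfin hθ hxy hR hw0
    _ = (κ * volume R) * (lpAvg 1 σ R ^ x * lpAvg 1 w R ^ y) := by
        rw [hsplit, ← mul_assoc, ← mul_assoc, ENNReal.mul_rpow_of_nonneg _ _ (by positivity),
          ENNReal.mul_rpow_of_nonneg _ (lpAvg 1 w R ^ (x + y)) (by positivity),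
          ← ENNReal.rpow_mul (lpAvg 1 σ R), ← ENNReal.rpow_mul (lpAvg 1 w R),
          mul_div_cancel₀ _ hθ.ne', mul_div_cancel₀ _ hθ.ne']
        ring
    _ = _ := by ring

open scoped Classical in
/-- Packing of cubes on which `⟨w⟩ ⟨σ⟩ ^ (p - 1)` is roughly constant. -/
lemma Carried.sum_level_le {F : Finset (Set (Fin d → ℝ))}
    {E : Set (Fin d → ℝ) → Set (Fin d → ℝ)} (h : Carried F E) {σ w : (Fin d → ℝ) → ℝ≥0∞}
    (hσ : AEMeasurable σ) (hσfin : ∀ Q, IsCube Q → ∫⁻ x in Q, σ x ≠ ∞)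
    (hw : AEMeasurable w) (hwfin : ∀ Q, IsCube Q → ∫⁻ x in Q, w x ≠ ∞)
    (hσ0 : ∀ Q, IsCube Q → ∫⁻ x in Q, σ x ≠ 0) (hw0 : ∀ Q, IsCube Q → ∫⁻ x in Q, w x ≠ 0)
    {p : ℝ} (hp : 1 < p)
    (hX : ∀ Q ∈ F, ∀ R ∈ F, lpAvg 1 w Q * lpAvg 1 σ Q ^ (p - 1) ≤
      2 * (lpAvg 1 w R * lpAvg 1 σ R ^ (p - 1))) {R : Set (Fin d → ℝ)} (hR : R ∈ F) :
    ∑ Q ∈ F.filter (· ⊆ R), volume (E Q) * (lpAvg 1 σ Q ^ (1 / p) * lpAvg 1 w Q ^ (1 - 1 / p)) ≤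
      ENNReal.ofReal (2 * (p ^ 2 / (p - 1))) *
        ((∫⁻ x in R, σ x) ^ (1 / p) * (∫⁻ x in R, w x) ^ (1 - 1 / p)) := by
  have hp0 : 0 < p := by linarith
  have hp1 : 0 < p - 1 := by linarith
  have hp' := one_sub_one_div_nonneg hp
  -- The power δ of ⟨w⟩ ⟨σ⟩^(p-1), nearly constant on the level, is split off. This lowers the sum
  -- of the exponents from 1 to 1 - p δ while both remain positive.
  set δ := (p - 1) / p ^ 3 with hδ
  have hδ0 : 0 < δ := by positivity
  have hδ1 : δ ≤ 1 := by
    rw [hδ, div_le_one (by positivity)]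
    nlinarith [sq_nonneg p, mul_pos hp0 hp0, mul_pos (mul_pos hp0 hp0) hp1]
  set x := 1 / p - (p - 1) * δ with hx
  set y := 1 - 1 / p - δ with hy
  have hx0 : 0 < x := by
    rw [hx, hδ, show 1 / p - (p - 1) * ((p - 1) / p ^ 3) = (2 * p - 1) / p ^ 3 by
      field_simp; ring]
    have : 0 < 2 * p - 1 := by linarith
    positivity
  have hy0 : 0 < y := by
    rw [hy, hδ, show 1 - 1 / p - (p - 1) / p ^ 3 = (p - 1) * (p - 1) * (p + 1) / p ^ 3 by
      field_simp; ring]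
    positivity
  have hxy : x + y = 1 - (p - 1) / p ^ 2 := by rw [hx, hy, hδ]; field_simp; ring
  have hxy1 : x + y < 1 := by
    have : 0 < (p - 1) / p ^ 2 := by positivity
    linarith
  have factor : ∀ S W : ℝ≥0∞,
      S ^ (1 / p) * W ^ (1 - 1 / p) = (W * S ^ (p - 1)) ^ δ * (S ^ x * W ^ y) := by
    intro S W
    rw [ENNReal.mul_rpow_of_nonneg _ _ hδ0.le, ← ENNReal.rpow_mul,
      show 1 / p = (p - 1) * δ + x by rw [hx]; ring,
      show 1 - ((p - 1) * δ + x) = δ + y by rw [hx, hy]; ring,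
      ENNReal.rpow_add_of_nonneg _ _ (by positivity) hx0.le,
      ENNReal.rpow_add_of_nonneg _ _ hδ0.le hy0.le]
    ring
  have hRc := h.isCube R hR
  calc _ ≤ ∑ Q ∈ F.filter (· ⊆ R), (2 * (lpAvg 1 w R * lpAvg 1 σ R ^ (p - 1))) ^ δ *
        (volume (E Q) * (lpAvg 1 σ Q ^ x * lpAvg 1 w Q ^ y)) := by
        refine Finset.sum_le_sum fun Q hQ => ?_
        rw [factor, mul_left_comm]
        exact mul_le_mul_left
          (ENNReal.rpow_le_rpow (hX Q (Finset.mem_filter.mp hQ).1 R hR) hδ0.le) _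
    _ = (2 * (lpAvg 1 w R * lpAvg 1 σ R ^ (p - 1))) ^ δ *
        ∑ Q ∈ F.filter (· ⊆ R), volume (E Q) * (lpAvg 1 σ Q ^ x * lpAvg 1 w Q ^ y) := by
        rw [Finset.mul_sum]
    _ ≤ (2 * (lpAvg 1 w R * lpAvg 1 σ R ^ (p - 1)) ^ δ) *
        (ENNReal.ofReal (1 / (1 - (x + y))) *
          (volume R * (lpAvg 1 σ R ^ x * lpAvg 1 w R ^ y))) := by
        refine mul_le_mul' ?_ (h.sum_rpow_mul_rpow_le hσ hσfin hw hwfin hx0 hy0 hxy1 hR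
          (hσ0 R hRc) (hw0 R hRc))
        rw [ENNReal.mul_rpow_of_nonneg _ _ hδ0.le]
        gcongr
        calc (2 : ℝ≥0∞) ^ δ ≤ 2 ^ (1 : ℝ) :=
              ENNReal.rpow_le_rpow_of_exponent_le (by norm_num) hδ1
          _ = 2 := ENNReal.rpow_one _
    _ = 2 * ENNReal.ofReal (1 / (1 - (x + y))) *
        (volume R * (lpAvg 1 σ R ^ (1 / p) * lpAvg 1 w R ^ (1 - 1 / p))) := by rw [factor]; ring
    _ = _ := by
        rw [← volume_mul_lpAvg_one σ hRc, ← volume_mul_lpAvg_one w hRc,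
          ENNReal.mul_rpow_of_nonneg _ _ (by positivity), ENNReal.mul_rpow_of_nonneg _ _ hp',
          ENNReal.ofReal_mul (by norm_num), ENNReal.ofReal_ofNat, hxy]
        have hv : volume R = volume R ^ (1 / p) * volume R ^ (1 - 1 / p) := by
          rw [← ENNReal.rpow_add_of_nonneg _ _ (by positivity) hp']; simp
        rw [show 1 / (1 - (1 - (p - 1) / p ^ 2)) = p ^ 2 / (p - 1) by rw [sub_sub_cancel, one_div_div]]
        nth_rewrite 1 [hv]
        ring

/-! ### The two-weight estimate for a pair of coefficient families. -/

lemma maxOn_mono {X : Type*} {F G : Finset (Set X)} (hFG : F ⊆ G) (φ : Set X → ℝ≥0∞) (x : X) :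
    maxOn F φ x ≤ maxOn G φ x :=
  maxOn_le fun _ hR hx => le_maxOn φ (hFG hR) hx

lemma monotone_rpow {p : ℝ} (hp : 0 ≤ p) : Monotone fun y : ℝ≥0∞ => y ^ p :=
  fun _ _ h => ENNReal.rpow_le_rpow h hp

lemma tsub_rpow_le {q : ℝ} (hq : 1 ≤ q) {a b : ℝ≥0∞} (hba : b ≤ a) :
    (a - b) ^ q ≤ a ^ q - b ^ q := by
  by_cases hb : b = ∞
  · subst hb
    simp [tsub_eq_zero_of_le, show 0 < q by linarith]
  refine ENNReal.le_sub_of_add_le_right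
    (ENNReal.rpow_ne_top_of_nonneg (by linarith) hb) ?_
  calc (a - b) ^ q + b ^ q ≤ (a - b + b) ^ q := ENNReal.add_rpow_le_rpow_add _ _ hq
    _ = a ^ q := by rw [tsub_add_cancel_of_le hba]

/-- One half of the estimate for the paraproduct decomposition: `H` is stopped, `G` is increased. -/
lemma Carried.sum_upSup_mul_incr_le {F : Finset (Set (Fin d → ℝ))}
    {E : Set (Fin d → ℝ) → Set (Fin d → ℝ)} (h : Carried F E) {Λ : ℝ≥0∞}
    (hΛ : ∀ Q ∈ F, volume Q ≤ Λ * volume (E Q)) {σ w : (Fin d → ℝ) → ℝ≥0∞}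
    (hσ : AEMeasurable σ) (hσfin : ∀ Q, IsCube Q → ∫⁻ x in Q, σ x ≠ ∞)
    (hσA : aInftyConst σ ≠ ∞) (hw : AEMeasurable w) {p : ℝ} (hp : 1 < p)
    (H G : Set (Fin d → ℝ) → ℝ≥0∞) :
    ∑ R ∈ F, ((∫⁻ x in R, σ x) ^ (1 / p) * (∫⁻ x in R, w x) ^ (1 - 1 / p)) *
        (upSup F H R * (upSup F G R - strictUpSup F G R)) ≤
      (Λ * aInftyConst σ) ^ (1 / p) * (∫⁻ x, σ x * maxOn F H x ^ p) ^ (1 / p) *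
        (∫⁻ x, w x * maxOn F G x ^ (p / (p - 1))) ^ (1 - 1 / p) := by
  classical
  have hp0 : 0 < p := by linarith
  have hp1 : 0 < p - 1 := by linarith
  have hconj : p.HolderConjugate (p / (p - 1)) := Real.HolderConjugate.conjExponent hp
  have hq1 : 1 ≤ p / (p - 1) := by rw [le_div_iff₀ hp1]; linarith
  have hpp : 1 / (p / (p - 1)) = 1 - 1 / p := by field_simp
  have hm : ∀ R ∈ F, MeasurableSet R := fun R hR => (h.isCube R hR).measurableSet
  have hol := ENNReal.inner_le_Lp_mul_Lq F (fun R => (∫⁻ x in R, σ x) ^ (1 / p) * upSup F H R)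
    (fun R => (∫⁻ x in R, w x) ^ (1 - 1 / p) * (upSup F G R - strictUpSup F G R)) hconj
  rw [hpp] at hol
  calc _ = ∑ R ∈ F, (∫⁻ x in R, σ x) ^ (1 / p) * upSup F H R *
        ((∫⁻ x in R, w x) ^ (1 - 1 / p) * (upSup F G R - strictUpSup F G R)) :=
        Finset.sum_congr rfl fun R _ => by ring
    _ ≤ _ := hol
    _ ≤ _ := by
      rw [← ENNReal.mul_rpow_of_nonneg _ _ (by positivity : 0 ≤ 1 / p)]
      refine mul_le_mul' (ENNReal.rpow_le_rpow ?_ (by positivity))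
        (ENNReal.rpow_le_rpow ?_ (one_sub_one_div_nonneg hp))
      -- The stopped factor: by sparseness the masses σ(Q) themselves form a Carleson sequence,
      -- which costs the A_∞ constant of σ.
      · calc ∑ R ∈ F, ((∫⁻ x in R, σ x) ^ (1 / p) * upSup F H R) ^ p
            = ∑ R ∈ F, (∫⁻ x in R, σ x) * upSup F H R ^ p := by
              refine Finset.sum_congr rfl fun R _ => ?_
              rw [ENNReal.mul_rpow_of_nonneg _ _ hp0.le, ← ENNReal.rpow_mul,
                one_div_mul_cancel hp0.ne', ENNReal.rpow_one]
          _ ≤ _ := by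
              refine h.laminar.carleson_embedding hm H (monotone_rpow hp0.le)
                (ENNReal.zero_rpow_of_pos hp0) hσ fun R hR => ?_
              calc ∑ Q ∈ F.filter (· ⊆ R), ∫⁻ x in Q, σ x
                  ≤ ∑ Q ∈ F.filter (· ⊆ R), Λ * (volume (E Q) * lpAvg 1 σ Q) := by
                    refine Finset.sum_le_sum fun Q hQ => ?_
                    have hQF := (Finset.mem_filter.mp hQ).1
                    rw [← volume_mul_lpAvg_one σ (h.isCube Q hQF), ← mul_assoc]
                    gcongr
                    exact hΛ Q hQF
                _ = Λ * ∑ Q ∈ F.filter (· ⊆ R), volume (E Q) * lpAvg 1 σ Q := by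
                    rw [Finset.mul_sum]
                _ ≤ Λ * (aInftyConst σ * ∫⁻ x in R, σ x) := by
                    gcongr
                    exact h.sum_lpAvg_one_le hσA (h.isCube R hR) (hσfin R (h.isCube R hR))
                _ = _ := by ring
      -- The increased factor needs no A_∞ constant: powers of increments are at most increments of
      -- powers, and these telescope.
      · rw [lintegral_mul_comp_maxOn h.laminar hm G (monotone_rpow (by positivity))
          (ENNReal.zero_rpow_of_pos (by positivity)) hw]
        refine Finset.sum_le_sum fun R _ => ?_
        rw [ENNReal.mul_rpow_of_nonneg _ _ (by positivity), ← ENNReal.rpow_mul, ← hpp,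
          one_div_mul_cancel (by positivity), ENNReal.rpow_one, mul_comm]
        gcongr
        exact tsub_rpow_le hq1 (strictUpSup_le_upSup G R)

/-- The two-weight estimate on cubes where `⟨w⟩ ⟨σ⟩ ^ (p - 1)` is roughly constant. -/
lemma Carried.sum_level_mul_le {F : Finset (Set (Fin d → ℝ))}
    {E : Set (Fin d → ℝ) → Set (Fin d → ℝ)} (h : Carried F E) {Λ : ℝ≥0∞}
    (hΛ : ∀ Q ∈ F, volume Q ≤ Λ * volume (E Q)) {σ w : (Fin d → ℝ) → ℝ≥0∞}
    (hσ : AEMeasurable σ) (hσfin : ∀ Q, IsCube Q → ∫⁻ x in Q, σ x ≠ ∞)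
    (hw : AEMeasurable w) (hwfin : ∀ Q, IsCube Q → ∫⁻ x in Q, w x ≠ ∞)
    (hσ0 : ∀ Q, IsCube Q → ∫⁻ x in Q, σ x ≠ 0) (hw0 : ∀ Q, IsCube Q → ∫⁻ x in Q, w x ≠ 0)
    (hσA : aInftyConst σ ≠ ∞) (hwA : aInftyConst w ≠ ∞) {p : ℝ} (hp : 1 < p)
    (hX : ∀ Q ∈ F, ∀ R ∈ F, lpAvg 1 w Q * lpAvg 1 σ Q ^ (p - 1) ≤
      2 * (lpAvg 1 w R * lpAvg 1 σ R ^ (p - 1))) (H G : Set (Fin d → ℝ) → ℝ≥0∞) :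
    ∑ Q ∈ F, (volume (E Q) * (lpAvg 1 σ Q ^ (1 / p) * lpAvg 1 w Q ^ (1 - 1 / p))) * (H Q * G Q) ≤
      ENNReal.ofReal (2 * (p ^ 2 / (p - 1))) *
        ((Λ * aInftyConst σ) ^ (1 / p) + (Λ * aInftyConst w) ^ (1 - 1 / p)) *
        ((∫⁻ x, σ x * maxOn F H x ^ p) ^ (1 / p) *
          (∫⁻ x, w x * maxOn F G x ^ (p / (p - 1))) ^ (1 - 1 / p)) := by
  classical
  have hp1 : 0 < p - 1 := by linarith
  have hq1 : 1 < p / (p - 1) := by rw [lt_div_iff₀ hp1]; linarith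
  have hpp : 1 / (p / (p - 1)) = 1 - 1 / p := by field_simp
  have hqq : p / (p - 1) / (p / (p - 1) - 1) = p := by
    rw [show p / (p - 1) - 1 = 1 / (p - 1) by field_simp; ring]; field_simp
  set τ : Set (Fin d → ℝ) → ℝ≥0∞ := fun Q =>
    volume (E Q) * (lpAvg 1 σ Q ^ (1 / p) * lpAvg 1 w Q ^ (1 - 1 / p))
  set κ := ENNReal.ofReal (2 * (p ^ 2 / (p - 1)))
  set ν : Set (Fin d → ℝ) → ℝ≥0∞ := fun R =>
    (∫⁻ x in R, σ x) ^ (1 / p) * (∫⁻ x in R, w x) ^ (1 - 1 / p) with hν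
  set Ψ : Finset (Set (Fin d → ℝ)) → ℝ≥0∞ := fun C => C.sup H * C.sup G
  have hΨ : Monotone Ψ := fun _ _ hC => mul_le_mul' (Finset.sup_mono hC) (Finset.sup_mono hC)
  -- The discrete product rule: in each summand one of the two running maxima carries the increment,
  -- and the two resulting sums are exchanged by duality.
  have hincr : ∀ R, Ψ (F.filter (R ⊆ ·)) - Ψ (F.filter (R ⊂ ·)) ≤
      upSup F H R * (upSup F G R - strictUpSup F G R) +
        upSup F G R * (upSup F H R - strictUpSup F H R) := by
    intro R
    change upSup F H R * upSup F G R - strictUpSup F H R * strictUpSup F G R ≤ _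
    rw [tsub_le_iff_right]
    calc upSup F H R * upSup F G R
        ≤ upSup F H R * (strictUpSup F G R + (upSup F G R - strictUpSup F G R)) := by
          gcongr; exact le_add_tsub
      _ = upSup F H R * strictUpSup F G R +
          upSup F H R * (upSup F G R - strictUpSup F G R) := mul_add _ _ _
      _ ≤ (strictUpSup F H R + (upSup F H R - strictUpSup F H R)) * strictUpSup F G R +
          upSup F H R * (upSup F G R - strictUpSup F G R) := by
          gcongr; exact le_add_tsub
      _ = (upSup F H R * (upSup F G R - strictUpSup F G R) +
            strictUpSup F G R * (upSup F H R - strictUpSup F H R)) +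
            strictUpSup F H R * strictUpSup F G R := by ring
      _ ≤ _ := by
          gcongr
          exact strictUpSup_le_upSup G R
  have half₁ := h.sum_upSup_mul_incr_le hΛ hσ hσfin hσA hw hp H G
  have half₂ := h.sum_upSup_mul_incr_le hΛ hw hwfin hwA hσ hq1 G H
  rw [hpp, hqq, sub_sub_cancel] at half₂
  calc ∑ Q ∈ F, τ Q * (H Q * G Q) ≤ ∑ Q ∈ F, τ Q * Ψ (F.filter (Q ⊆ ·)) := by
        refine Finset.sum_le_sum fun Q hQ => mul_le_mul_right (mul_le_mul' ?_ ?_) _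
        · exact le_upSup H hQ subset_rfl
        · exact le_upSup G hQ subset_rfl
    _ = ∑ R ∈ F, (Ψ (F.filter (R ⊆ ·)) - Ψ (F.filter (R ⊂ ·))) *
          ∑ Q ∈ F.filter (· ⊆ R), τ Q :=
        sum_mul_eq_sum_increments h.laminar Ψ hΨ (by simp [Ψ]) τ
    _ ≤ ∑ R ∈ F, (upSup F H R * (upSup F G R - strictUpSup F G R) +
        upSup F G R * (upSup F H R - strictUpSup F H R)) * (κ * ν R) :=
        Finset.sum_le_sum fun R hR => mul_le_mul' (hincr R)
          (h.sum_level_le hσ hσfin hw hwfin hσ0 hw0 hp hX hR)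
    _ = κ * (∑ R ∈ F, ν R * (upSup F H R * (upSup F G R - strictUpSup F G R)) +
        ∑ R ∈ F, ((∫⁻ x in R, w x) ^ (1 - 1 / p) * (∫⁻ x in R, σ x) ^ (1 / p)) *
          (upSup F G R * (upSup F H R - strictUpSup F H R))) := by
        rw [← Finset.sum_add_distrib, Finset.mul_sum]
        exact Finset.sum_congr rfl fun R _ => by simp only [hν]; ring
    _ ≤ κ * (_ + _) := mul_le_mul_right (add_le_add half₁ half₂) _
    _ = _ := by ring

lemma exists_dyadic_level {A X : ℝ≥0∞} (hA : A ≠ ∞) (hX0 : X ≠ 0) (hXA : X ≤ A) :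
    ∃ j : ℕ, X ≤ A * 2⁻¹ ^ j ∧ A * 2⁻¹ ^ j ≤ 2 * X := by
  have hex : ∃ n : ℕ, A * 2⁻¹ ^ n ≤ X := by
    have hlim : Filter.Tendsto (fun n : ℕ => A * (2⁻¹ : ℝ≥0∞) ^ n) Filter.atTop (nhds (A * 0)) :=
      ENNReal.Tendsto.const_mul
        (ENNReal.tendsto_pow_atTop_nhds_zero_of_lt_one (by norm_num)) (Or.inr hA)
    rw [mul_zero] at hlim
    obtain ⟨n, hn⟩ := (hlim.eventually (gt_mem_nhds (pos_iff_ne_zero.mpr hX0))).exists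
    exact ⟨n, hn.le⟩
  classical
  rcases h : Nat.find hex with _ | j
  · have := Nat.find_spec hex
    rw [h, pow_zero, mul_one] at this
    refine ⟨0, by simpa using hXA, ?_⟩
    rw [pow_zero, mul_one, two_mul]
    exact this.trans le_self_add
  · have h1 := Nat.find_spec hex
    have h2 := Nat.find_min hex (m := j) (by omega)
    rw [h] at h1
    refine ⟨j, (not_le.mp h2).le, ?_⟩
    calc A * 2⁻¹ ^ j = 2 * (A * 2⁻¹ ^ (j + 1)) := by
          rw [pow_succ, ← mul_assoc A, mul_comm 2, mul_assoc _ 2⁻¹ 2,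
            ENNReal.inv_mul_cancel (by norm_num) (by norm_num), mul_one]
      _ ≤ 2 * X := by gcongr

/-- The constant in the two-weight estimate. -/
def twoWeightConst (p : ℝ) : ℝ≥0∞ :=
  (1 - (2⁻¹ : ℝ≥0∞) ^ (1 / p))⁻¹ * ENNReal.ofReal (2 * (p ^ 2 / (p - 1)))

lemma twoWeightConst_ne_top {p : ℝ} (hp : 1 < p) : twoWeightConst p ≠ ∞ := by
  have : (2⁻¹ : ℝ≥0∞) ^ (1 / p) < 1 :=
    ENNReal.rpow_lt_one (by norm_num) (by positivity)
  exact ENNReal.mul_ne_top (ENNReal.inv_ne_top.mpr (tsub_pos_of_lt this).ne')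
    ENNReal.ofReal_ne_top

/-- The two-weight estimate for a Muckenhoupt pair. -/
theorem MuckenhouptPair.sum_mul_le {p : ℝ} (hp : 1 < p) {w σ : (Fin d → ℝ) → ℝ≥0∞} {A : ℝ≥0∞}
    (hw : MuckenhouptPair p w σ A) (hA : A ≠ ∞) {F : Finset (Set (Fin d → ℝ))}
    {E : Set (Fin d → ℝ) → Set (Fin d → ℝ)} (h : Carried F E) {Λ : ℝ≥0∞}
    (hΛ : ∀ Q ∈ F, volume Q ≤ Λ * volume (E Q))
    (hσA : aInftyConst σ ≠ ∞) (hwA : aInftyConst w ≠ ∞) (H G : Set (Fin d → ℝ) → ℝ≥0∞) :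
    ∑ Q ∈ F, volume (E Q) * (lpAvg 1 σ Q * lpAvg 1 w Q) * (H Q * G Q) ≤
      twoWeightConst p * A ^ (1 / p) *
        ((Λ * aInftyConst σ) ^ (1 / p) + (Λ * aInftyConst w) ^ (1 - 1 / p)) *
        ((∫⁻ x, σ x * maxOn F H x ^ p) ^ (1 / p) *
          (∫⁻ x, w x * maxOn F G x ^ (p / (p - 1))) ^ (1 - 1 / p)) := by
  classical
  have hp0 : 0 < p := by linarith
  have hp1 : 0 < p - 1 := by linarith
  have hp' := one_sub_one_div_nonneg hp
  set X : Set (Fin d → ℝ) → ℝ≥0∞ := fun Q => lpAvg 1 w Q * lpAvg 1 σ Q ^ (p - 1) with hX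
  have havg : ∀ g : (Fin d → ℝ) → ℝ≥0∞, ∀ Q, IsCube Q → ∫⁻ x in Q, g x ≠ 0 → lpAvg 1 g Q ≠ 0 :=
    fun g Q hQ hg h0 => hg (by rw [← volume_mul_lpAvg_one g hQ, h0, mul_zero])
  have hX0 : ∀ Q ∈ F, X Q ≠ 0 := fun Q hQ => by
    have hQc := h.isCube Q hQ
    refine mul_ne_zero (havg w Q hQc (hw.lintegral_left_ne_zero hQc)) ?_
    rw [Ne, ENNReal.rpow_eq_zero_iff_of_pos hp1]
    exact havg σ Q hQc (hw.lintegral_right_ne_zero hp hQc)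
  have hXA : ∀ Q ∈ F, X Q ≤ A := fun Q hQ => by
    have := hw.le Q (h.isCube Q hQ)
    rwa [← lpAvg_one, ← lpAvg_one] at this
  -- Level j collects the cubes whose A_p product is comparable to A 2^(-j). Extracting the p-th
  -- root of that product leaves ρ^j with ρ < 1, so the levels sum geometrically.
  choose! lev hlev₁ hlev₂ using fun Q (hQ : Q ∈ F) => exists_dyadic_level hA (hX0 Q hQ) (hXA Q hQ)
  set ρ : ℝ≥0∞ := 2⁻¹ ^ (1 / p) with hρ
  set κ := ENNReal.ofReal (2 * (p ^ 2 / (p - 1)))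
  set B := κ * ((Λ * aInftyConst σ) ^ (1 / p) + (Λ * aInftyConst w) ^ (1 - 1 / p)) *
    ((∫⁻ x, σ x * maxOn F H x ^ p) ^ (1 / p) *
      (∫⁻ x, w x * maxOn F G x ^ (p / (p - 1))) ^ (1 - 1 / p)) with hB
  have hlevel : ∀ j, ∑ Q ∈ F with lev Q = j,
      volume (E Q) * (lpAvg 1 σ Q * lpAvg 1 w Q) * (H Q * G Q) ≤ A ^ (1 / p) * ρ ^ j * B := by
    intro j
    have hsub : F.filter (lev · = j) ⊆ F := Finset.filter_subset _ _
    have hF' := h.mono hsub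
    set F' := F.filter (lev · = j) with hF'def
    have hlv : ∀ Q ∈ F', X Q ≤ A * 2⁻¹ ^ j ∧ A * 2⁻¹ ^ j ≤ 2 * X Q := fun Q hQ => by
      obtain ⟨hQF, hQj⟩ := Finset.mem_filter.mp hQ
      rw [← hQj]
      exact ⟨hlev₁ Q hQF, hlev₂ Q hQF⟩
    have hterm : ∀ Q ∈ F', lpAvg 1 σ Q * lpAvg 1 w Q ≤
        A ^ (1 / p) * ρ ^ j * (lpAvg 1 σ Q ^ (1 / p) * lpAvg 1 w Q ^ (1 - 1 / p)) := by
      intro Q hQ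
      calc lpAvg 1 σ Q * lpAvg 1 w Q
          = X Q ^ (1 / p) * (lpAvg 1 σ Q ^ (1 / p) * lpAvg 1 w Q ^ (1 - 1 / p)) := by
            have e1 : lpAvg 1 σ Q = lpAvg 1 σ Q ^ ((p - 1) * (1 / p)) * lpAvg 1 σ Q ^ (1 / p) := by
              rw [← ENNReal.rpow_add_of_nonneg _ _ (by positivity) (by positivity),
                show (p - 1) * (1 / p) + 1 / p = 1 by field_simp; ring, ENNReal.rpow_one]
            have e2 : lpAvg 1 w Q = lpAvg 1 w Q ^ (1 / p) * lpAvg 1 w Q ^ (1 - 1 / p) := by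
              rw [← ENNReal.rpow_add_of_nonneg _ _ (by positivity) hp']; simp
            rw [hX]
            simp only
            rw [ENNReal.mul_rpow_of_nonneg _ _ (by positivity), ← ENNReal.rpow_mul]
            nth_rewrite 1 [e1, e2]
            ring
        _ ≤ (A * 2⁻¹ ^ j) ^ (1 / p) * (lpAvg 1 σ Q ^ (1 / p) * lpAvg 1 w Q ^ (1 - 1 / p)) :=
            mul_le_mul_left (ENNReal.rpow_le_rpow (hlv Q hQ).1 (by positivity)) _
        _ = _ := by
            rw [ENNReal.mul_rpow_of_nonneg _ _ (by positivity), hρ, ← ENNReal.rpow_natCast,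
              ← ENNReal.rpow_natCast, ← ENNReal.rpow_mul, ← ENNReal.rpow_mul, mul_comm (j : ℝ)]
    calc ∑ Q ∈ F', volume (E Q) * (lpAvg 1 σ Q * lpAvg 1 w Q) * (H Q * G Q)
        ≤ ∑ Q ∈ F', A ^ (1 / p) * ρ ^ j *
          ((volume (E Q) * (lpAvg 1 σ Q ^ (1 / p) * lpAvg 1 w Q ^ (1 - 1 / p))) *
            (H Q * G Q)) := by
          refine Finset.sum_le_sum fun Q hQ => ?_
          calc _ ≤ volume (E Q) * (A ^ (1 / p) * ρ ^ j *
                (lpAvg 1 σ Q ^ (1 / p) * lpAvg 1 w Q ^ (1 - 1 / p))) * (H Q * G Q) :=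
                mul_le_mul_left (mul_le_mul_right (hterm Q hQ) _) _
            _ = _ := by ring
      _ = A ^ (1 / p) * ρ ^ j * ∑ Q ∈ F',
          (volume (E Q) * (lpAvg 1 σ Q ^ (1 / p) * lpAvg 1 w Q ^ (1 - 1 / p))) *
            (H Q * G Q) := by rw [Finset.mul_sum]
      _ ≤ A ^ (1 / p) * ρ ^ j * (κ *
          ((Λ * aInftyConst σ) ^ (1 / p) + (Λ * aInftyConst w) ^ (1 - 1 / p)) *
          ((∫⁻ x, σ x * maxOn F' H x ^ p) ^ (1 / p) *
            (∫⁻ x, w x * maxOn F' G x ^ (p / (p - 1))) ^ (1 - 1 / p))) := by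
          refine mul_le_mul_right (hF'.sum_level_mul_le (fun Q hQ => hΛ Q (hsub hQ))
            hw.aemeasurable_right hw.right_ne_top hw.aemeasurable_left hw.left_ne_top
            (fun Q hQ => hw.lintegral_right_ne_zero hp hQ)
            (fun Q hQ => hw.lintegral_left_ne_zero hQ) hσA hwA hp
            (fun Q hQ R hR => (hlv Q hQ).1.trans (hlv R hR).2) H G) _
      _ ≤ _ := by
          rw [hB]
          have hpp : 0 ≤ p / (p - 1) := by positivity
          gcongr
          · exact maxOn_mono hsub H _
          · exact maxOn_mono hsub G _
  rw [← Finset.sum_fiberwise_of_maps_to (g := lev) (t := F.image lev)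
    fun Q hQ => Finset.mem_image_of_mem lev hQ]
  calc _ ≤ ∑ j ∈ F.image lev, A ^ (1 / p) * ρ ^ j * B := Finset.sum_le_sum fun j _ => hlevel j
    _ = A ^ (1 / p) * B * ∑ j ∈ F.image lev, ρ ^ j := by
        rw [Finset.mul_sum]
        exact Finset.sum_congr rfl fun _ _ => by ring
    _ ≤ A ^ (1 / p) * B * (1 - ρ)⁻¹ := by
        rw [← ENNReal.tsum_geometric]
        exact mul_le_mul_right (ENNReal.sum_le_tsum _) _
    _ = _ := by rw [hB, twoWeightConst]; ring

/-! ### The mixed A_p–A_∞ estimate and its pure A_p consequence. -/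

/-- The average `(w(Q)⁻¹ ∫_Q g ^ m w) ^ (1 / m)` with respect to a weight. -/
def weightedAvg (m : ℝ) (w g : (Fin d → ℝ) → ℝ≥0∞) (Q : Set (Fin d → ℝ)) : ℝ≥0∞ :=
  ((∫⁻ x in Q, g x ^ m * w x) / ∫⁻ x in Q, w x) ^ (1 / m)

/-- The weighted maximal function is bounded on `L^p(w)`. -/
lemma lintegral_mul_maxOn_weightedAvg_le {F : Finset (Set (Fin d → ℝ))} (hF : Laminar F)
    (hc : ∀ Q ∈ F, IsCube Q) {w : (Fin d → ℝ) → ℝ≥0∞} (hw : AEMeasurable w)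
    (hfin : ∀ Q, IsCube Q → ∫⁻ x in Q, w x ≠ ∞) {m p : ℝ} (hm : 0 < m) (hmp : m < p)
    {g : (Fin d → ℝ) → ℝ≥0∞} (hg : AEMeasurable g) :
    ∫⁻ x, w x * maxOn F (weightedAvg m w g) x ^ p ≤
      ENNReal.ofReal (p / m / (p / m - 1)) ^ (p / m) * ∫⁻ x, g x ^ p * w x := by
  have hp : 0 < p := hm.trans hmp
  have hpm : 1 < p / m := by rwa [lt_div_iff₀ hm, one_mul]
  have hms : ∀ Q ∈ F, MeasurableSet Q := fun Q hQ => (hc Q hQ).measurableSet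
  set μ := (volume : Measure (Fin d → ℝ)).withDensity w
  set φ : Set (Fin d → ℝ) → ℝ≥0∞ := fun Q => ⨍⁻ y in Q, g y ^ m ∂μ
  have hgm : AEMeasurable fun x => g x ^ m := hg.pow_const m
  have hφ : ∀ Q ∈ F, weightedAvg m w g Q = φ Q ^ (1 / m) := fun Q hQ => by
    simp only [φ, μ]
    rw [setLAverage_withDensity hw (hms Q hQ) hgm, weightedAvg]
  have hle : ∀ x, maxOn F (weightedAvg m w g) x ^ p ≤ maxOn F φ x ^ (p / m) := fun x => by
    have : maxOn F (weightedAvg m w g) x ≤ maxOn F φ x ^ (1 / m) :=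
      maxOn_le fun Q hQ hx => by
        rw [hφ Q hQ]
        exact ENNReal.rpow_le_rpow (le_maxOn φ hQ hx) (by positivity)
    calc _ ≤ (maxOn F φ x ^ (1 / m)) ^ p := ENNReal.rpow_le_rpow this hp.le
      _ = _ := by rw [← ENNReal.rpow_mul]; congr 1; ring
  have habs : μ ≪ volume := withDensity_absolutelyContinuous _ _
  have doob := lintegral_maxOn_rpow_le hF hms (μ := μ)
    (fun Q hQ => by
      simp only [μ]
      rw [withDensity_apply _ (hms Q hQ)]
      exact hfin Q (hc Q hQ)) (hgm.mono_ac habs) hpm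
  have hMm : Measurable (maxOn F φ) := measurable_maxOn hms φ
  calc _ ≤ ∫⁻ x, maxOn F φ x ^ (p / m) * w x := by
        refine lintegral_mono fun x => ?_
        rw [mul_comm]
        exact mul_le_mul_left (hle x) _
    _ = ∫⁻ x, maxOn F φ x ^ (p / m) ∂μ :=
        (lintegral_withDensity' hw (hMm.pow_const _).aemeasurable).symm
    _ ≤ _ := doob
    _ = _ := by
        simp only [μ]
        rw [lintegral_withDensity' hw (hgm.pow_const _)]
        congr 1
        refine lintegral_congr fun x => ?_
        rw [← ENNReal.rpow_mul, mul_div_cancel₀ _ hm.ne']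

/-- The averages of `g w`, raised to a power close to one, are controlled by averages of `g` with
respect to the `A_∞` weight `w`. -/
lemma lpAvg_mul_le_weightedAvg (hd : 1 ≤ d) {w : (Fin d → ℝ) → ℝ≥0∞} (hw : AEMeasurable w) {a : ℝ}
    (ha : 1 ≤ a) (hA : aInftyConst w = ENNReal.ofReal a) {m t : ℝ} (hm : 1 < m)
    (ht : 2 ^ (d + 2) * (m / (m - 1)) * a ≤ t) {α : Fin d → Bool} {Q : Set (Fin d → ℝ)}
    (hQ : Q ∈ grid α) (h0 : ∫⁻ x in Q, w x ≠ 0) (hfin : ∫⁻ x in Q, w x ≠ ∞)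
    {g : (Fin d → ℝ) → ℝ≥0∞} (hg : AEMeasurable g) :
    lpAvg (1 + 1 / t) (fun x => g x * w x) Q ≤ 2 * (lpAvg 1 w Q * weightedAvg m w g Q) := by
  have hm0 : 0 < m := by linarith
  have hm1 : 0 < m - 1 := by linarith
  have hQc := isCube_of_mem_grid hQ
  have hθ0 : 0 < 1 - 1 / m := by
    rw [sub_pos, div_lt_one hm0]; exact hm
  set θ := 1 - 1 / m with hθ
  have hθ1 : θ ≤ 1 := by
    have : 0 < 1 / m := by positivity
    rw [hθ]; linarith
  have ht0 : 0 < t := lt_of_lt_of_le (by positivity) ht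
  set δ : ℝ := 1 / (2 ^ (d + 1) * a) with hδ
  have hδ0 : 0 < δ := by positivity
  have hδ1 : δ ≤ 1 := by
    rw [hδ, div_le_one (by positivity)]
    calc (1 : ℝ) = 1 * 1 := by norm_num
      _ ≤ 2 ^ (d + 1) * a := by gcongr; exact one_le_pow₀ (by norm_num)
  have hs : 1 / (1 + 1 / t) = 1 - 1 / (t + 1) := one_div_one_add_one_div ht0
  set s := 1 + 1 / t with hsd
  have hs0 : 0 < s := by positivity
  set τ := 1 / (t + 1) with hτ
  have hτ0 : 0 < τ := by positivity
  -- The lower bound on t makes s so close to one that Hölder between g w^(1/m) and w^θ needs w only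
  -- to the power θ k ≤ 1 + δ, within reach of reverse Hölder.
  have hτδ : 2 * τ ≤ θ * δ := by
    have h1 : τ ≤ 1 / (2 ^ (d + 2) * (m / (m - 1)) * a) :=
      one_div_le_one_div_of_le (by positivity) (by linarith)
    have h2 : θ * δ = 2 * (1 / (2 ^ (d + 2) * (m / (m - 1)) * a)) := by
      rw [hθ, hδ, pow_add, pow_add]; field_simp
    rw [h2]; linarith
  have hτθ : 0 < θ - τ := by nlinarith
  set k := 1 / (θ - τ) with hk
  have hk0 : 0 < k := by positivity
  have ek : 1 / s = 1 / m + 1 / k := by rw [hs, hk, one_div_one_div, hθ]; ring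
  have hsm : s < m := by
    have : 0 < 1 / k := by positivity
    exact lt_of_one_div_lt_one_div hm0 (by linarith)
  have hθk : θ * k ≤ 1 + δ := by
    rw [hk, mul_one_div, div_le_iff₀ hτθ]; nlinarith
  have hrep : ∀ x, g x * w x = (g x * w x ^ (1 / m)) * w x ^ θ := fun x => by
    rw [mul_assoc, ← ENNReal.rpow_add_of_nonneg _ _ (by positivity) hθ0.le, hθ]
    simp
  have hRH := reverse_holder hd hw (by rw [hA]; exact ENNReal.ofReal_ne_top) hQ hfin hδ0 (by
    rw [hA, show (2 : ℝ≥0∞) ^ (d + 1) = ENNReal.ofReal (2 ^ (d + 1)) by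
      rw [ENNReal.ofReal_pow (by norm_num), ENNReal.ofReal_ofNat],
      ← ENNReal.ofReal_mul (by positivity), ← ENNReal.ofReal_mul hδ0.le, hδ,
      one_div_mul_cancel (by positivity), ENNReal.ofReal_one])
  have hwk : lpAvg k (fun x => w x ^ θ) Q ≤ 2 * lpAvg 1 w Q ^ θ := by
    rw [lpAvg_rpow hθ0.ne']
    calc lpAvg (θ * k) w Q ^ θ ≤ (2 * lpAvg 1 w Q) ^ θ :=
          ENNReal.rpow_le_rpow ((lpAvg_le_lpAvg (by positivity) hθk hw hQc).trans hRH) hθ0.le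
      _ = 2 ^ θ * lpAvg 1 w Q ^ θ := ENNReal.mul_rpow_of_nonneg _ _ hθ0.le
      _ ≤ 2 * lpAvg 1 w Q ^ θ := by
          gcongr
          calc (2 : ℝ≥0∞) ^ θ ≤ 2 ^ (1 : ℝ) :=
                ENNReal.rpow_le_rpow_of_exponent_le (by norm_num) hθ1
            _ = 2 := ENNReal.rpow_one _
  have hgm : lpAvg m (fun x => g x * w x ^ (1 / m)) Q =
      weightedAvg m w g Q * lpAvg 1 w Q ^ (1 / m) := by
    rw [weightedAvg, ← ENNReal.mul_rpow_of_nonneg _ _ (by positivity), lpAvg, lpAvg_one,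
      setLAverage_eq, setLAverage_eq]
    congr 1
    have : ∀ x, (g x * w x ^ (1 / m)) ^ m = g x ^ m * w x := fun x => by
      rw [ENNReal.mul_rpow_of_nonneg _ _ hm0.le, ← ENNReal.rpow_mul, one_div_mul_cancel hm0.ne',
        ENNReal.rpow_one]
    simp_rw [this, div_eq_mul_inv]
    rw [mul_assoc, ← mul_assoc (∫⁻ x in Q, w x)⁻¹, ENNReal.inv_mul_cancel h0 hfin, one_mul]
  calc lpAvg s (fun x => g x * w x) Q = lpAvg s (fun x => (g x * w x ^ (1 / m)) * w x ^ θ) Q := by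
        simp_rw [← hrep]
    _ ≤ lpAvg m (fun x => g x * w x ^ (1 / m)) Q * lpAvg k (fun x => w x ^ θ) Q :=
        lpAvg_mul_le hs0 hsm ek (hg.mul (hw.pow_const _)) (hw.pow_const _) Q
    _ ≤ (weightedAvg m w g Q * lpAvg 1 w Q ^ (1 / m)) * (2 * lpAvg 1 w Q ^ θ) := by
        rw [hgm]; gcongr
    _ = 2 * ((lpAvg 1 w Q ^ (1 / m) * lpAvg 1 w Q ^ θ) * weightedAvg m w g Q) := by ring
    _ = _ := by
        rw [← ENNReal.rpow_add_of_nonneg _ _ (by positivity) hθ0.le, hθ]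
        simp

namespace MuckenhouptPair

variable {p : ℝ} {w σ : (Fin d → ℝ) → ℝ≥0∞} {A : ℝ≥0∞}

/-- Hölder applied to 1 = w^(1/p) σ^(1/p') on any cube. -/
lemma one_le (hp : 1 < p) (h : MuckenhouptPair p w σ A) : 1 ≤ A := by
  have hp0 : 0 < p := by linarith
  have hp1 : 0 < p - 1 := by linarith
  have hQ := isCube_centeredCube (d := d) 0
  set Q := centeredCube d 0
  have hone : (fun _ : Fin d → ℝ => (1 : ℝ≥0∞)) =ᵐ[volume]
      fun x => w x ^ (1 / p) * σ x ^ ((p - 1) / p) := by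
    filter_upwards [h.ae_dual] with x ⟨h0, htop, hx⟩
    rw [hx, ← ENNReal.rpow_mul, ← ENNReal.rpow_add _ _ h0 htop,
      show 1 / p + -(1 / (p - 1)) * ((p - 1) / p) = 0 by field_simp; ring, ENNReal.rpow_zero]
  have h1 : (1 : ℝ≥0∞) ≤ (lpAvg 1 w Q * lpAvg 1 σ Q ^ (p - 1)) ^ (1 / p) := by
    calc (1 : ℝ≥0∞) = lpAvg 1 (fun _ => 1) Q := (lpAvg_const one_pos hQ 1).symm
      _ = lpAvg 1 (fun x => w x ^ (1 / p) * σ x ^ ((p - 1) / p)) Q := lpAvg_congr_ae hone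
      _ ≤ lpAvg p (fun x => w x ^ (1 / p)) Q * lpAvg (p / (p - 1)) (fun x => σ x ^ ((p - 1) / p)) Q :=
          lpAvg_mul_le one_pos hp (by field_simp; ring) (h.aemeasurable_left.pow_const _)
            (h.aemeasurable_right.pow_const _) Q
      _ = _ := by
          rw [lpAvg_rpow (by positivity), lpAvg_rpow (by positivity), one_div_mul_cancel hp0.ne',
            show (p - 1) / p * (p / (p - 1)) = 1 by field_simp,
            ENNReal.mul_rpow_of_nonneg _ _ (by positivity), ← ENNReal.rpow_mul, mul_one_div]
  have h2 : (1 : ℝ≥0∞) ≤ A ^ (1 / p) := h1.trans (ENNReal.rpow_le_rpow (by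
    have := h.le Q hQ
    rwa [← lpAvg_one, ← lpAvg_one] at this) (by positivity))
  by_contra! hlt
  exact absurd h2 (not_le.mpr (ENNReal.rpow_lt_one hlt (by positivity)))

lemma one_le_aInftyConst_left (h : MuckenhouptPair p w σ A) : 1 ≤ aInftyConst w :=
  one_le_aInftyConst_of_cube (isCube_centeredCube (d := d) 0)
    (h.lintegral_left_ne_zero (isCube_centeredCube 0)) (h.left_ne_top _ (isCube_centeredCube 0))

end MuckenhouptPair

/-- The constant relating `[w]_{A_∞}` and `[w]_{A_p}`. -/
def aInftyApConst (d : ℕ) (p : ℝ) : ℝ≥0∞ :=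
  6 ^ d * (2 ^ d * (ENNReal.ofReal (p / (p - 1)) ^ (p - 1) * ENNReal.ofReal p))

lemma aInftyApConst_ne_top {p : ℝ} (hp : 1 < p) : aInftyApConst d p ≠ ∞ := by
  have := ENNReal.rpow_ne_top_of_nonneg (y := p - 1) (by linarith)
    (ENNReal.ofReal_ne_top (r := p / (p - 1)))
  unfold aInftyApConst
  finiteness

/-- The bound for the weighted maximal operator `M^w_m` on `L^p(w)`, with `m = (1 + p) / 2`. -/
def weightedMaxConst (p : ℝ) : ℝ≥0∞ :=
  (ENNReal.ofReal (p / ((1 + p) / 2) / (p / ((1 + p) / 2) - 1)) ^ (p / ((1 + p) / 2))) ^ (1 / p)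

lemma weightedMaxConst_ne_top {p : ℝ} (hp : 1 < p) : weightedMaxConst p ≠ ∞ :=
  ENNReal.rpow_ne_top_of_nonneg (by positivity)
    (ENNReal.rpow_ne_top_of_nonneg (by positivity) ENNReal.ofReal_ne_top)

/-- The ratio of the sparse exponent `t` and the `A_∞` constants. -/
def bumpConst (d : ℕ) (p : ℝ) : ℝ :=
  2 ^ (d + 2) * ((1 + p) / 2 / ((1 + p) / 2 - 1)) +
    2 ^ (d + 2) * ((1 + p / (p - 1)) / 2 / ((1 + p / (p - 1)) / 2 - 1))

/-- The bilinear sparse bound behind the mixed `A_p`-`A_∞` estimate. -/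
lemma MuckenhouptPair.sum_lpAvg_le (hd : 1 ≤ d) {p : ℝ} (hp : 1 < p)
    {w σ : (Fin d → ℝ) → ℝ≥0∞} {A : ℝ≥0∞} (hw : MuckenhouptPair p w σ A) (hA : A ≠ ∞) {aσ aw : ℝ}
    (haσ : 1 ≤ aσ) (haw : 1 ≤ aw) (hσA : aInftyConst σ = ENNReal.ofReal aσ)
    (hwA : aInftyConst w = ENNReal.ofReal aw) {t : ℝ} (ht : bumpConst d p * max aσ aw ≤ t)
    {α : Fin d → Bool} {F : Finset (Set (Fin d → ℝ))} {E : Set (Fin d → ℝ) → Set (Fin d → ℝ)}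
    (h : GridSparse α F E) {f v : (Fin d → ℝ) → ℝ≥0∞} (hf : AEMeasurable f) (hv : AEMeasurable v) :
    ∑ Q ∈ F, volume (E Q) * (lpAvg (1 + 1 / t) f Q *
      lpAvg (1 + 1 / t) (fun x => v x * w x ^ (1 / p)) Q) ≤
      4 * (twoWeightConst p * A ^ (1 / p) *
        ((2 * 6 ^ d * aInftyConst σ) ^ (1 / p) + (2 * 6 ^ d * aInftyConst w) ^ (1 - 1 / p)) *
        (weightedMaxConst p * wNorm p w f *
          (weightedMaxConst (p / (p - 1)) * (∫⁻ x, v x ^ (p / (p - 1))) ^ (1 - 1 / p)))) := by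
  have hp0 : 0 < p := by linarith
  have hp1 : 0 < p - 1 := by linarith
  have hp' := one_sub_one_div_nonneg hp
  have hq1 : 1 < p / (p - 1) := by rw [lt_div_iff₀ hp1]; linarith
  have hpp : 1 / (p / (p - 1)) = 1 - 1 / p := by field_simp
  set q := p / (p - 1) with hq
  set m₁ := (1 + p) / 2 with hm₁
  set m₂ := (1 + q) / 2 with hm₂
  have hm₁1 : 1 < m₁ := by rw [hm₁]; linarith
  have hm₂1 : 1 < m₂ := by rw [hm₂]; linarith
  have hc₁ : 0 < 2 ^ (d + 2) * (m₁ / (m₁ - 1)) := by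
    have : 0 < m₁ - 1 := by linarith
    positivity
  have hc₂ : 0 < 2 ^ (d + 2) * (m₂ / (m₂ - 1)) := by
    have : 0 < m₂ - 1 := by linarith
    positivity
  have hb : bumpConst d p = 2 ^ (d + 2) * (m₁ / (m₁ - 1)) + 2 ^ (d + 2) * (m₂ / (m₂ - 1)) := rfl
  have ht₁ : 2 ^ (d + 2) * (m₁ / (m₁ - 1)) * aσ ≤ t := by
    refine le_trans ?_ ht
    have := le_max_left aσ aw
    rw [hb]
    exact mul_le_mul (by linarith) this (by linarith) (by linarith)
  have ht₂ : 2 ^ (d + 2) * (m₂ / (m₂ - 1)) * aw ≤ t := by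
    refine le_trans ?_ ht
    have := le_max_right aσ aw
    rw [hb]
    exact mul_le_mul (by linarith) this (by linarith) (by linarith)
  -- The substitutions f = η σ and v w^(1/p) = g w are isometric from L^p(w) to L^p(σ) and from
  -- L^(p') to L^(p')(w), which makes the problem symmetric in the two weights.
  set η : (Fin d → ℝ) → ℝ≥0∞ := fun x => f x * (σ x)⁻¹ with hη
  set g : (Fin d → ℝ) → ℝ≥0∞ := fun x => v x * w x ^ (1 / p - 1) with hg
  have hηm : AEMeasurable η := hf.mul hw.aemeasurable_right.inv
  have hgm : AEMeasurable g := hv.mul (hw.aemeasurable_left.pow_const _)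
  have hfη : f =ᵐ[volume] fun x => η x * σ x := by
    filter_upwards [hw.ae_right] with x ⟨h0, htop⟩
    simp only [hη]
    rw [mul_assoc, ENNReal.inv_mul_cancel h0 htop, mul_one]
  have hvg : (fun x => v x * w x ^ (1 / p)) =ᵐ[volume] fun x => g x * w x := by
    filter_upwards [hw.ae_dual] with x ⟨h0, htop, _⟩
    simp only [hg]
    nth_rewrite 3 [← ENNReal.rpow_one (w x)]
    rw [mul_assoc, ← ENNReal.rpow_add _ _ h0 htop, sub_add_cancel]
  have hηnorm : ∫⁻ x, η x ^ p * σ x = ∫⁻ x, f x ^ p * w x := by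
    refine lintegral_congr_ae ?_
    filter_upwards [hw.ae_dual, hw.ae_right] with x ⟨h0, htop, hx⟩ ⟨h0', htop'⟩
    simp only [hη]
    rw [ENNReal.mul_rpow_of_nonneg _ _ hp0.le, mul_assoc]
    congr 1
    rw [hx, ← ENNReal.rpow_neg_one, ← ENNReal.rpow_mul, ← ENNReal.rpow_mul,
      ← ENNReal.rpow_add _ _ h0 htop,
      show -(1 / (p - 1)) * (-1 * p) + -(1 / (p - 1)) = 1 by field_simp; ring, ENNReal.rpow_one]
  have hgnorm : ∫⁻ x, g x ^ q * w x = ∫⁻ x, v x ^ q := by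
    refine lintegral_congr_ae ?_
    filter_upwards [hw.ae_dual] with x ⟨h0, htop, _⟩
    simp only [hg]
    nth_rewrite 2 [← ENNReal.rpow_one (w x)]
    rw [ENNReal.mul_rpow_of_nonneg _ _ (by linarith), mul_assoc, ← ENNReal.rpow_mul,
      ← ENNReal.rpow_add _ _ h0 htop,
      show (1 / p - 1) * q + 1 = 0 by rw [hq]; field_simp; ring, ENNReal.rpow_zero, mul_one]
  set H := weightedAvg m₁ σ η
  set G := weightedAvg m₂ w g
  have hterm : ∀ Q ∈ F, volume (E Q) * (lpAvg (1 + 1 / t) f Q *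
      lpAvg (1 + 1 / t) (fun x => v x * w x ^ (1 / p)) Q) ≤
      4 * (volume (E Q) * (lpAvg 1 σ Q * lpAvg 1 w Q) * (H Q * G Q)) := by
    intro Q hQ
    have hQg := h.mem_grid Q hQ
    have hQc := h.isCube Q hQ
    rw [lpAvg_congr_ae hfη, lpAvg_congr_ae hvg]
    calc _ ≤ volume (E Q) * ((2 * (lpAvg 1 σ Q * H Q)) * (2 * (lpAvg 1 w Q * G Q))) := by
          refine mul_le_mul_right (mul_le_mul' ?_ ?_) _
          · exact lpAvg_mul_le_weightedAvg hd hw.aemeasurable_right haσ hσA hm₁1 ht₁ hQg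
              (hw.lintegral_right_ne_zero hp hQc) (hw.right_ne_top Q hQc) hηm
          · exact lpAvg_mul_le_weightedAvg hd hw.aemeasurable_left haw hwA hm₂1 ht₂ hQg
              (hw.lintegral_left_ne_zero hQc) (hw.left_ne_top Q hQc) hgm
      _ = _ := by ring
  have hHM := lintegral_mul_maxOn_weightedAvg_le h.laminar h.isCube hw.aemeasurable_right
    hw.right_ne_top (by linarith : 0 < m₁) (by rw [hm₁]; linarith : m₁ < p) hηm
  have hGM := lintegral_mul_maxOn_weightedAvg_le h.laminar h.isCube hw.aemeasurable_left
    hw.left_ne_top (by linarith : 0 < m₂) (by rw [hm₂]; linarith : m₂ < q) hgm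
  rw [hηnorm] at hHM
  rw [hgnorm] at hGM
  calc _ ≤ ∑ Q ∈ F, 4 * (volume (E Q) * (lpAvg 1 σ Q * lpAvg 1 w Q) * (H Q * G Q)) :=
        Finset.sum_le_sum hterm
    _ = 4 * ∑ Q ∈ F, volume (E Q) * (lpAvg 1 σ Q * lpAvg 1 w Q) * (H Q * G Q) := by
        rw [Finset.mul_sum]
    _ ≤ 4 * (twoWeightConst p * A ^ (1 / p) *
        ((2 * 6 ^ d * aInftyConst σ) ^ (1 / p) + (2 * 6 ^ d * aInftyConst w) ^ (1 - 1 / p)) *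
        ((∫⁻ x, σ x * maxOn F H x ^ p) ^ (1 / p) *
          (∫⁻ x, w x * maxOn F G x ^ q) ^ (1 - 1 / p))) := by
        refine mul_le_mul_right (hw.sum_mul_le hp hA h.toCarried h.volume_le ?_ ?_ H G) _
        · rw [hσA]; exact ENNReal.ofReal_ne_top
        · rw [hwA]; exact ENNReal.ofReal_ne_top
    _ ≤ _ := by
        refine mul_le_mul_right (mul_le_mul_right (mul_le_mul' ?_ ?_) _) _
        · rw [weightedMaxConst, wNorm, ← ENNReal.mul_rpow_of_nonneg _ _ (by positivity)]
          exact ENNReal.rpow_le_rpow hHM (by positivity)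
        · rw [weightedMaxConst, hpp, ← ENNReal.mul_rpow_of_nonneg _ _ hp']
          exact ENNReal.rpow_le_rpow hGM hp'

lemma rpow_le_self_of_one_le {x : ℝ≥0∞} (hx : 1 ≤ x) {θ : ℝ} (hθ : θ ≤ 1) : x ^ θ ≤ x := by
  calc x ^ θ ≤ x ^ (1 : ℝ) := ENNReal.rpow_le_rpow_of_exponent_le hx hθ
    _ = x := ENNReal.rpow_one x

lemma one_lt_bumpConst {p : ℝ} (hp : 1 < p) : 1 < bumpConst d p := by
  have hp1 : 0 < p - 1 := by linarith
  have hq1 : 1 < p / (p - 1) := by rw [lt_div_iff₀ hp1]; linarith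
  have h2 : (1 : ℝ) ≤ 2 ^ (d + 2) := one_le_pow₀ (by norm_num)
  have key : ∀ m : ℝ, 1 < m → 1 < m / (m - 1) := fun m hm => by
    rw [lt_div_iff₀ (by linarith)]; linarith
  have h₁ := key ((1 + p) / 2) (by linarith)
  have h₂ := key ((1 + p / (p - 1)) / 2) (by linarith)
  unfold bumpConst
  nlinarith

/-- The constant in the mixed `A_p`-`A_∞` estimate. -/
def mixedApConst (d : ℕ) (p : ℝ) : ℝ≥0∞ :=
  ENNReal.ofReal (bumpConst d p) * reductionConst d * 4 * twoWeightConst p * weightedMaxConst p *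
    weightedMaxConst (p / (p - 1)) * (2 * 6 ^ d * (1 + aInftyApConst d p)) + 1

lemma mixedApConst_ne_top {p : ℝ} (hp : 1 < p) : mixedApConst d p ≠ ∞ := by
  have hp1 : 0 < p - 1 := by linarith
  have := twoWeightConst_ne_top hp
  have := weightedMaxConst_ne_top hp
  have := weightedMaxConst_ne_top (p := p / (p - 1)) (by rw [lt_div_iff₀ hp1]; linarith)
  have := aInftyApConst_ne_top (d := d) hp
  unfold mixedApConst
  finiteness

/-- Both weights need reverse Hölder, so t is a multiple of the larger A_∞ constant, and that is the
last factor. The two-weight estimate supplies the rest, with the A_∞ constant of w inside the sum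
traded for `A`. -/
lemma mixedAp_of_ne_top (hd : 1 ≤ d) {p : ℝ} (hp : 1 < p)
    {T : ((Fin d → ℝ) → ℂ) → ((Fin d → ℝ) → ℂ)} {C : ℝ≥0} (hT : HasLinearSparseGrowth T C)
    {w σ : (Fin d → ℝ) → ℝ≥0∞} {A : ℝ≥0∞} (hw : MuckenhouptPair p w σ A) (hA : A ≠ ∞)
    {f : (Fin d → ℝ) → ℂ} (hf : IsBddCompSupp f) (hfin : wNorm p w (absFun f) ≠ ∞) :
    wNorm p w (absFun (T f)) ≤ mixedApConst d p * C *
      (A ^ (1 / p) * (A ^ (1 - 1 / p) + aInftyConst σ ^ (1 / p)) *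
        max (aInftyConst σ) (aInftyConst w)) * wNorm p w (absFun f) := by
  have hp0 : 0 < p := by linarith
  have hp1 : 0 < p - 1 := by linarith
  have hq1 : 1 < p / (p - 1) := by rw [lt_div_iff₀ hp1]; linarith
  have hp' := one_sub_one_div_nonneg hp
  have hip : 1 / p ≤ 1 := by rw [div_le_one hp0]; exact hp.le
  have hip' : 1 - 1 / p ≤ 1 := by
    have : 0 < 1 / p := by positivity
    linarith
  have hwK : aInftyConst w ≤ aInftyApConst d p * A := hw.aInftyConst_le hp
  have hKfin := aInftyApConst_ne_top (d := d) hp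
  have hwA : aInftyConst w ≠ ∞ := ne_top_of_le_ne_top (ENNReal.mul_ne_top hKfin hA) hwK
  have hσA : aInftyConst σ ≠ ∞ := by
    refine ne_top_of_le_ne_top (ENNReal.mul_ne_top (aInftyApConst_ne_top (d := d) hq1) ?_)
      ((hw.symm hp).aInftyConst_le hq1)
    exact ENNReal.rpow_ne_top_of_nonneg (by positivity) hA
  set aw := (aInftyConst w).toReal
  set aσ := (aInftyConst σ).toReal
  have hwa : aInftyConst w = ENNReal.ofReal aw := (ENNReal.ofReal_toReal hwA).symm
  have hσa : aInftyConst σ = ENNReal.ofReal aσ := (ENNReal.ofReal_toReal hσA).symm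
  have haw : 1 ≤ aw := by
    have := hw.one_le_aInftyConst_left
    rwa [hwa, ENNReal.one_le_ofReal] at this
  have haσ : 1 ≤ aσ := by
    have := (hw.symm hp).one_le_aInftyConst_left
    rwa [hσa, ENNReal.one_le_ofReal] at this
  have hb := one_lt_bumpConst (d := d) hp
  set t := bumpConst d p * max aσ aw with ht
  have ht1 : 1 < t := by
    have : 1 ≤ max aσ aw := haσ.trans (le_max_left _ _)
    rw [ht]; nlinarith
  set Λ : ℝ≥0∞ := 2 * 6 ^ d with hΛ
  have hΛ1 : 1 ≤ Λ := by
    calc (1 : ℝ≥0∞) = 1 * 1 := by norm_num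
      _ ≤ Λ := by
        rw [hΛ]
        gcongr
        · norm_num
        · exact one_le_pow₀ (by norm_num)
  have hΛfin : Λ ≠ ∞ := by rw [hΛ]; finiteness
  set Z := (Λ * aInftyConst σ) ^ (1 / p) + (Λ * aInftyConst w) ^ (1 - 1 / p) with hZ
  have hZle : Z ≤ Λ * (1 + aInftyApConst d p) * (A ^ (1 - 1 / p) + aInftyConst σ ^ (1 / p)) := by
    rw [mul_add, add_comm]
    refine add_le_add ?_ ?_
    · rw [ENNReal.mul_rpow_of_nonneg _ _ (by positivity)]
      gcongr
      calc Λ ^ (1 / p) ≤ Λ := rpow_le_self_of_one_le hΛ1 hip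
        _ ≤ Λ * (1 + aInftyApConst d p) := le_mul_of_one_le_right' le_self_add
    · calc (Λ * aInftyConst w) ^ (1 - 1 / p)
          ≤ (Λ * ((1 + aInftyApConst d p) * A)) ^ (1 - 1 / p) := by
            gcongr
            exact hwK.trans (mul_le_mul_left le_add_self _)
        _ = (Λ * (1 + aInftyApConst d p)) ^ (1 - 1 / p) * A ^ (1 - 1 / p) := by
            rw [← mul_assoc, ENNReal.mul_rpow_of_nonneg _ _ hp']
        _ ≤ _ := by
            gcongr
            exact rpow_le_self_of_one_le (hΛ1.trans (le_mul_of_one_le_right' le_self_add)) hip'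
  set D₁ := weightedMaxConst p
  set D₂ := weightedMaxConst (p / (p - 1))
  have hwne : ∀ᵐ x, w x ≠ ∞ := by
    filter_upwards [hw.ae_dual] with x hx using hx.2.1
  have main := wNorm_le_of_sparse hT ht1 hp hf hw.aemeasurable_left hwne
    (N := 4 * (twoWeightConst p * A ^ (1 / p) * Z * (D₁ * wNorm p w (absFun f) * D₂)))
    (by
      have h1 := twoWeightConst_ne_top hp
      have h2 : D₁ ≠ ∞ := weightedMaxConst_ne_top hp
      have h3 : D₂ ≠ ∞ := weightedMaxConst_ne_top hq1
      have h4 : A ^ (1 / p) ≠ ∞ := ENNReal.rpow_ne_top_of_nonneg (by positivity) hA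
      have h5 : Z ≠ ∞ := ENNReal.add_ne_top.mpr
        ⟨ENNReal.rpow_ne_top_of_nonneg (by positivity) (ENNReal.mul_ne_top hΛfin hσA),
          ENNReal.rpow_ne_top_of_nonneg hp' (ENNReal.mul_ne_top hΛfin hwA)⟩
      finiteness) (fun α F E hFE v hv =>
      (hw.sum_lpAvg_le hd hp hA haσ haw hσa hwa le_rfl hFE hf.aemeasurable_absFun hv).trans_eq
        (by ring))
  have htm : ENNReal.ofReal t = ENNReal.ofReal (bumpConst d p) *
      max (aInftyConst σ) (aInftyConst w) := by
    rw [ht, ENNReal.ofReal_mul (by linarith), hσa, hwa,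
      ENNReal.ofReal_mono.map_max]
  refine main.trans ?_
  rw [htm]
  calc _ ≤ C * (ENNReal.ofReal (bumpConst d p) * max (aInftyConst σ) (aInftyConst w)) *
        (reductionConst d * (4 * (twoWeightConst p * A ^ (1 / p) *
          (Λ * (1 + aInftyApConst d p) * (A ^ (1 - 1 / p) + aInftyConst σ ^ (1 / p))) *
          (D₁ * wNorm p w (absFun f) * D₂)))) := by gcongr
    _ = (ENNReal.ofReal (bumpConst d p) * reductionConst d * 4 * twoWeightConst p * D₁ * D₂ *
          (Λ * (1 + aInftyApConst d p))) * C *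
        (A ^ (1 / p) * (A ^ (1 - 1 / p) + aInftyConst σ ^ (1 / p)) *
          max (aInftyConst σ) (aInftyConst w)) * wNorm p w (absFun f) := by ring
    _ ≤ _ := by
        gcongr
        exact le_self_add

theorem mixedAp (hd : 1 ≤ d) {p : ℝ} (hp : 1 < p)
    {T : ((Fin d → ℝ) → ℂ) → ((Fin d → ℝ) → ℂ)} {C : ℝ≥0} (hT : HasLinearSparseGrowth T C)
    {w σ : (Fin d → ℝ) → ℝ≥0∞} {A : ℝ≥0∞} (hw : MuckenhouptPair p w σ A) (hA : A ≠ ∞)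
    {f : (Fin d → ℝ) → ℂ} (hf : IsBddCompSupp f) :
    wNorm p w (absFun (T f)) ≤ mixedApConst d p * C *
      (A ^ (1 / p) * (A ^ (1 - 1 / p) + aInftyConst σ ^ (1 / p)) *
        max (aInftyConst σ) (aInftyConst w)) * wNorm p w (absFun f) := by
  have hK := ENNReal.coe_toNNReal (mixedApConst_ne_top (d := d) hp)
  have key := mixedAp_of_ne_top hd hp hT hw hA hf
  rw [← hK] at key ⊢
  refine wNorm_le_of_finite hT hf hp ?_ ?_ key
  -- The summand 1 in `mixedApConst` is there only to make the constant visibly nonzero.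
  · intro h0
    rw [h0] at hK
    rw [mixedApConst, ENNReal.coe_zero] at hK
    exact one_ne_zero (add_eq_zero.mp hK.symm).2
  · have hA1 := hw.one_le hp
    have hA0 : A ≠ 0 := (zero_lt_one.trans_le hA1).ne'
    have h1 := (zero_lt_one.trans_le hw.one_le_aInftyConst_left).ne'
    refine mul_ne_zero (mul_ne_zero ?_ ?_) ?_
    · simp [ENNReal.rpow_eq_zero_iff, hA0, hA]
    · intro h
      rw [add_eq_zero] at h
      simp [ENNReal.rpow_eq_zero_iff, hA0, hA] at h
    · intro h
      exact h1 (le_antisymm ((le_max_right _ _).trans h.le) zero_le)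

/-- The factor in the mixed estimate is controlled by a power of the `A_p` constant. -/
lemma MuckenhouptPair.mixed_factor_le {p : ℝ} (hp : 1 < p) {w σ : (Fin d → ℝ) → ℝ≥0∞} {A : ℝ≥0∞}
    (hw : MuckenhouptPair p w σ A) :
    A ^ (1 / p) * (A ^ (1 - 1 / p) + aInftyConst σ ^ (1 / p)) *
        max (aInftyConst σ) (aInftyConst w) ≤
      (1 + aInftyApConst d (p / (p - 1)) ^ (1 / p)) *
        (aInftyApConst d (p / (p - 1)) + aInftyApConst d p) *
        A ^ (2 * max 1 (1 / (p - 1))) := by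
  have hp0 : 0 < p := by linarith
  have hp1 : 0 < p - 1 := by linarith
  have hq1 : 1 < p / (p - 1) := by rw [lt_div_iff₀ hp1]; linarith
  have hp' := one_sub_one_div_nonneg hp
  have hA1 := hw.one_le hp
  have hwK : aInftyConst w ≤ aInftyApConst d p * A := hw.aInftyConst_le hp
  have hσK : aInftyConst σ ≤ aInftyApConst d (p / (p - 1)) * A ^ (1 / (p - 1)) :=
    (hw.symm hp).aInftyConst_le hq1
  set μ := max 1 (1 / (p - 1))
  set K₁ := aInftyApConst d p
  set K₂ := aInftyApConst d (p / (p - 1))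
  have hμ0 : 0 ≤ μ := zero_le_one.trans (le_max_left _ _)
  have hB₁ : A ≤ A ^ μ := by
    nth_rewrite 1 [← ENNReal.rpow_one A]
    exact ENNReal.rpow_le_rpow_of_exponent_le hA1 (le_max_left _ _)
  have hB₂ : A ^ (1 / (p - 1)) ≤ A ^ μ :=
    ENNReal.rpow_le_rpow_of_exponent_le hA1 (le_max_right _ _)
  have e1 : A ^ (1 / p) * A ^ (1 - 1 / p) = A := by
    rw [← ENNReal.rpow_add_of_nonneg _ _ (by positivity) hp']; simp
  -- The A_p constant of σ is A^(1/(p-1)), so each of the two factors is at most a multiple of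
  -- A^(max(1, 1/(p-1))).
  have e2 : A ^ (1 / p) * (A ^ (1 / (p - 1))) ^ (1 / p) = A ^ (1 / (p - 1)) := by
    rw [← ENNReal.rpow_mul, ← ENNReal.rpow_add_of_nonneg _ _ (by positivity) (by positivity)]
    congr 1
    field_simp
    ring
  have h1 : A ^ (1 / p) * (A ^ (1 - 1 / p) + aInftyConst σ ^ (1 / p)) ≤
      (1 + K₂ ^ (1 / p)) * A ^ μ := by
    calc _ ≤ A ^ (1 / p) * (A ^ (1 - 1 / p) + (K₂ * A ^ (1 / (p - 1))) ^ (1 / p)) := by gcongr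
      _ = A + K₂ ^ (1 / p) * A ^ (1 / (p - 1)) := by
          rw [mul_add, e1, ENNReal.mul_rpow_of_nonneg _ _ (by positivity), mul_left_comm, e2]
      _ ≤ A ^ μ + K₂ ^ (1 / p) * A ^ μ := by gcongr
      _ = _ := by ring
  have h2 : max (aInftyConst σ) (aInftyConst w) ≤ (K₂ + K₁) * A ^ μ := by
    rw [add_mul]
    refine max_le ?_ ?_
    · exact (hσK.trans (mul_le_mul_right hB₂ _)).trans le_self_add
    · exact (hwK.trans (mul_le_mul_right hB₁ _)).trans le_add_self
  calc _ ≤ ((1 + K₂ ^ (1 / p)) * A ^ μ) * ((K₂ + K₁) * A ^ μ) := mul_le_mul' h1 h2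
    _ = _ := by
        rw [two_mul, ENNReal.rpow_add_of_nonneg _ _ hμ0 hμ0]; ring

/-- Both forms of the `A_p` estimate, with a common constant. -/
theorem exists_mixedAp (hd : 1 ≤ d) {p : ℝ} (hp : 1 < p) :
    ∃ K : ℝ≥0, ∀ (T : ((Fin d → ℝ) → ℂ) → ((Fin d → ℝ) → ℂ)) (C : ℝ≥0),
      HasLinearSparseGrowth T C → ∀ w : (Fin d → ℝ) → ℝ≥0∞, IsWeight w → apConst p w < ∞ →
      ∀ f : (Fin d → ℝ) → ℂ, IsBddCompSupp f →
        wNorm p w (absFun (T f)) ≤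
            K * C * (apConst p w ^ (1 / p) *
              (apConst p w ^ (1 - 1 / p) + aInftyConst (dualWeight p w) ^ (1 / p)) *
              max (aInftyConst (dualWeight p w)) (aInftyConst w)) *
              wNorm p w (absFun f) ∧
        wNorm p w (absFun (T f)) ≤
            K * C * apConst p w ^ (2 * max 1 (1 / (p - 1))) * wNorm p w (absFun f) := by
  have hp1 : 0 < p - 1 := by linarith
  have hq1 : 1 < p / (p - 1) := by rw [lt_div_iff₀ hp1]; linarith
  set Γ : ℝ≥0∞ := (1 + aInftyApConst d (p / (p - 1)) ^ (1 / p)) *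
    (aInftyApConst d (p / (p - 1)) + aInftyApConst d p) with hΓ
  have hΓfin : Γ ≠ ∞ := by
    have h1 := aInftyApConst_ne_top (d := d) hp
    have h2 := aInftyApConst_ne_top (d := d) hq1
    have h3 := ENNReal.rpow_ne_top_of_nonneg (y := 1 / p) (by positivity) h2
    rw [hΓ]
    finiteness
  have hK := ENNReal.coe_toNNReal
    (ENNReal.mul_ne_top (mixedApConst_ne_top (d := d) hp) (b := 1 + Γ) (by finiteness))
  refine ⟨(mixedApConst d p * (1 + Γ)).toNNReal, fun T C hT w hw hA f hf => ?_⟩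
  rw [hK]
  by_cases h0 : w =ᵐ[volume] 0
  · rw [wNorm_eq_zero hp h0]
    exact ⟨zero_le, zero_le⟩
  have hpair := muckenhouptPair hp hw hA h0
  have main := mixedAp hd hp hT hpair hA.ne hf
  refine ⟨main.trans ?_, main.trans ?_⟩
  · gcongr
    exact le_mul_of_one_le_right' le_self_add
  · calc _ ≤ mixedApConst d p * C * (Γ * apConst p w ^ (2 * max 1 (1 / (p - 1)))) *
          wNorm p w (absFun f) := by
          refine mul_le_mul_left (mul_le_mul_right ?_ _) _
          exact hpair.mixed_factor_le hp
      _ = (mixedApConst d p * Γ) * C * apConst p w ^ (2 * max 1 (1 / (p - 1))) *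
          wNorm p w (absFun f) := by ring
      _ ≤ _ := by
          gcongr
          exact le_add_self

end SparseBounds

end

theorem theorem1p3 (d : ℕ) (hd : 1 ≤ d) :
    -- 1. mixed bound, and its consequence in terms of the `A_p` constant alone
    (∀ p : ℝ, 1 < p → ∃ K : ℝ≥0,
      ∀ (T : ((Fin d → ℝ) → ℂ) → ((Fin d → ℝ) → ℂ)) (C : ℝ≥0), HasLinearSparseGrowth T C →
      ∀ w : (Fin d → ℝ) → ℝ≥0∞, IsWeight w → apConst p w < ∞ →
      ∀ f : (Fin d → ℝ) → ℂ, IsBddCompSupp f →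
        wNorm p w (absFun (T f)) ≤
            K * C * (apConst p w ^ (1 / p) *
              (apConst p w ^ (1 - 1 / p) + aInftyConst (dualWeight p w) ^ (1 / p)) *
              max (aInftyConst (dualWeight p w)) (aInftyConst w)) *
              wNorm p w (absFun f) ∧
        wNorm p w (absFun (T f)) ≤
            K * C * apConst p w ^ (2 * max 1 (1 / (p - 1))) * wNorm p w (absFun f)) ∧
    -- 2. Fefferman-Stein inequality; `p' = p / (p - 1)`, `r' = r / (r - 1)`
    (∃ K : ℝ≥0, ∀ p r : ℝ, 1 < r → r < p →
      ∀ (T : ((Fin d → ℝ) → ℂ) → ((Fin d → ℝ) → ℂ)) (C : ℝ≥0), HasLinearSparseGrowth T C →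
      ∀ w : (Fin d → ℝ) → ℝ≥0∞, IsWeight w →
      ∀ f : (Fin d → ℝ) → ℂ, IsBddCompSupp f →
        wNorm p w (absFun (T f)) ≤
          K * C * ENNReal.ofReal (p ^ 2 * (p / (p - 1)) ^ (1 / p) *
            (r / (r - 1)) ^ (1 + (1 - 1 / p))) * wNorm p (maximalFn r w) (absFun f)) ∧
    -- 3. `A_q`-`A_∞` estimate
    (∀ p q : ℝ, 1 ≤ q → q < p → ∃ K : ℝ≥0,
      ∀ (T : ((Fin d → ℝ) → ℂ) → ((Fin d → ℝ) → ℂ)) (C : ℝ≥0), HasLinearSparseGrowth T C →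
      ∀ w : (Fin d → ℝ) → ℝ≥0∞, IsWeight w → apConst q w < ∞ →
      ∀ f : (Fin d → ℝ) → ℂ, IsBddCompSupp f →
        wNorm p w (absFun (T f)) ≤
          K * C * (apConst q w ^ (1 / p) * aInftyConst w ^ (1 + (1 - 1 / p))) *
            wNorm p w (absFun f)) ∧
    -- 4. Coifman-Fefferman inequality
    (∀ p : ℝ, 1 < p → ∃ K : ℝ≥0,
      ∀ (T : ((Fin d → ℝ) → ℂ) → ((Fin d → ℝ) → ℂ)) (C : ℝ≥0), HasLinearSparseGrowth T C →
      ∀ w : (Fin d → ℝ) → ℝ≥0∞, IsWeight w → aInftyConst w < ∞ →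
      ∀ (ε : ℝ), 0 < ε →
      ∀ f : (Fin d → ℝ) → ℂ, IsBddCompSupp f →
        wNorm p w (absFun (T f)) ≤
          K * C * (ENNReal.ofReal ((1 + ε) / ε) * aInftyConst w ^ 2) *
            wNorm p w (maximalFn (1 + ε) (absFun f))) := by
  refine ⟨fun p hp => exists_mixedAp hd hp,
    ⟨72 * reductionConst d, fun p r hr hrp T C hT w hw f hf => feffermanStein hr hrp hT hw hf⟩,
    fun p q hq hqp => ⟨mixedAqConst d p q, fun T C hT w hw hA f hf =>
      mixedAq hd hq hqp hT hw hA hf⟩,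
    fun p hp => ⟨_, fun T C hT w hw hA ε hε f hf => coifmanFefferman hd hp hT hw hA hε hf⟩⟩
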